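/- Let $I=[0,1]$ and let $f_1,f_2:I\to\mathbb R^N$ be continuous piecewise linear curves, linear on the pieces of subdivisions $0=s_0<\dots<s_m=1$ and $0=t_0<\dots<t_n=1$ respectively. Let $q_k=f_k'/\sqrt{|f_k'|}$ (with value $0$ where $f_k'=0$), let $u_i$ be the constant value of $q_1$ on $(s_{i-1},s_i)$, $v_j$ that of $q_2$ on $(t_{j-1},t_j)$, and $W_{ij}=u_i\cdot v_j$ for $1\le i\le m$, $1\le j\le n$. Points $(s_i,t_j)$ are called vertices and $G_{ij}=[s_{i-1},s_i]\times[t_{j-1},t_j]$ blocks. Let $\tilde\Gamma$ (resp. $\Gamma$) be the set of absolutely continuous $\gamma:I\to I$ with $\gamma(0)=0$, $\gamma(1)=1$ and $\gamma'\ge0$ (resp. $\gamma'>0$) a.e.; put $(q*\gamma)(x)=\sqrt{\gamma'(x)}\,q(\gamma(x))$, let $[q]$ be the closure of $q*\Gamma$ in $L^2(I,\mathbb R^N)$, and let $d([q_1],[q_2])$ be the infimum of $\|w_1-w_2\|_{L^2}$ over $w_1\in[q_1]$, $w_2\in[q_2]$. An optimal matching is a map $\gamma=(\gamma_1,\gamma_2):I\to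 I\times I$ with $\gamma_1,\gamma_2\in\tilde\Gamma$, $q_k*\gamma_k\in[q_k]$ and $\|q_1*\gamma_1-q_2*\gamma_2\|_{L^2}=d([q_1],[q_2])$. The slope of $\gamma$ on an interval where it is linear and non-constant is $\gamma_2'/\gamma_1'\in[0,\infty]$. For a segment $\gamma|_{[a,b]}$ ($0\le a<b\le1$) we say that it passes through $G_{ij}$ if $\{z\in[a,b]:\gamma(z)\in G_{ij}\}$ is an interval $[c,d]$ with $c<d$, and when $\gamma$ is linear there $H_{ij}$ denotes its slope on $[c,d]$. P-segment: $\gamma|_{[a,b]}$ is piecewise linear and injective; $\gamma(a)=(s_{i_0-1},t_{j_0-1})$ and $\gamma(b)=(s_{i_1},t_{j_1})$ with $1\le i_0\le i_1\le m$, $1\le j_0\le j_1\le n$, $W_{i_0j_0}>0$, $W_{i_1j_1}>0$, and no $\gamma(z)$ with $a<z<b$ is a vertex; $\gamma$ is linear in each block it passes through; if it passes through $G_{ij}$ and $W_{ij}>0$ then $0<H_{ij}<\infty$, while if $W_{ij}\le0$ then $H_{ij}=0$ when $\gamma$ enters $G_{ij}$ through its left edge and $H_{ij}=\infty$ when it enters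 through its lower edge, and one of these two values is taken. When the segment passes from $G_{ij}$ to $G_{i+1,j}$: if $W_{i+1,j}\le0$ then $H_{i+1,j}=0$; if $W_{i+1,j}>0$ then $H_{i+1,j}/H_{kj}=(W_{i+1,j}/W_{kj})^2$, where $k\le i$ is the largest index with $W_{kj}>0$ (so $k=i$ if $W_{ij}>0$; such a $k$ exists and the segment passes through $G_{kj}$). When it passes from $G_{ij}$ to $G_{i,j+1}$: if $W_{i,j+1}\le0$ then $H_{i,j+1}=\infty$; if $W_{i,j+1}>0$ then $H_{i,j+1}/H_{ik}=(W_{ik}/W_{i,j+1})^2$, where $k\le j$ is the largest index with $W_{ik}>0$ (again such a $k$ exists and the segment passes through $G_{ik}$). N-segment: $\gamma(a)=(s_{i_0},t_{j_0})$ and $\gamma(b)=(s_{i_1},t_{j_1})$ are distinct vertices with $i_0\le i_1$, $j_0\le j_1$; $\gamma$ runs linearly and horizontally to $(s_{i_1},t_{j_0})$ on $[a,\frac{a+b}2]$ and then linearly and vertically on $[\frac{a+b}2,b]$ (if $i_0=i_1$ or $j_0=j_1$, $\gamma$ is simply linear on $[a,b]$); and $W_{ij}\le0$ for all blocks with $i_0+1\le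 i\le i_1$, $j_0\le j\le j_1+1$ and for all blocks with $i_0\le i\le i_1+1$, $j_0+1\le j\le j_1$. Theorem. There is an optimal matching $\gamma=(\gamma_1,\gamma_2)$ such that: (1) there is a partition $0=u_0<u_1<\dots<u_k=1$ such that each $\gamma|_{[u_{i-1},u_i]}$ is a P-segment or an N-segment; (2) no two consecutive pieces of this partition are both N-segments; (3) whenever $\gamma|_{[u_1,u_2]}$ and $\gamma|_{[u_3,u_4]}$ are P-segments and either $u_2=u_3$ or $\gamma|_{[u_2,u_3]}$ is an N-segment, with $\gamma(u_2)=(s_{i_1},t_{j_1})$ and $\gamma(u_3)=(s_{i_2},t_{j_2})$, then, writing $A=W_{i_1,j_1}$, $B=W_{i_2+1,j_2+1}$, $C=W_{i_1,j_2+1}$, $D=W_{i_2+1,j_1}$, the final slope $H_{i_1,j_1}$ of the first P-segment and the initial slope $H_{i_2+1,j_2+1}$ of the second satisfy $H_{i_2+1,j_2+1}=\mu^2H_{i_1,j_1}$ with $$\mu\in\begin{cases}\left[\frac{D^2}{AB},\frac{AB}{C^2}\right]&\text{if }C>0,\ D>0,\\[2pt] \left[0,\frac{AB}{C^2}\right]&\text{if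 }C>0,\ D\le0,\\[2pt] \left[\frac{D^2}{AB},\infty\right]&\text{if }C\le0,\ D>0,\\[2pt] [0,\infty]&\text{if }C\le0,\ D\le0.\end{cases}$$ Moreover, if (for vertices $(s_{i_1},t_{j_1})$ and $(s_{i_2},t_{j_2})$ with $1\le i_1\le m$, $1\le j_1\le n$, $i_2<m$, $j_2<n$) $A,B,C,D$ are all positive and $CD>AB$, then the interval prescribed for $\mu$ is empty, and there is no optimal matching of $f_1,f_2$ that has a P-segment ending at $(s_{i_1},t_{j_1})$ and a P-segment beginning at $(s_{i_2},t_{j_2})$ which is adjacent to it or separated from it by a single N-segment. -/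

import Mathlib

open Set MeasureTheory
open scoped ENNReal

namespace ElasticMatching

noncomputable section

/-! ### Partitions and piecewise linear functions -/

/-- `a = u 0 < u 1 < ⋯ < u k = b`. -/
def IsPartition (a b : ℝ) (k : ℕ) (u : ℕ → ℝ) : Prop :=
  u 0 = a ∧ u k = b ∧ ∀ i < k, u i < u (i + 1)

/-- `g` is linear (that is, affine) on `[a, b]`. -/
def LinearOn {F : Type*} [AddCommGroup F] [Module ℝ F] (g : ℝ → F) (a b : ℝ) : Prop :=
  ∃ p v : F, ∀ x ∈ Icc a b, g x = p + x • v

/-- `g` is (continuous and) piecewise linear on `[a, b]`. -/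
def PiecewiseLinearOn {F : Type*} [AddCommGroup F] [Module ℝ F] (g : ℝ → F) (a b : ℝ) : Prop :=
  ∃ (k : ℕ) (u : ℕ → ℝ), IsPartition a b k u ∧ ∀ i < k, LinearOn g (u i) (u (i + 1))

/-- A continuous piecewise linear curve `[0,1] → ℝ^N`, together with a subdivision
`0 = node 0 < ⋯ < node num = 1` on each closed piece of which it is linear.
Values of `toFun` outside `[0,1]` play no role. -/
structure PLCurve (N : ℕ) where
  toFun : ℝ → EuclideanSpace ℝ (Fin N)
  num : ℕ
  node : ℕ → ℝ
  isPartition : IsPartition 0 1 num node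
  linear : ∀ i < num, LinearOn toFun (node i) (node (i + 1))

/-! ### Square root velocity functions, reparametrizations, closed orbits -/

/-- Lebesgue measure on `I = [0,1]`. -/
abbrev volI : Measure ℝ := volume.restrict (Icc 0 1)

/-- `L²(I, ℝ^N)`. -/
abbrev L2 (N : ℕ) : Type := Lp (EuclideanSpace ℝ (Fin N)) 2 volI

/-- `V x = x / √|x|` for `x ≠ 0` and `V 0 = 0`. -/
def rootNormalize {N : ℕ} (x : EuclideanSpace ℝ (Fin N)) : EuclideanSpace ℝ (Fin N) :=
  (Real.sqrt ‖x‖)⁻¹ • x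

/-- The square root velocity function `Q(f) = V ∘ f'`. -/
def srvf {N : ℕ} (f : ℝ → EuclideanSpace ℝ (Fin N)) : ℝ → EuclideanSpace ℝ (Fin N) :=
  fun x => rootNormalize (deriv f x)

/-- The semigroup `Γ̃`: absolutely continuous `γ : I → I` with `γ 0 = 0`, `γ 1 = 1` and
`γ' ≥ 0` almost everywhere. -/
def IsWeakReparam (γ : ℝ → ℝ) : Prop :=
  MapsTo γ (Icc 0 1) (Icc 0 1) ∧ AbsolutelyContinuousOnInterval γ 0 1 ∧ γ 0 = 0 ∧ γ 1 = 1 ∧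
    ∀ᵐ x ∂volI, 0 ≤ deriv γ x

/-- The group `Γ`: absolutely continuous `γ : I → I` with `γ 0 = 0`, `γ 1 = 1` and
`γ' > 0` almost everywhere. -/
def IsReparam (γ : ℝ → ℝ) : Prop :=
  MapsTo γ (Icc 0 1) (Icc 0 1) ∧ AbsolutelyContinuousOnInterval γ 0 1 ∧ γ 0 = 0 ∧ γ 1 = 1 ∧
    ∀ᵐ x ∂volI, 0 < deriv γ x

/-- The action `(q * γ)(x) = √(γ' x) q(γ x)`. -/
def act {N : ℕ} (q : ℝ → EuclideanSpace ℝ (Fin N)) (γ : ℝ → ℝ) :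
    ℝ → EuclideanSpace ℝ (Fin N) :=
  fun x => Real.sqrt (deriv γ x) • q (γ x)

/-- The orbit `q Γ` in `L²(I, ℝ^N)`. -/
def orbit {N : ℕ} (q : ℝ → EuclideanSpace ℝ (Fin N)) : Set (L2 N) :=
  {w | ∃ γ : ℝ → ℝ, IsReparam γ ∧ (w : ℝ → EuclideanSpace ℝ (Fin N)) =ᵐ[volI] act q γ}

/-- `[q]`, the closure of the orbit `q Γ` in `L²(I, ℝ^N)`. -/
def closedOrbit {N : ℕ} (q : ℝ → EuclideanSpace ℝ (Fin N)) : Set (L2 N) :=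
  closure (orbit q)

/-- `d([q₁], [q₂])`, the infimum of `d(w₁, w₂)` over `w₁ ∈ [q₁]`, `w₂ ∈ [q₂]`. -/
def orbitDist {N : ℕ} (q₁ q₂ : ℝ → EuclideanSpace ℝ (Fin N)) : ℝ :=
  sInf {r | ∃ w₁ ∈ closedOrbit q₁, ∃ w₂ ∈ closedOrbit q₂, r = dist w₁ w₂}

/-- A matching is a pair `γ = (γ₁, γ₂)` of elements of `Γ̃`; it is optimal for `q₁, q₂` if
`q₁ * γ₁ ∈ [q₁]` and `q₂ * γ₂ ∈ [q₂]` realize the distance `d([q₁], [q₂])`. -/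
def IsOptimalMatching {N : ℕ} (f₁ f₂ : PLCurve N) (γ : ℝ → ℝ × ℝ) : Prop :=
  IsWeakReparam (fun z => (γ z).1) ∧ IsWeakReparam (fun z => (γ z).2) ∧
    ∃ w₁ ∈ closedOrbit (srvf f₁.toFun), ∃ w₂ ∈ closedOrbit (srvf f₂.toFun),
      (w₁ : ℝ → EuclideanSpace ℝ (Fin N)) =ᵐ[volI] act (srvf f₁.toFun) (fun z => (γ z).1) ∧
      (w₂ : ℝ → EuclideanSpace ℝ (Fin N)) =ᵐ[volI] act (srvf f₂.toFun) (fun z => (γ z).2) ∧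
      dist w₁ w₂ = orbitDist (srvf f₁.toFun) (srvf f₂.toFun)

/-! ### The grid

Nodes are numbered from `0`, blocks from `1`: the block `(i, j)` is
`[s (i-1), s i] × [t (j-1), t j]` with `1 ≤ i ≤ m`, `1 ≤ j ≤ n`. -/

/-- The constant value of the square root velocity function on the open interval
`(node (i-1), node i)`, for `1 ≤ i ≤ num` (read off at the midpoint). -/
def PLCurve.pieceValue {N : ℕ} (f : PLCurve N) (i : ℕ) : EuclideanSpace ℝ (Fin N) :=
  srvf f.toFun ((f.node (i - 1) + f.node i) / 2)

/-- The weights `W i j = u i ⬝ v j`. -/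
def weight {N : ℕ} (f₁ f₂ : PLCurve N) (i j : ℕ) : ℝ :=
  inner ℝ (f₁.pieceValue i) (f₂.pieceValue j)

/-- `(i, j)` is the index of a block of the grid. -/
def IsBlock {N : ℕ} (f₁ f₂ : PLCurve N) (i j : ℕ) : Prop :=
  1 ≤ i ∧ i ≤ f₁.num ∧ 1 ≤ j ∧ j ≤ f₂.num

/-- The vertex `(s i, t j)`, for `i ≤ m` and `j ≤ n`. -/
def vertex {N : ℕ} (f₁ f₂ : PLCurve N) (i j : ℕ) : ℝ × ℝ :=
  (f₁.node i, f₂.node j)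

/-- The block `G i j`. -/
def block {N : ℕ} (f₁ f₂ : PLCurve N) (i j : ℕ) : Set (ℝ × ℝ) :=
  Icc (f₁.node (i - 1)) (f₁.node i) ×ˢ Icc (f₂.node (j - 1)) (f₂.node j)

/-- The parameters in `[a, b]` at which `γ` is in the block `(i, j)`. -/
def passage {N : ℕ} (f₁ f₂ : PLCurve N) (γ : ℝ → ℝ × ℝ) (a b : ℝ) (i j : ℕ) : Set ℝ :=
  {z ∈ Icc a b | γ z ∈ block f₁ f₂ i j}

/-- The slope `γ₂' / γ₁' ∈ [0, ∞]` of a path that is linear, non-constant and weakly increasing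
in both coordinates on `[c, d]`. -/
def slopeOn (γ : ℝ → ℝ × ℝ) (c d : ℝ) : ℝ≥0∞ :=
  ENNReal.ofReal ((γ d).2 - (γ c).2) / ENNReal.ofReal ((γ d).1 - (γ c).1)

/-- `H i j`: the slope with which the segment `γ|[a,b]` passes through the block `(i, j)`. -/
def blockSlope {N : ℕ} (f₁ f₂ : PLCurve N) (γ : ℝ → ℝ × ℝ) (a b : ℝ) (i j : ℕ) : ℝ≥0∞ :=
  slopeOn γ (sInf (passage f₁ f₂ γ a b i j)) (sSup (passage f₁ f₂ γ a b i j))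

/-- The segment `γ|[a,b]` spends exactly the non-degenerate interval `[c, d]` in the
block `(i, j)`. -/
def PassesOn {N : ℕ} (f₁ f₂ : PLCurve N) (γ : ℝ → ℝ × ℝ) (a b : ℝ) (i j : ℕ) (c d : ℝ) : Prop :=
  c < d ∧ passage f₁ f₂ γ a b i j = Icc c d

/-- The segment `γ|[a,b]` passes directly from the block `(i, j)` to the block `(i', j')`. -/
def PassesFromTo {N : ℕ} (f₁ f₂ : PLCurve N) (γ : ℝ → ℝ × ℝ) (a b : ℝ) (i j i' j' : ℕ) : Prop :=
  ∃ c d e, PassesOn f₁ f₂ γ a b i j c d ∧ PassesOn f₁ f₂ γ a b i' j' d e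

/-! ### P-segments -/

/-- The requirements on a P-segment on `[a, b]` inside a single block: it is linear there; in a
block of non-positive weight it is horizontal or vertical, according to the edge through which
it enters; in a block of positive weight its slope is neither `0` nor `∞`. -/
def BlockRule {N : ℕ} (f₁ f₂ : PLCurve N) (γ : ℝ → ℝ × ℝ) (a b : ℝ) : Prop :=
  ∀ i j, IsBlock f₁ f₂ i j → ∀ c d, PassesOn f₁ f₂ γ a b i j c d →
    LinearOn γ c d ∧
    (weight f₁ f₂ i j ≤ 0 →
      (blockSlope f₁ f₂ γ a b i j = 0 ∨ blockSlope f₁ f₂ γ a b i j = ∞) ∧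
      ((γ c).1 = f₁.node (i - 1) → blockSlope f₁ f₂ γ a b i j = 0) ∧
      ((γ c).2 = f₂.node (j - 1) → blockSlope f₁ f₂ γ a b i j = ∞)) ∧
    (0 < weight f₁ f₂ i j →
      blockSlope f₁ f₂ γ a b i j ≠ 0 ∧ blockSlope f₁ f₂ γ a b i j ≠ ∞)

/-- The change of slope when a P-segment on `[a, b]` passes through a vertical gridline from the
block `(i, j)` to the block `(i+1, j)`. -/
def VerticalGridlineRule {N : ℕ} (f₁ f₂ : PLCurve N) (γ : ℝ → ℝ × ℝ) (a b : ℝ) : Prop :=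
  ∀ i j, IsBlock f₁ f₂ i j → IsBlock f₁ f₂ (i + 1) j →
    PassesFromTo f₁ f₂ γ a b i j (i + 1) j →
    (0 < weight f₁ f₂ i j → 0 < weight f₁ f₂ (i + 1) j →
      blockSlope f₁ f₂ γ a b (i + 1) j / blockSlope f₁ f₂ γ a b i j =
        ENNReal.ofReal ((weight f₁ f₂ (i + 1) j / weight f₁ f₂ i j) ^ 2)) ∧
    (weight f₁ f₂ (i + 1) j ≤ 0 → blockSlope f₁ f₂ γ a b (i + 1) j = 0) ∧
    (weight f₁ f₂ i j ≤ 0 → 0 < weight f₁ f₂ (i + 1) j →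
      ∃ k, 1 ≤ k ∧ k ≤ i ∧ 0 < weight f₁ f₂ k j ∧
        (∀ k', k < k' → k' ≤ i → weight f₁ f₂ k' j ≤ 0) ∧
        (∃ c d, PassesOn f₁ f₂ γ a b k j c d) ∧
        blockSlope f₁ f₂ γ a b (i + 1) j / blockSlope f₁ f₂ γ a b k j =
          ENNReal.ofReal ((weight f₁ f₂ (i + 1) j / weight f₁ f₂ k j) ^ 2))

/-- The change of slope when a P-segment on `[a, b]` passes through a horizontal gridline from
the block `(i, j)` to the block `(i, j+1)`. -/
def HorizontalGridlineRule {N : ℕ} (f₁ f₂ : PLCurve N) (γ : ℝ → ℝ × ℝ) (a b : ℝ) : Prop :=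
  ∀ i j, IsBlock f₁ f₂ i j → IsBlock f₁ f₂ i (j + 1) →
    PassesFromTo f₁ f₂ γ a b i j i (j + 1) →
    (0 < weight f₁ f₂ i j → 0 < weight f₁ f₂ i (j + 1) →
      blockSlope f₁ f₂ γ a b i (j + 1) / blockSlope f₁ f₂ γ a b i j =
        ENNReal.ofReal ((weight f₁ f₂ i j / weight f₁ f₂ i (j + 1)) ^ 2)) ∧
    (weight f₁ f₂ i (j + 1) ≤ 0 → blockSlope f₁ f₂ γ a b i (j + 1) = ∞) ∧
    (weight f₁ f₂ i j ≤ 0 → 0 < weight f₁ f₂ i (j + 1) →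
      ∃ k, 1 ≤ k ∧ k ≤ j ∧ 0 < weight f₁ f₂ i k ∧
        (∀ k', k < k' → k' ≤ j → weight f₁ f₂ i k' ≤ 0) ∧
        (∃ c d, PassesOn f₁ f₂ γ a b i k c d) ∧
        blockSlope f₁ f₂ γ a b i (j + 1) / blockSlope f₁ f₂ γ a b i k =
          ENNReal.ofReal ((weight f₁ f₂ i k / weight f₁ f₂ i (j + 1)) ^ 2))

/-- `γ|[a,b]` is a P-segment. -/
def IsPSegment {N : ℕ} (f₁ f₂ : PLCurve N) (γ : ℝ → ℝ × ℝ) (a b : ℝ) : Prop :=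
  0 ≤ a ∧ a < b ∧ b ≤ 1 ∧
  PiecewiseLinearOn γ a b ∧ InjOn γ (Icc a b) ∧
  (∃ i₀ j₀ i₁ j₁, IsBlock f₁ f₂ i₀ j₀ ∧ IsBlock f₁ f₂ i₁ j₁ ∧ i₀ ≤ i₁ ∧ j₀ ≤ j₁ ∧
    γ a = vertex f₁ f₂ (i₀ - 1) (j₀ - 1) ∧ γ b = vertex f₁ f₂ i₁ j₁ ∧
    (∀ z ∈ Ioo a b, ∀ i ≤ f₁.num, ∀ j ≤ f₂.num, γ z ≠ vertex f₁ f₂ i j) ∧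
    0 < weight f₁ f₂ i₀ j₀ ∧ 0 < weight f₁ f₂ i₁ j₁) ∧
  BlockRule f₁ f₂ γ a b ∧
  VerticalGridlineRule f₁ f₂ γ a b ∧
  HorizontalGridlineRule f₁ f₂ γ a b

/-! ### N-segments -/

/-- `γ|[a,b]` is an N-segment: it runs linearly and horizontally on the first half of `[a, b]`,
then linearly and vertically on the second half (or is linear on all of `[a, b]` if it is only
horizontal or only vertical), and certain weights are non-positive. -/
def IsNSegment {N : ℕ} (f₁ f₂ : PLCurve N) (γ : ℝ → ℝ × ℝ) (a b : ℝ) : Prop :=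
  0 ≤ a ∧ a < b ∧ b ≤ 1 ∧
  ∃ i₀ j₀ i₁ j₁, i₀ ≤ i₁ ∧ i₁ ≤ f₁.num ∧ j₀ ≤ j₁ ∧ j₁ ≤ f₂.num ∧ (i₀ < i₁ ∨ j₀ < j₁) ∧
    γ a = vertex f₁ f₂ i₀ j₀ ∧ γ b = vertex f₁ f₂ i₁ j₁ ∧
    (i₀ = i₁ ∨ j₀ = j₁ → LinearOn γ a b) ∧
    (i₀ < i₁ → j₀ < j₁ →
      γ ((a + b) / 2) = vertex f₁ f₂ i₁ j₀ ∧
      LinearOn γ a ((a + b) / 2) ∧ LinearOn γ ((a + b) / 2) b) ∧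
    (∀ i j, IsBlock f₁ f₂ i j → i₀ + 1 ≤ i → i ≤ i₁ → j₀ ≤ j → j ≤ j₁ + 1 →
      weight f₁ f₂ i j ≤ 0) ∧
    (∀ i j, IsBlock f₁ f₂ i j → i₀ ≤ i → i ≤ i₁ + 1 → j₀ + 1 ≤ j → j ≤ j₁ →
      weight f₁ f₂ i j ≤ 0)

/-! ### Consecutive P-segments -/

/-- `γ|[u₁,u₂]` is a P-segment ending at the vertex `(i₁, j₁)`, `γ|[u₃,u₄]` is a P-segment
beginning at the vertex `(i₂, j₂)`, and either `u₂ = u₃` or `γ|[u₂,u₃]` is an N-segment. -/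
def ConsecutivePSegments {N : ℕ} (f₁ f₂ : PLCurve N) (γ : ℝ → ℝ × ℝ) (u₁ u₂ u₃ u₄ : ℝ)
    (i₁ j₁ i₂ j₂ : ℕ) : Prop :=
  IsPSegment f₁ f₂ γ u₁ u₂ ∧ IsPSegment f₁ f₂ γ u₃ u₄ ∧
  (u₂ = u₃ ∨ IsNSegment f₁ f₂ γ u₂ u₃) ∧
  i₁ ≤ f₁.num ∧ j₁ ≤ f₂.num ∧ i₂ ≤ f₁.num ∧ j₂ ≤ f₂.num ∧
  γ u₂ = vertex f₁ f₂ i₁ j₁ ∧ γ u₃ = vertex f₁ f₂ i₂ j₂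

/-- The interval in `[0, ∞]` prescribed for `μ` by the weights `A, B > 0` and `C, D`. -/
def muInterval (A B C D : ℝ) : Set ℝ≥0∞ :=
  if 0 < C then
    if 0 < D then Icc (ENNReal.ofReal (D ^ 2 / (A * B))) (ENNReal.ofReal (A * B / C ^ 2))
    else Icc 0 (ENNReal.ofReal (A * B / C ^ 2))
  else
    if 0 < D then Icc (ENNReal.ofReal (D ^ 2 / (A * B))) ∞
    else Icc 0 ∞

end

end ElasticMatching

namespace ElasticMatching

/-! ### Partitions -/

section Partition

variable {m : ℕ} {s : ℕ → ℝ}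

/-! All elements of `[q_k]` have the same norm (`norm_sq_of_mem_closedOrbit`), so a small distance
is the same as a large inner product (`dist_le_dist_iff`), and the task is to maximize the overlap
`∫ ⟨q₁ * γ₁, q₂ * γ₂⟩`. While the path `(γ₁, γ₂)` stays in the block `(i, j)`, the integrand is `W i
j * √(γ₁' γ₂')`. By Cauchy–Schwarz it contributes at most `max (W i j) 0 * √(Δx Δy)`, with equality
for a straight step if `W i j > 0` and for any horizontal or vertical step. Matchings are thereby
replaced by finite chains of points, each step inside one block, and the overlap by the total gain
of the chain (`exists_reach_of_overlap`, `FollowsOn.integral_overlap`).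

Two steps in the same block may be merged without loss, so chains may be assumed to cross the blocks
one after the other. Such chains form a compact set and a chain of largest gain exists. Among these,
one is chosen that is at a vertex as often as possible (`Grid.IsOptimal`). This tie-break removes
degenerate crossings: a crossing point that can slide to a vertex without loss would already have
done so.

The optimal chain is cut at its vertices. Inside a piece, the height `η` at which a gridline is
crossed maximizes `A √(η - a) + B √(b - η)`, which is the quotient law for the slopes; blocks of
non-positive weight are crossed level, and the law then relates the positive blocks on both sides of
them (`Grid.IsRun.crossing`). Such pieces become P-segments. A maximal stretch without gain becomes
one N-segment, so no two of these are adjacent. Its weight conditions hold because a block of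
positive weight next to it could be used with a gain of order `√ε` at a loss of order `ε`
(`Grid.IsIdle.weight_nonpos`).

At a junction of two P-segments the path may cut the corner through the block of weight `C`, or
through that of weight `D`. The first-order condition (`corner_condition`) gives `C² μ ≤ A B` and,
with the coordinates exchanged, `D² ≤ μ A B`. It uses only that the overlap is largest, so it holds
for every optimal matching, and for `C D > A B` no `μ` is left. Throughout, only crossings of
vertical gridlines are treated directly; `Grid.swap` yields the others. -/

theorem IsPartition.lt {a b : ℝ} (hs : IsPartition a b m s) {i j : ℕ} (hij : i < j) (hj : j ≤ m) :
    s i < s j := by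
  induction j, hij using Nat.le_induction with
  | base => exact hs.2.2 i (by omega)
  | succ k hk ih => exact (ih (by omega)).trans (hs.2.2 k (by omega))

theorem IsPartition.le {a b : ℝ} (hs : IsPartition a b m s) {i j : ℕ} (hij : i ≤ j) (hj : j ≤ m) :
    s i ≤ s j := by
  rcases hij.eq_or_lt with rfl | h
  · exact le_rfl
  · exact (hs.lt h hj).le

theorem IsPartition.lt_of_lt {a b : ℝ} (hs : IsPartition a b m s) {i j : ℕ} (hi : i ≤ m)
    (h : s i < s j) : i < j := by
  by_contra hc
  exact absurd (hs.le (not_lt.1 hc) hi) (not_le.2 h)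

theorem IsPartition.inj {a b : ℝ} (hs : IsPartition a b m s) {i j : ℕ} (hi : i ≤ m) (hj : j ≤ m)
    (h : s i = s j) : i = j := by
  rcases lt_trichotomy i j with h1 | h1 | h1
  · exact absurd h (hs.lt h1 hj).ne
  · exact h1
  · exact absurd h (hs.lt h1 hi).ne'

theorem IsPartition.pos (hs : IsPartition 0 1 m s) : 1 ≤ m := by
  rcases Nat.eq_zero_or_pos m with rfl | h
  · have := hs.1.symm.trans hs.2.1
    norm_num at this
  · exact h

theorem IsPartition.mem (hs : IsPartition 0 1 m s) {i : ℕ} (hi : i ≤ m) : 0 ≤ s i ∧ s i ≤ 1 :=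
  ⟨hs.1 ▸ hs.le (Nat.zero_le i) hi, hs.2.1 ▸ hs.le hi le_rfl⟩

theorem IsPartition.exists_piece (hs : IsPartition 0 1 m s) {x : ℝ} (h0 : 0 ≤ x) (h1 : x ≤ 1) :
    ∃ i, 1 ≤ i ∧ i ≤ m ∧ s (i - 1) ≤ x ∧ x ≤ s i := by
  have key : ∀ k, k ≤ m → x ≤ s k → k = 0 ∨ ∃ i, 1 ≤ i ∧ i ≤ m ∧ s (i - 1) ≤ x ∧ x ≤ s i := by
    intro k
    induction k with
    | zero => intro _ _; exact Or.inl rfl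
    | succ k ih =>
      intro hk hx
      rcases le_total x (s k) with h | h
      · rcases ih (by omega) h with rfl | h'
        · exact Or.inr ⟨1, le_rfl, hk, by simpa [hs.1] using h0, hx⟩
        · exact Or.inr h'
      · exact Or.inr ⟨k + 1, by omega, hk, by simpa using h, hx⟩
  rcases key m le_rfl (hs.2.1 ▸ h1) with h | h
  · exact absurd hs.pos (by omega)
  · exact h

theorem IsPartition.eq_of_mem_Ioo {a b : ℝ} (hs : IsPartition a b m s) {x : ℝ} {i i' : ℕ}
    (hi : i ≤ m) (h1 : s (i - 1) < x) (h2 : x < s i) (hi' : i' ≤ m) (hi0 : 1 ≤ i')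
    (h1' : s (i' - 1) ≤ x) (h2' : x ≤ s i') : i = i' := by
  have e1 := hs.lt_of_lt (i := i - 1) (j := i') (by omega) (h1.trans_le h2')
  have e2 := hs.lt_of_lt (i := i' - 1) (j := i) (by omega) (h1'.trans_lt h2)
  omega

/-- `x` is one of the nodes of the partition. -/
def IsNode (s : ℕ → ℝ) (m : ℕ) (x : ℝ) : Prop := ∃ i ≤ m, s i = x

theorem IsPartition.not_isNode {a b : ℝ} (hs : IsPartition a b m s) {x : ℝ} {i : ℕ} (hi : i ≤ m)
    (h1 : s (i - 1) < x) (h2 : x < s i) : ¬ IsNode s m x := by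
  rintro ⟨j, hj, rfl⟩
  have e1 := hs.lt_of_lt (i := i - 1) (by omega) h1
  have e2 := hs.lt_of_lt hj h2
  omega

theorem IsNode.eq_or_eq {a b : ℝ} (hs : IsPartition a b m s) {x : ℝ} (hx : IsNode s m x) {i : ℕ}
    (hi : i ≤ m) (h1 : s (i - 1) ≤ x) (h2 : x ≤ s i) : x = s (i - 1) ∨ x = s i := by
  by_contra! hc
  exact hs.not_isNode hi (h1.lt_of_ne' hc.1) (h2.lt_of_ne hc.2) hx

/-- To prove a transitive relation between times along a monotone path, it is enough to prove it
for times between which the path stays in a single piece of a partition. -/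
theorem IsPartition.interval_induction (hs : IsPartition 0 1 m s) {g : ℝ → ℝ}
    (hg : ContinuousOn g (Icc 0 1)) (hmaps : MapsTo g (Icc 0 1) (Icc 0 1)) {R : ℝ → ℝ → Prop}
    (trans : ∀ c e d, 0 ≤ c → c ≤ e → e ≤ d → d ≤ 1 → R c e → R e d → R c d)
    (base : ∀ i, 1 ≤ i → i ≤ m → ∀ c d, 0 ≤ c → c ≤ d → d ≤ 1 → s (i - 1) ≤ g c → g d ≤ s i →
      R c d) {c d : ℝ} (hc : 0 ≤ c) (hcd : c ≤ d) (hd : d ≤ 1) : R c d := by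
  have key : ∀ i, 1 ≤ i → i ≤ m → ∀ c d, 0 ≤ c → c ≤ d → d ≤ 1 → g d ≤ s i → R c d := by
    intro i hi
    induction i, hi using Nat.le_induction with
    | base =>
      intro h1 c d hc hcd hd hgd
      refine base 1 le_rfl h1 c d hc hcd hd ?_ hgd
      simpa [hs.1] using (hmaps ⟨hc, hcd.trans hd⟩).1
    | succ k hk ih =>
      intro h1 c d hc hcd hd hgd
      rcases le_total (s k) (g c) with h | h
      · exact base (k + 1) (by omega) h1 c d hc hcd hd (by simpa using h) hgd
      rcases le_total (g d) (s k) with h' | h'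
      · exact ih (by omega) c d hc hcd hd h'
      obtain ⟨e, he, hge⟩ := intermediate_value_Icc hcd
        (hg.mono (Icc_subset_Icc hc hd)) (⟨h, h'⟩ : s k ∈ Icc (g c) (g d))
      exact trans c e d hc he.1 he.2 hd (ih (by omega) c e hc he.1 (he.2.trans hd) hge.le)
        (base (k + 1) (by omega) h1 e d (hc.trans he.1) he.2 hd (by simp [hge]) hgd)
  exact key m hs.pos le_rfl c d hc hcd hd (hs.2.1 ▸ (hmaps ⟨hc.trans hcd, hd⟩).2)

end Partition

/-! ### Weighted grids -/

/-- The combinatorial data of the problem: two partitions of `[0,1]` and a weight for each of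
the blocks. -/
structure Grid where
  m : ℕ
  n : ℕ
  s : ℕ → ℝ
  t : ℕ → ℝ
  W : ℕ → ℕ → ℝ
  hs : IsPartition 0 1 m s
  ht : IsPartition 0 1 n t

namespace Grid

variable (G : Grid)

/-- The grid with the coordinates exchanged. -/
def swap : Grid := ⟨G.n, G.m, G.t, G.s, fun i j => G.W j i, G.ht, G.hs⟩

/-- `(i, j)` is the index of a block. -/
def IsBl (i j : ℕ) : Prop := 1 ≤ i ∧ i ≤ G.m ∧ 1 ≤ j ∧ j ≤ G.n

/-- The point `p` lies in the block `(i, j)`. -/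
def Mem (i j : ℕ) (p : ℝ × ℝ) : Prop :=
  (G.s (i - 1) ≤ p.1 ∧ p.1 ≤ G.s i) ∧ (G.t (j - 1) ≤ p.2 ∧ p.2 ≤ G.t j)

/-- The contribution of a step from `p` to `q` in the block `(i, j)`. -/
noncomputable def gain (i j : ℕ) (p q : ℝ × ℝ) : ℝ :=
  max (G.W i j) 0 * √((q.1 - p.1) * (q.2 - p.2))

/-- `p` and `q` are joined by a monotone chain of steps inside blocks with total gain `v`. -/
inductive Reach : ℝ × ℝ → ℝ × ℝ → ℝ → Prop
  | refl (p : ℝ × ℝ) : Reach p p 0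
  | step {i j : ℕ} {p q r : ℝ × ℝ} {v : ℝ} : G.IsBl i j → G.Mem i j p → G.Mem i j q → p ≤ q →
      Reach q r v → Reach p r (G.gain i j p q + v)

variable {G}

theorem gain_nonneg (i j : ℕ) (p q : ℝ × ℝ) : 0 ≤ G.gain i j p q := by
  unfold gain; positivity

theorem gain_eq_zero {i j : ℕ} {p q : ℝ × ℝ} (h : G.W i j ≤ 0 ∨ p.1 = q.1 ∨ p.2 = q.2) :
    G.gain i j p q = 0 := by
  unfold gain
  rcases h with h | h | h <;> simp [h]

theorem gain_of_pos {i j : ℕ} (h : 0 < G.W i j) (p q : ℝ × ℝ) :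
    G.gain i j p q = G.W i j * √((q.1 - p.1) * (q.2 - p.2)) := by
  rw [gain, max_eq_left h.le]

/-- After squaring, this is the inequality of the arithmetic and geometric mean for `a * d` and `c *
b`. -/
theorem sqrt_mul_add_sqrt_mul_le {a b c d : ℝ} (ha : 0 ≤ a) (hb : 0 ≤ b) (hc : 0 ≤ c)
    (hd : 0 ≤ d) : √(a * b) + √(c * d) ≤ √((a + c) * (b + d)) := by
  apply Real.le_sqrt_of_sq_le
  have h1 := Real.sq_sqrt (mul_nonneg ha hb)
  have h2 := Real.sq_sqrt (mul_nonneg hc hd)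
  have h3 : 2 * (√(a * b) * √(c * d)) ≤ a * d + c * b := by
    rw [← Real.sqrt_mul (by positivity)]
    have : √(a * b * (c * d)) ≤ √(((a * d + c * b) / 2) ^ 2) :=
      Real.sqrt_le_sqrt (by nlinarith [sq_nonneg (a * d - c * b)])
    rw [Real.sqrt_sq (by positivity)] at this
    linarith
  nlinarith

/-- One step in a block is at least as good as two. This is what permits chains to be normalized to
a single step per block. -/
theorem gain_add_le {i j : ℕ} {p q r : ℝ × ℝ} (hpq : p ≤ q) (hqr : q ≤ r) :
    G.gain i j p q + G.gain i j q r ≤ G.gain i j p r := by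
  unfold gain
  rw [← mul_add]
  refine mul_le_mul_of_nonneg_left ?_ (by positivity)
  have := sqrt_mul_add_sqrt_mul_le (sub_nonneg.2 hpq.1) (sub_nonneg.2 hpq.2) (sub_nonneg.2 hqr.1)
    (sub_nonneg.2 hqr.2)
  rwa [show q.1 - p.1 + (r.1 - q.1) = r.1 - p.1 by ring,
    show q.2 - p.2 + (r.2 - q.2) = r.2 - p.2 by ring] at this

theorem Reach.single {i j : ℕ} {p q : ℝ × ℝ} (hb : G.IsBl i j) (hp : G.Mem i j p)
    (hq : G.Mem i j q) (hpq : p ≤ q) : G.Reach p q (G.gain i j p q) := by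
  simpa using Reach.step hb hp hq hpq (Reach.refl q)

theorem Reach.trans {p q r : ℝ × ℝ} {v w : ℝ} (h : G.Reach p q v) (h' : G.Reach q r w) :
    G.Reach p r (v + w) := by
  induction h with
  | refl => simpa using h'
  | step hb hp hq hpq _ ih => rw [add_assoc]; exact Reach.step hb hp hq hpq (ih h')

theorem Reach.zero_right {x x' y : ℝ} (hx0 : 0 ≤ x) (hxx : x ≤ x') (hx1 : x' ≤ 1) (hy0 : 0 ≤ y)
    (hy1 : y ≤ 1) : G.Reach (x, y) (x', y) 0 := by
  obtain ⟨j, hj1, hjn, hj⟩ := G.ht.exists_piece hy0 hy1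
  refine G.hs.interval_induction (g := id) (R := fun x x' => G.Reach (x, y) (x', y) 0)
    continuousOn_id (mapsTo_id _) ?_ ?_ hx0 hxx hx1
  · intro c e d _ _ _ _ h h'
    simpa using h.trans h'
  · intro i hi1 him c d _ hcd _ h1 h2
    have := Reach.single (G := G) (i := i) (j := j) (p := (c, y)) (q := (d, y))
      ⟨hi1, him, hj1, hjn⟩ ⟨⟨h1, hcd.trans h2⟩, hj⟩ ⟨⟨h1.trans hcd, h2⟩, hj⟩ ⟨hcd, le_rfl⟩
    rwa [gain_eq_zero (by simp)] at this

theorem Reach.zero_up {x y y' : ℝ} (hx0 : 0 ≤ x) (hx1 : x ≤ 1) (hy0 : 0 ≤ y) (hyy : y ≤ y')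
    (hy1 : y' ≤ 1) : G.Reach (x, y) (x, y') 0 := by
  obtain ⟨i, hi1, him, hi⟩ := G.hs.exists_piece hx0 hx1
  refine G.ht.interval_induction (g := id) (R := fun y y' => G.Reach (x, y) (x, y') 0)
    continuousOn_id (mapsTo_id _) ?_ ?_ hy0 hyy hy1
  · intro c e d _ _ _ _ h h'
    simpa using h.trans h'
  · intro j hj1 hjn c d _ hcd _ h1 h2
    have := Reach.single (G := G) (i := i) (j := j) (p := (x, c)) (q := (x, d))
      ⟨hi1, him, hj1, hjn⟩ ⟨hi, ⟨h1, hcd.trans h2⟩⟩ ⟨hi, ⟨h1.trans hcd, h2⟩⟩ ⟨le_rfl, hcd⟩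
    rwa [gain_eq_zero (by simp)] at this

/-- Free moves along a horizontal and then a vertical line. They are the connecting parts of all the
competitors with which optimal chains are compared. -/
theorem Reach.zero {p q : ℝ × ℝ} (hp : 0 ≤ p) (hpq : p ≤ q) (hq : q ≤ 1) : G.Reach p q 0 := by
  have h1 := Reach.zero_right (G := G) hp.1 hpq.1 hq.1 hp.2 (hpq.2.trans hq.2)
  have h2 := Reach.zero_up (G := G) (hp.1.trans hpq.1) hq.1 hp.2 hpq.2 hq.2
  simpa using h1.trans h2

theorem IsBl.swap {i j : ℕ} (h : G.IsBl i j) : G.swap.IsBl j i := ⟨h.2.2.1, h.2.2.2, h.1, h.2.1⟩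

theorem Mem.swap {i j : ℕ} {p : ℝ × ℝ} (h : G.Mem i j p) : G.swap.Mem j i p.swap := ⟨h.2, h.1⟩

theorem gain_swap (i j : ℕ) (p q : ℝ × ℝ) : G.swap.gain j i p.swap q.swap = G.gain i j p q := by
  simp [gain, Grid.swap, mul_comm]

theorem Reach.swap {p q : ℝ × ℝ} {v : ℝ} (h : G.Reach p q v) : G.swap.Reach p.swap q.swap v := by
  induction h with
  | refl => exact Reach.refl _
  | step hb hp hq hpq _ ih =>
    rw [← gain_swap]
    exact Reach.step hb.swap hp.swap hq.swap ⟨hpq.2, hpq.1⟩ ih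

/-! ### Chains that cross the blocks one after the other -/

/-- `CReach i j p v`: a chain from `p` to `(1,1)` of total gain `v` that takes one step in each
of the blocks it meets, beginning with the block `(i, j)` and leaving each block through its
right or upper edge. -/
inductive CReach (G : Grid) : ℕ → ℕ → ℝ × ℝ → ℝ → Prop
  | last {p : ℝ × ℝ} : G.Mem G.m G.n p → CReach G G.m G.n p (G.gain G.m G.n p (1, 1))
  | right {i j : ℕ} {p q : ℝ × ℝ} {v : ℝ} : G.IsBl i j → G.Mem i j p → G.Mem i j q → p ≤ q →
      q.1 = G.s i → CReach G (i + 1) j q v → CReach G i j p (G.gain i j p q + v)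
  | up {i j : ℕ} {p q : ℝ × ℝ} {v : ℝ} : G.IsBl i j → G.Mem i j p → G.Mem i j q → p ≤ q →
      q.2 = G.t j → CReach G i (j + 1) q v → CReach G i j p (G.gain i j p q + v)

theorem CReach.isBl {i j : ℕ} {p : ℝ × ℝ} {v : ℝ} (h : G.CReach i j p v) : G.IsBl i j := by
  cases h with
  | last => exact ⟨G.hs.pos, le_rfl, G.ht.pos, le_rfl⟩
  | right h => exact h
  | up h => exact h

theorem CReach.mem {i j : ℕ} {p : ℝ × ℝ} {v : ℝ} (h : G.CReach i j p v) : G.Mem i j p := by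
  cases h <;> assumption

theorem Mem.le_one {i j : ℕ} {p : ℝ × ℝ} (h : G.Mem i j p) (hb : G.IsBl i j) : p ≤ 1 :=
  ⟨h.1.2.trans (G.hs.mem hb.2.1).2, h.2.2.trans (G.ht.mem hb.2.2.2).2⟩

theorem Mem.nonneg {i j : ℕ} {p : ℝ × ℝ} (h : G.Mem i j p) (hb : G.IsBl i j) : 0 ≤ p :=
  ⟨(G.hs.mem ((Nat.sub_le _ _).trans hb.2.1)).1.trans h.1.1,
    (G.ht.mem ((Nat.sub_le _ _).trans hb.2.2.2)).1.trans h.2.1⟩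

theorem CReach.merge {i j : ℕ} {p q : ℝ × ℝ} {v : ℝ} (hp : G.Mem i j p) (hpq : p ≤ q)
    (h : G.CReach i j q v) : ∃ v', G.gain i j p q + v ≤ v' ∧ G.CReach i j p v' := by
  cases h with
  | last hq =>
    exact ⟨_, gain_add_le hpq (hq.le_one ⟨G.hs.pos, le_rfl, G.ht.pos, le_rfl⟩), .last hp⟩
  | @right _ _ _ r v hb hq hr hqr hr1 h =>
    refine ⟨_, ?_, .right hb hp hr (hpq.trans hqr) hr1 h⟩
    have := gain_add_le (G := G) (i := i) (j := j) hpq hqr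
    linarith
  | @up _ _ _ r v hb hq hr hqr hr1 h =>
    refine ⟨_, ?_, .up hb hp hr (hpq.trans hqr) hr1 h⟩
    have := gain_add_le (G := G) (i := i) (j := j) hpq hqr
    linarith

theorem CReach.of_right {i j : ℕ} {p : ℝ × ℝ} {v : ℝ} (hb : G.IsBl i j) (hp : G.Mem i j p)
    (h : G.CReach (i + 1) j p v) : G.CReach i j p v := by
  have h1 : p.1 = G.s i := le_antisymm hp.1.2 (by simpa using h.mem.1.1)
  have := CReach.right hb hp hp le_rfl h1 h
  rwa [gain_eq_zero (by simp), zero_add] at this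

theorem CReach.of_up {i j : ℕ} {p : ℝ × ℝ} {v : ℝ} (hb : G.IsBl i j) (hp : G.Mem i j p)
    (h : G.CReach i (j + 1) p v) : G.CReach i j p v := by
  have h1 : p.2 = G.t j := le_antisymm hp.2.2 (by simpa using h.mem.2.1)
  have := CReach.up hb hp hp le_rfl h1 h
  rwa [gain_eq_zero (by simp), zero_add] at this

/-- Here `p` lies on the gridline between the columns `i` and `i + 1`, so the chain can only run
vertically in column `i`, without gain. These steps are recorded in column `i + 1` instead, until
the chain leaves column `i`; the vertical step made there is merged into the next one. -/
theorem CReach.of_left {i j : ℕ} {p : ℝ × ℝ} {v : ℝ} (hb : G.IsBl (i + 1) j)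
    (hp : G.Mem (i + 1) j p) (h : G.CReach i j p v) : ∃ v', v ≤ v' ∧ G.CReach (i + 1) j p v' := by
  induction h with
  | last => exact absurd hb.2.1 (by omega)
  | @right i j p q v hb' hp' hq hpq hq1 h _ =>
    have h1 : p.1 = q.1 := le_antisymm hpq.1 (by rw [hq1]; simpa using hp.1.1)
    obtain ⟨v', hv, h'⟩ := h.merge hp hpq
    exact ⟨v', by linarith [gain_nonneg (G := G) (i + 1) j p q,
      gain_eq_zero (G := G) (i := i) (j := j) (Or.inr (Or.inl h1))], h'⟩
  | @up i j p q v hb' hp' hq hpq hq1 h ih =>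
    have hi : G.s i ≤ p.1 := by simpa using hp.1.1
    have h1 : p.1 = q.1 := le_antisymm hpq.1 (hq.1.2.trans hi)
    have hb2 := h.isBl
    have hq' : G.Mem (i + 1) (j + 1) q :=
      ⟨⟨h1 ▸ hp.1.1, h1 ▸ hp.1.2⟩, h.mem.2⟩
    obtain ⟨v', hv, h'⟩ := ih ⟨hb.1, hb.2.1, hb2.2.2⟩ hq'
    have := CReach.up hb hp (q := q) ⟨⟨h1 ▸ hp.1.1, h1 ▸ hp.1.2⟩, hq.2⟩ hpq hq1 h'
    exact ⟨_, by linarith [gain_nonneg (G := G) (i + 1) j p q,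
      gain_eq_zero (G := G) (i := i) (j := j) (Or.inr (Or.inl h1))], this⟩

theorem CReach.of_down {i j : ℕ} {p : ℝ × ℝ} {v : ℝ} (hb : G.IsBl i (j + 1))
    (hp : G.Mem i (j + 1) p) (h : G.CReach i j p v) : ∃ v', v ≤ v' ∧ G.CReach i (j + 1) p v' := by
  induction h with
  | last => exact absurd hb.2.2.2 (by omega)
  | @up i j p q v hb' hp' hq hpq hq1 h _ =>
    have h1 : p.2 = q.2 := le_antisymm hpq.2 (by rw [hq1]; simpa using hp.2.1)
    obtain ⟨v', hv, h'⟩ := h.merge hp hpq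
    exact ⟨v', by linarith [gain_nonneg (G := G) i (j + 1) p q,
      gain_eq_zero (G := G) (i := i) (j := j) (Or.inr (Or.inr h1))], h'⟩
  | @right i j p q v hb' hp' hq hpq hq1 h ih =>
    have hi : G.t j ≤ p.2 := by simpa using hp.2.1
    have h1 : p.2 = q.2 := le_antisymm hpq.2 (hq.2.2.trans hi)
    have hb2 := h.isBl
    have hq' : G.Mem (i + 1) (j + 1) q :=
      ⟨h.mem.1, ⟨h1 ▸ hp.2.1, h1 ▸ hp.2.2⟩⟩
    obtain ⟨v', hv, h'⟩ := ih ⟨hb2.1, hb2.2.1, hb.2.2⟩ hq'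
    have := CReach.right hb hp (q := q) ⟨hq.1, ⟨h1 ▸ hp.2.1, h1 ▸ hp.2.2⟩⟩ hpq hq1 h'
    exact ⟨_, by linarith [gain_nonneg (G := G) i (j + 1) p q,
      gain_eq_zero (G := G) (i := i) (j := j) (Or.inr (Or.inr h1))], this⟩

theorem index_close {m : ℕ} {s : ℕ → ℝ} (hs : IsPartition 0 1 m s) {i i' : ℕ} {x : ℝ}
    (hi : i ≤ m) (hi' : i' ≤ m) (h : s (i - 1) ≤ x ∧ x ≤ s i)
    (h' : s (i' - 1) ≤ x ∧ x ≤ s i') : i = i' ∨ i' = i + 1 ∨ i = i' + 1 := by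
  by_contra! hc
  rcases lt_or_ge i i' with h1 | h1
  · exact absurd (h'.1.trans h.2) (not_le.2 (hs.lt (by omega) (by omega)))
  · exact absurd (h.1.trans h'.2) (not_le.2 (hs.lt (by omega) (by omega)))

/-- A point in two blocks has indices that differ by at most one in each direction; first the column
and then the row is changed. -/
theorem CReach.transfer {i j i' j' : ℕ} {p : ℝ × ℝ} {v : ℝ} (hb : G.IsBl i' j')
    (hp : G.Mem i' j' p) (h : G.CReach i j p v) : ∃ v', v ≤ v' ∧ G.CReach i' j' p v' := by
  have hb0 := h.isBl
  have hp0 := h.mem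
  have h1 : ∃ v', v ≤ v' ∧ G.CReach i' j p v' := by
    have hb1 : G.IsBl i' j := ⟨hb.1, hb.2.1, hb0.2.2⟩
    have hp1 : G.Mem i' j p := ⟨hp.1, hp0.2⟩
    rcases index_close G.hs hb0.2.1 hb.2.1 hp0.1 hp.1 with rfl | rfl | rfl
    · exact ⟨v, le_rfl, h⟩
    · exact h.of_left hb1 hp1
    · exact ⟨v, le_rfl, h.of_right hb1 hp1⟩
  obtain ⟨w, hw, h2⟩ := h1
  rcases index_close G.ht hb0.2.2.2 hb.2.2.2 hp0.2 hp.2 with rfl | rfl | rfl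
  · exact ⟨w, hw, h2⟩
  · obtain ⟨v', hv', h'⟩ := h2.of_down hb hp
    exact ⟨v', hw.trans hv', h'⟩
  · exact ⟨w, hw, h2.of_up hb hp⟩

/-- The chain is normalized from its end backwards: each step is merged into the first step of what
follows, and the result is then transferred to the block in which the previous step takes place. Its
start is trivial, since `(1,1)` lies in the last block only. -/
theorem Reach.exists_cReach {p r : ℝ × ℝ} {v : ℝ} (h : G.Reach p r v) (hr : r = (1, 1))
    {i j : ℕ} (hb : G.IsBl i j) (hp : G.Mem i j p) : ∃ v', v ≤ v' ∧ G.CReach i j p v' := by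
  induction h generalizing i j with
  | refl p =>
    subst hr
    have h1 : i = G.m := by
      by_contra hc
      have := G.hs.lt (lt_of_le_of_ne hb.2.1 hc) le_rfl
      rw [G.hs.2.1] at this
      exact absurd hp.1.2 (not_le.2 this)
    have h2 : j = G.n := by
      by_contra hc
      have := G.ht.lt (lt_of_le_of_ne hb.2.2.2 hc) le_rfl
      rw [G.ht.2.1] at this
      exact absurd hp.2.2 (not_le.2 this)
    subst h1 h2
    exact ⟨_, gain_nonneg _ _ _ _, .last hp⟩
  | step hb1 hp1 hq1 hpq _ ih =>
    obtain ⟨v1, hv1, h1⟩ := ih hr hb1 hq1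
    obtain ⟨v2, hv2, h2⟩ := h1.merge hp1 hpq
    obtain ⟨v3, hv3, h3⟩ := h2.transfer hb hp
    exact ⟨v3, by linarith, h3⟩

end Grid

/-! ### Chains as sequences and the existence of an optimal chain. -/

namespace Grid

/-- A chain of points from `p` in the block `(i, j)` to `(1,1)`, one step in each of the
blocks `(I k, J k)`, which are left through the right or the upper edge; after its arrival in
`(1,1)` it stays there. -/
structure IsChainFrom (G : Grid) (i j : ℕ) (p : ℝ × ℝ) (I J : ℕ → ℕ) (x y : ℕ → ℝ) : Prop where
  zero : I 0 = i ∧ J 0 = j ∧ x 0 = p.1 ∧ y 0 = p.2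
  isBl : ∀ k, G.IsBl (I k) (J k)
  mem : ∀ k, G.Mem (I k) (J k) (x k, y k)
  mem' : ∀ k, G.Mem (I k) (J k) (x (k + 1), y (k + 1))
  mono : ∀ k, x k ≤ x (k + 1) ∧ y k ≤ y (k + 1)
  next : ∀ k, (I (k + 1) = I k + 1 ∧ J (k + 1) = J k ∧ x (k + 1) = G.s (I k)) ∨
    (J (k + 1) = J k + 1 ∧ I (k + 1) = I k ∧ y (k + 1) = G.t (J k)) ∨
    (I k = G.m ∧ J k = G.n ∧ I (k + 1) = G.m ∧ J (k + 1) = G.n ∧ x (k + 1) = 1 ∧ y (k + 1) = 1)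

/-- The gain of the `k`-th step of a chain. -/
noncomputable def stepGain (G : Grid) (I J : ℕ → ℕ) (x y : ℕ → ℝ) (k : ℕ) : ℝ :=
  G.gain (I k) (J k) (x k, y k) (x (k + 1), y (k + 1))

/-- The total gain of a chain. -/
noncomputable def totalGain (G : Grid) (I J : ℕ → ℕ) (x y : ℕ → ℝ) : ℝ :=
  ∑ k ∈ Finset.range (G.m + G.n), G.stepGain I J x y k

/-- The point `(a, b)` is a vertex of the grid. -/
def IsVertex (G : Grid) (a b : ℝ) : Prop := IsNode G.s G.m a ∧ IsNode G.t G.n b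

open Classical in
/-- The number of indices at which a chain is at a vertex. -/
noncomputable def vertexCount (G : Grid) (x y : ℕ → ℝ) : ℕ :=
  ((Finset.range (G.m + G.n)).filter fun k => G.IsVertex (x k) (y k)).card

/-- The sequence `a, f 0, f 1, …`. -/
def prepend {α : Type*} (a : α) (f : ℕ → α) : ℕ → α
  | 0 => a
  | k + 1 => f k

variable {G : Grid}

theorem vertexCount_le (x y : ℕ → ℝ) : G.vertexCount x y ≤ G.m + G.n := by
  classical
  exact (Finset.card_filter_le _ _).trans (by simp)

theorem IsChainFrom.prepend {i j i' j' : ℕ} {p q : ℝ × ℝ} {I J : ℕ → ℕ} {x y : ℕ → ℝ}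
    (h : G.IsChainFrom i' j' q I J x y) (hb : G.IsBl i j) (hp : G.Mem i j p) (hq : G.Mem i j q)
    (hpq : p ≤ q) (hn : (i' = i + 1 ∧ j' = j ∧ q.1 = G.s i) ∨ (j' = j + 1 ∧ i' = i ∧ q.2 = G.t j) ∨
      (i = G.m ∧ j = G.n ∧ i' = G.m ∧ j' = G.n ∧ q.1 = 1 ∧ q.2 = 1)) :
    G.IsChainFrom i j p (Grid.prepend i I) (Grid.prepend j J) (Grid.prepend p.1 x)
      (Grid.prepend p.2 y) := by
  obtain ⟨h0, h1, h2, h3⟩ := h.zero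
  constructor
  · exact ⟨rfl, rfl, rfl, rfl⟩
  · rintro (_ | k)
    · exact hb
    · exact h.isBl k
  · rintro (_ | k)
    · exact hp
    · exact h.mem k
  · rintro (_ | k)
    · simpa [Grid.prepend, h2, h3] using hq
    · exact h.mem' k
  · rintro (_ | k)
    · simpa [Grid.prepend, h2, h3] using (⟨hpq.1, hpq.2⟩ : p.1 ≤ q.1 ∧ p.2 ≤ q.2)
    · exact h.mono k
  · rintro (_ | k)
    · simpa [Grid.prepend, h0, h1, h2, h3] using hn
    · exact h.next k

theorem stepGain_prepend {i j i' j' : ℕ} {p q : ℝ × ℝ} {I J : ℕ → ℕ} {x y : ℕ → ℝ}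
    (h : G.IsChainFrom i' j' q I J x y) :
    G.stepGain (prepend i I) (prepend j J) (prepend p.1 x) (prepend p.2 y) 0 =
      G.gain i j p q := by
  obtain ⟨-, -, h2, h3⟩ := h.zero
  simp [stepGain, prepend, h2, h3]

/-- The finite chain is continued by the constant `(1,1)`. All chains thus become points of one
product space, whatever their number of steps. -/
theorem CReach.exists_chain {i j : ℕ} {p : ℝ × ℝ} {v : ℝ} (h : G.CReach i j p v) :
    ∃ I J x y, G.IsChainFrom i j p I J x y ∧
      ∃ N₀, ∀ N ≥ N₀, ∑ k ∈ Finset.range N, G.stepGain I J x y k = v := by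
  have cons : ∀ {i j i' j' : ℕ} {p q : ℝ × ℝ} {v : ℝ}, G.IsBl i j → G.Mem i j p → G.Mem i j q →
      p ≤ q → ((i' = i + 1 ∧ j' = j ∧ q.1 = G.s i) ∨ (j' = j + 1 ∧ i' = i ∧ q.2 = G.t j) ∨
      (i = G.m ∧ j = G.n ∧ i' = G.m ∧ j' = G.n ∧ q.1 = 1 ∧ q.2 = 1)) →
      (∃ I J x y, G.IsChainFrom i' j' q I J x y ∧
        ∃ N₀, ∀ N ≥ N₀, ∑ k ∈ Finset.range N, G.stepGain I J x y k = v) →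
      ∃ I J x y, G.IsChainFrom i j p I J x y ∧
        ∃ N₀, ∀ N ≥ N₀, ∑ k ∈ Finset.range N, G.stepGain I J x y k = G.gain i j p q + v := by
    rintro i j i' j' p q v hb hp hq hpq hn ⟨I, J, x, y, hc, N₀, hN⟩
    refine ⟨_, _, _, _, hc.prepend hb hp hq hpq hn, N₀ + 1, fun N hN' => ?_⟩
    obtain ⟨N, rfl⟩ : ∃ N', N = N' + 1 := ⟨N - 1, by omega⟩
    rw [Finset.sum_range_succ', stepGain_prepend hc, add_comm, ← hN N (by omega)]
    rfl
  have hbl : G.IsBl G.m G.n := ⟨G.hs.pos, le_rfl, G.ht.pos, le_rfl⟩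
  have hlast : G.Mem G.m G.n (1, 1) :=
    ⟨⟨(G.hs.mem (Nat.sub_le _ _)).2, G.hs.2.1.ge⟩, ⟨(G.ht.mem (Nat.sub_le _ _)).2, G.ht.2.1.ge⟩⟩
  induction h with
  | @last p hp =>
    have := cons (v := 0) hbl hp hlast (hp.le_one hbl) (i' := G.m) (j' := G.n)
      (Or.inr (Or.inr (by simp))) ⟨fun _ => G.m, fun _ => G.n, fun _ => 1, fun _ => 1,
        ⟨by simp, fun _ => hbl, fun _ => hlast, fun _ => hlast, by simp, by simp⟩, 0,
        fun N _ => Finset.sum_eq_zero fun k _ => gain_eq_zero (by simp)⟩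
    simpa using this
  | right hb hp hq hpq hq1 _ ih => exact cons hb hp hq hpq (Or.inl ⟨rfl, rfl, hq1⟩) ih
  | up hb hp hq hpq hq1 _ ih => exact cons hb hp hq hpq (Or.inr (Or.inl ⟨rfl, rfl, hq1⟩)) ih

/-- A chain from `(0,0)` to `(1,1)`. -/
abbrev IsChain (G : Grid) (I J : ℕ → ℕ) (x y : ℕ → ℝ) : Prop := G.IsChainFrom 1 1 0 I J x y

variable {I J : ℕ → ℕ} {x y : ℕ → ℝ}

theorem IsChain.swap (h : G.IsChain I J x y) : G.swap.IsChain J I y x where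
  zero := ⟨h.zero.2.1, h.zero.1, h.zero.2.2.2, h.zero.2.2.1⟩
  isBl k := (h.isBl k).swap
  mem k := (h.mem k).swap
  mem' k := (h.mem' k).swap
  mono k := (h.mono k).symm
  next k := by
    rcases h.next k with h1 | h1 | ⟨h1, h2, h3, h4, h5, h6⟩
    · exact Or.inr (Or.inl h1)
    · exact Or.inl h1
    · exact Or.inr (Or.inr ⟨h2, h1, h4, h3, h6, h5⟩)

theorem stepGain_swap (k : ℕ) : G.swap.stepGain J I y x k = G.stepGain I J x y k :=
  gain_swap _ _ (x k, y k) (x (k + 1), y (k + 1))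

theorem totalGain_swap : G.swap.totalGain J I y x = G.totalGain I J x y := by
  unfold totalGain
  rw [show G.swap.m + G.swap.n = G.m + G.n from add_comm _ _]
  exact Finset.sum_congr rfl fun k _ => stepGain_swap k

theorem vertexCount_swap : G.swap.vertexCount y x = G.vertexCount x y := by
  classical
  unfold vertexCount
  rw [show G.swap.m + G.swap.n = G.m + G.n from add_comm _ _]
  congr 1
  ext k
  rw [Finset.mem_filter, Finset.mem_filter]
  exact and_congr_right fun _ => and_comm

/-- Every step into a new block raises `I + J` by one. As `I + J ≤ m + n`, the chain has arrived
after fewer than `m + n` steps, so the fixed number of summands in `totalGain` loses nothing. -/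
theorem IsChain.index_or (h : G.IsChain I J x y) (k : ℕ) :
    (I k + J k = k + 2) ∨ (x k = 1 ∧ y k = 1 ∧ I k = G.m ∧ J k = G.n) := by
  induction k with
  | zero => exact Or.inl (by rw [h.zero.1, h.zero.2.1])
  | succ k ih =>
    have hb := h.isBl (k + 1)
    have hm := h.mono k
    have hq := (h.mem' k).le_one (h.isBl k)
    rcases h.next k with ⟨h1, h2, h3⟩ | ⟨h1, h2, h3⟩ | ⟨h1, h2, h3, h4, h5, h6⟩
    · rcases ih with ih | ⟨ih1, ih2, ih3, ih4⟩
      · left; omega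
      · have := hb.2.1; omega
    · rcases ih with ih | ⟨ih1, ih2, ih3, ih4⟩
      · left; omega
      · have := hb.2.2.2; omega
    · exact Or.inr ⟨h5, h6, h3, h4⟩

theorem IsChain.eq_one (h : G.IsChain I J x y) {k : ℕ} (hk : G.m + G.n ≤ k + 1) :
    x k = 1 ∧ y k = 1 := by
  rcases h.index_or k with h1 | h1
  · have := (h.isBl k).2.1
    have := (h.isBl k).2.2.2
    omega
  · exact ⟨h1.1, h1.2.1⟩

theorem IsChain.stepGain_eq_zero (h : G.IsChain I J x y) {k : ℕ} (hk : G.m + G.n ≤ k + 1) :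
    G.stepGain I J x y k = 0 :=
  gain_eq_zero (Or.inr (Or.inl (by simp [(h.eq_one hk).1, (h.eq_one (k := k + 1) (by omega)).1])))

theorem IsChain.sum_range_eq (h : G.IsChain I J x y) {N : ℕ} (hN : G.m + G.n ≤ N) :
    ∑ k ∈ Finset.range N, G.stepGain I J x y k = G.totalGain I J x y := by
  refine (Finset.sum_subset (Finset.range_subset_range.2 hN) fun k _ hk => ?_).symm
  rw [Finset.mem_range, not_lt] at hk
  exact h.stepGain_eq_zero (by omega)

theorem Reach.exists_chain {v : ℝ} (h : G.Reach 0 1 v) :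
    ∃ I J x y, G.IsChain I J x y ∧ v ≤ G.totalGain I J x y := by
  obtain ⟨v', hv, h'⟩ := h.exists_cReach rfl (i := 1) (j := 1)
    ⟨le_rfl, G.hs.pos, le_rfl, G.ht.pos⟩
    ⟨⟨by simp [G.hs.1], (G.hs.mem G.hs.pos).1⟩, ⟨by simp [G.ht.1], (G.ht.mem G.ht.pos).1⟩⟩
  obtain ⟨I, J, x, y, hc, N₀, hN⟩ := h'.exists_chain
  refine ⟨I, J, x, y, hc, ?_⟩
  rw [← IsChain.sum_range_eq hc (le_max_left _ N₀), hN _ (le_max_right _ _)]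
  exact hv

theorem IsChainFrom.reach {i j : ℕ} {p : ℝ × ℝ} (h : G.IsChainFrom i j p I J x y) {a b : ℕ}
    (hab : a ≤ b) :
    G.Reach (x a, y a) (x b, y b) (∑ k ∈ Finset.Ico a b, G.stepGain I J x y k) := by
  induction b, hab using Nat.le_induction with
  | base => simpa using Reach.refl _
  | succ b hb ih =>
    rw [Finset.sum_Ico_succ_top hb]
    exact ih.trans (Reach.single (h.isBl b) (h.mem b) (h.mem' b) (h.mono b))

/-- The indices range over finite sets and the coordinates over `[0,1]`, so the ambient product is
compact by Tychonoff. Each requirement on a chain involves finitely many entries and is closed: the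
indices are discrete, and the coordinates enter only through equations and weak inequalities. -/
theorem isCompact_chains (G : Grid) :
    IsCompact {c : (ℕ → ℕ) × (ℕ → ℕ) × (ℕ → ℝ) × (ℕ → ℝ) |
      G.IsChain c.1 c.2.1 c.2.2.1 c.2.2.2} := by
  let K : Set ((ℕ → ℕ) × (ℕ → ℕ) × (ℕ → ℝ) × (ℕ → ℝ)) :=
    (univ.pi fun _ => Iic G.m) ×ˢ (univ.pi fun _ => Iic G.n) ×ˢ
      (univ.pi fun _ => Icc 0 1) ×ˢ (univ.pi fun _ => Icc 0 1)
  have hK : IsCompact K :=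
    (isCompact_univ_pi fun _ => (finite_Iic _).isCompact).prod
      ((isCompact_univ_pi fun _ => (finite_Iic _).isCompact).prod
        ((isCompact_univ_pi fun _ => isCompact_Icc).prod
          (isCompact_univ_pi fun _ => isCompact_Icc)))
  refine hK.of_isClosed_subset ?_ ?_
  · have cI : ∀ k, Continuous fun c : (ℕ → ℕ) × (ℕ → ℕ) × (ℕ → ℝ) × (ℕ → ℝ) => c.1 k := by fun_prop
    have cJ : ∀ k, Continuous fun c : (ℕ → ℕ) × (ℕ → ℕ) × (ℕ → ℝ) × (ℕ → ℝ) => c.2.1 k := by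
      fun_prop
    have cx : ∀ k, Continuous fun c : (ℕ → ℕ) × (ℕ → ℕ) × (ℕ → ℝ) × (ℕ → ℝ) => c.2.2.1 k := by
      fun_prop
    have cy : ∀ k, Continuous fun c : (ℕ → ℕ) × (ℕ → ℕ) × (ℕ → ℝ) × (ℕ → ℝ) => c.2.2.2 k := by
      fun_prop
    have hdisc : ∀ (P : ℕ → ℕ → ℕ → ℕ → Prop) (k : ℕ),
        IsClosed {c : (ℕ → ℕ) × (ℕ → ℕ) × (ℕ → ℝ) × (ℕ → ℝ) |
          P (c.1 k) (c.2.1 k) (c.1 (k + 1)) (c.2.1 (k + 1))} := fun P k =>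
      (isClosed_discrete {q : ℕ × ℕ × ℕ × ℕ | P q.1 q.2.1 q.2.2.1 q.2.2.2}).preimage
        ((cI k).prodMk ((cJ k).prodMk ((cI (k + 1)).prodMk (cJ (k + 1)))))
    have hf : ∀ (f : ℕ → ℝ) {g : (ℕ → ℕ) × (ℕ → ℕ) × (ℕ → ℝ) × (ℕ → ℝ) → ℕ}, Continuous g →
        Continuous fun c => f (g c) := fun f _ hg =>
      (continuous_of_discreteTopology (f := f)).comp hg
    have hmem : ∀ k l, IsClosed {c : (ℕ → ℕ) × (ℕ → ℕ) × (ℕ → ℝ) × (ℕ → ℝ) |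
        G.Mem (c.1 k) (c.2.1 k) (c.2.2.1 l, c.2.2.2 l)} := fun k l =>
      ((isClosed_le (hf (fun i => G.s (i - 1)) (cI k)) (cx l)).inter
        (isClosed_le (cx l) (hf G.s (cI k)))).inter
      ((isClosed_le (hf (fun i => G.t (i - 1)) (cJ k)) (cy l)).inter
        (isClosed_le (cy l) (hf G.t (cJ k))))
    have e : {c : (ℕ → ℕ) × (ℕ → ℕ) × (ℕ → ℝ) × (ℕ → ℝ) |
        G.IsChain c.1 c.2.1 c.2.2.1 c.2.2.2} =
        {c | c.1 0 = 1 ∧ c.2.1 0 = 1} ∩ ({c | c.2.2.1 0 = 0} ∩ {c | c.2.2.2 0 = 0}) ∩ ⋂ k,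
          ({c | G.IsBl (c.1 k) (c.2.1 k)} ∩ {c | G.Mem (c.1 k) (c.2.1 k) (c.2.2.1 k, c.2.2.2 k)} ∩
          {c | G.Mem (c.1 k) (c.2.1 k) (c.2.2.1 (k + 1), c.2.2.2 (k + 1))} ∩
          ({c | c.2.2.1 k ≤ c.2.2.1 (k + 1)} ∩ {c | c.2.2.2 k ≤ c.2.2.2 (k + 1)}) ∩
          (({c | c.1 (k + 1) = c.1 k + 1 ∧ c.2.1 (k + 1) = c.2.1 k} ∩
              {c | c.2.2.1 (k + 1) = G.s (c.1 k)}) ∪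
            (({c | c.2.1 (k + 1) = c.2.1 k + 1 ∧ c.1 (k + 1) = c.1 k} ∩
              {c | c.2.2.2 (k + 1) = G.t (c.2.1 k)}) ∪
            ({c | c.1 k = G.m ∧ c.2.1 k = G.n ∧ c.1 (k + 1) = G.m ∧ c.2.1 (k + 1) = G.n} ∩
              ({c | c.2.2.1 (k + 1) = 1} ∩ {c | c.2.2.2 (k + 1) = 1}))))) := by
      ext ⟨I, J, x, y⟩
      simp only [mem_ofPred_eq, mem_inter_iff, mem_iInter, mem_union]
      constructor
      · intro h
        refine ⟨⟨⟨h.zero.1, h.zero.2.1⟩, h.zero.2.2⟩, fun k => ⟨⟨⟨⟨h.isBl k, h.mem k⟩, h.mem' k⟩,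
          h.mono k⟩, ?_⟩⟩
        simpa [and_assoc] using h.next k
      · rintro ⟨⟨⟨h1, h2⟩, h3⟩, h⟩
        exact ⟨⟨h1, h2, h3⟩, fun k => (h k).1.1.1.1, fun k => (h k).1.1.1.2, fun k => (h k).1.1.2,
          fun k => (h k).1.2, fun k => by simpa [and_assoc] using (h k).2⟩
    rw [e]
    refine (((hdisc (fun i j _ _ => i = 1 ∧ j = 1) 0).inter
      ((isClosed_eq (cx 0) continuous_const).inter (isClosed_eq (cy 0) continuous_const)))).inter
      (isClosed_iInter fun k => ((((hdisc (fun i j _ _ => G.IsBl i j) k).inter (hmem k k)).inter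
        (hmem k (k + 1))).inter ((isClosed_le (cx k) (cx (k + 1))).inter
          (isClosed_le (cy k) (cy (k + 1))))).inter ?_)
    refine ((hdisc (fun i j i' j' => i' = i + 1 ∧ j' = j) k).inter
      (isClosed_eq (cx _) (hf G.s (cI k)))).union
      (((hdisc (fun i j i' j' => j' = j + 1 ∧ i' = i) k).inter
        (isClosed_eq (cy _) (hf G.t (cJ k)))).union
      ((hdisc (fun i j i' j' => i = G.m ∧ j = G.n ∧ i' = G.m ∧ j' = G.n) k).inter
        ((isClosed_eq (cx _) continuous_const).inter (isClosed_eq (cy _) continuous_const))))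
  · rintro ⟨I, J, x, y⟩ h
    have h0 := fun k => (h.mem k).nonneg (h.isBl k)
    have h1 := fun k => (h.mem k).le_one (h.isBl k)
    exact ⟨fun k _ => (h.isBl k).2.1, fun k _ => (h.isBl k).2.2.2,
      fun k _ => ⟨(h0 k).1, (h1 k).1⟩, fun k _ => ⟨(h0 k).2, (h1 k).2⟩⟩

/-- A chain of the largest possible gain that, among all such chains, is at a vertex at as many
indices as possible. -/
structure IsOptimal (G : Grid) (I J : ℕ → ℕ) (x y : ℕ → ℝ) : Prop extends
    IsChain G I J x y where
  reach_le : ∀ {v}, G.Reach 0 1 v → v ≤ G.totalGain I J x y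
  count_le : ∀ {I' J' x' y'}, G.IsChain I' J' x' y' →
    G.totalGain I J x y ≤ G.totalGain I' J' x' y' → G.vertexCount x' y' ≤ G.vertexCount x y

theorem exists_isOptimal (G : Grid) : ∃ I J x y, G.IsOptimal I J x y := by
  obtain ⟨I₀, J₀, x₀, y₀, h₀, -⟩ := Reach.exists_chain (G := G)
    (Reach.zero le_rfl (zero_le_one) le_rfl)
  have hcont : Continuous fun c : (ℕ → ℕ) × (ℕ → ℕ) × (ℕ → ℝ) × (ℕ → ℝ) =>
      G.totalGain c.1 c.2.1 c.2.2.1 c.2.2.2 := by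
    refine continuous_finsetSum _ fun k _ => ?_
    have hW : Continuous fun c : (ℕ → ℕ) × (ℕ → ℕ) × (ℕ → ℝ) × (ℕ → ℝ) =>
        max (G.W (c.1 k) (c.2.1 k)) 0 :=
      (continuous_of_discreteTopology (f := fun q : ℕ × ℕ => max (G.W q.1 q.2) 0)).comp
        (by fun_prop : Continuous fun c : (ℕ → ℕ) × (ℕ → ℕ) × (ℕ → ℝ) × (ℕ → ℝ) =>
          (c.1 k, c.2.1 k))
    exact hW.mul (by fun_prop)
  obtain ⟨c, hc, hmax⟩ := G.isCompact_chains.exists_isMaxOn ⟨(I₀, J₀, x₀, y₀), h₀⟩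
    hcont.continuousOn
  set M := G.totalGain c.1 c.2.1 c.2.2.1 c.2.2.2
  -- The number of vertices is not continuous, but it is a bounded natural number, so it attains its
  -- supremum on the set of maximizers.
  let S : Set ℕ := {r | ∃ I J x y, G.IsChain I J x y ∧ M ≤ G.totalGain I J x y ∧
    G.vertexCount x y = r}
  have hS : sSup S ∈ S := by
    refine Nat.sSup_mem ⟨_, c.1, c.2.1, c.2.2.1, c.2.2.2, hc, le_rfl, rfl⟩ ⟨G.m + G.n, ?_⟩
    rintro _ ⟨I, J, x, y, -, -, rfl⟩
    exact vertexCount_le x y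
  have hB : BddAbove S := by
    refine ⟨G.m + G.n, ?_⟩
    rintro _ ⟨I, J, x, y, -, -, rfl⟩
    exact vertexCount_le x y
  obtain ⟨I, J, x, y, h, hM, hr⟩ := hS
  refine ⟨I, J, x, y, h, fun hv => ?_, fun {I' J' x' y'} h' hM' => ?_⟩
  · obtain ⟨I', J', x', y', h', hv'⟩ := hv.exists_chain
    exact hv'.trans ((hmax (show (I', J', x', y') ∈ _ from h')).trans hM)
  · rw [hr]
    exact le_csSup hB ⟨I', J', x', y', h', hM.trans hM', rfl⟩

end Grid

/-! ### Two optimization problems with square roots -/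

/-- A square root gains more than any smooth loss. -/
theorem nonpos_of_forall_add_sqrt_le {A B D δ : ℝ} (hA : 0 ≤ A) (hD : 0 < D) (hδ : 0 < δ)
    (h : ∀ ε, 0 < ε → ε ≤ δ → ε ≤ D → A * √(D - ε) + B * √ε ≤ A * √D) : B ≤ 0 := by
  by_contra! hB
  have hD' : 0 < √D := Real.sqrt_pos.2 hD
  -- The loss `A * (√D - √(D - ε))` is at most `A * ε / √D`. It is smaller than the supposed gain `B
  -- * √ε` as soon as `A * √ε < B * √D`, and `√ε ≤ c` ensures this.
  set c : ℝ := B * √D / (2 * (A + 1)) with hc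
  have hc0 : 0 < c := by positivity
  set ε : ℝ := min δ (min D (c ^ 2)) with hε
  have hε0 : 0 < ε := lt_min hδ (lt_min hD (by positivity))
  have hεD : ε ≤ D := (min_le_right _ _).trans (min_le_left _ _)
  have h1 := h ε hε0 (min_le_left _ _) hεD
  have h2 : √ε ≤ c := by
    rw [← Real.sqrt_sq hc0.le]
    exact Real.sqrt_le_sqrt ((min_le_right _ _).trans (min_le_right _ _))
  have h3 : D - ε ≤ √D * √(D - ε) := by
    have h4 : √(D - ε) ≤ √D := Real.sqrt_le_sqrt (by linarith)
    nlinarith [Real.sq_sqrt (sub_nonneg.2 hεD), Real.sqrt_nonneg (D - ε)]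
  have h5 : 0 < √ε := Real.sqrt_pos.2 hε0
  have h6 : √D * (B * √ε) ≤ A * (√ε * √ε) := by
    rw [Real.mul_self_sqrt hε0.le]
    nlinarith [Real.mul_self_sqrt hD.le]
  have h7 : √D * B ≤ A * √ε := by
    by_contra! h8
    nlinarith
  have h8 : A * √ε ≤ A * c := by gcongr
  have h9 : c * (2 * (A + 1)) = B * √D := by
    rw [hc]; field_simp
  nlinarith

/-- The optimality condition for the crossing of a gridline. -/
theorem crossing_condition {A B a b Y lo hi : ℝ} (hA : 0 < A) (hB : 0 < B) (haY : a < Y)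
    (hYb : Y ≤ b) (hlo : lo < Y) (hhi : Y < hi)
    (h : ∀ η, a ≤ η → η ≤ b → lo ≤ η → η ≤ hi →
      A * √(η - a) + B * √(b - η) ≤ A * √(Y - a) + B * √(b - Y)) :
    Y < b ∧ A ^ 2 * (b - Y) = B ^ 2 * (Y - a) := by
  rcases hYb.eq_or_lt with rfl | hYb
  -- If `Y = b`, the second root vanishes at the maximum, and lowering `η` by `ε` would gain `B *
  -- √ε`.
  · refine absurd (nonpos_of_forall_add_sqrt_le (A := A) (B := B) (D := Y - a) (δ := Y - lo) hA.le
      (by linarith) (by linarith) fun ε h0 h1 h2 => ?_) (not_le.2 hB)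
    have := h (Y - ε) (by linarith) (by linarith) (by linarith) (by linarith)
    rw [show Y - ε - a = Y - a - ε by ring, show Y - (Y - ε) = ε by ring] at this
    simpa using this
  refine ⟨hYb, ?_⟩
  have hmax : IsLocalMax (fun η => A * √(η - a) + B * √(b - η)) Y := by
    have : ∀ᶠ η in nhds Y, η ∈ Ioo (max a lo) (min b hi) :=
      Ioo_mem_nhds (max_lt haY hlo) (lt_min hYb hhi)
    filter_upwards [this] with η hη
    exact h η ((le_max_left _ _).trans hη.1.le) (hη.2.le.trans (min_le_left _ _))
      ((le_max_right _ _).trans hη.1.le) (hη.2.le.trans (min_le_right _ _))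
  have h1 : 0 < Y - a := sub_pos.2 haY
  have h2 : 0 < b - Y := sub_pos.2 hYb
  have hd : HasDerivAt (fun η => A * √(η - a) + B * √(b - η))
      (A * (1 / (2 * √(Y - a))) + B * (-1 / (2 * √(b - Y)))) Y :=
    ((((hasDerivAt_id Y).sub_const a).sqrt h1.ne').const_mul A).add
      ((((hasDerivAt_id Y).const_sub b).sqrt h2.ne').const_mul B)
  have h3 := hmax.hasDerivAt_eq_zero hd
  have h4 := Real.sqrt_pos.2 h1
  have h5 := Real.sqrt_pos.2 h2
  have h6 : A * √(b - Y) = B * √(Y - a) := by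
    field_simp at h3
    linarith
  have h7 : (A * √(b - Y)) ^ 2 = (B * √(Y - a)) ^ 2 := by rw [h6]
  rwa [mul_pow, mul_pow, Real.sq_sqrt h1.le, Real.sq_sqrt h2.le] at h7

/-! ### The local structure of optimal chains at gridlines. -/

namespace Grid

variable {G : Grid} {I J : ℕ → ℕ} {x y : ℕ → ℝ}

theorem gain_le_gain {i j : ℕ} {p q p' q' : ℝ × ℝ} (h0 : p.1 ≤ q.1) (h0' : p.2 ≤ q.2)
    (h1 : q.1 - p.1 ≤ q'.1 - p'.1) (h2 : q.2 - p.2 ≤ q'.2 - p'.2) :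
    G.gain i j p q ≤ G.gain i j p' q' := by
  unfold gain
  have := sub_nonneg.2 h0
  have := sub_nonneg.2 h0'
  gcongr
  linarith

theorem isVertex_swap {a b : ℝ} : G.swap.IsVertex b a ↔ G.IsVertex a b := and_comm

/-- The `k`-th step of a chain ends on the right edge of its block. -/
def ExitRight (G : Grid) (I J : ℕ → ℕ) (x : ℕ → ℝ) (k : ℕ) : Prop :=
  I (k + 1) = I k + 1 ∧ J (k + 1) = J k ∧ x (k + 1) = G.s (I k)

/-- The `k`-th step of a chain ends on the upper edge of its block. -/
abbrev ExitUp (G : Grid) (I J : ℕ → ℕ) (y : ℕ → ℝ) (k : ℕ) : Prop := G.swap.ExitRight J I y k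

theorem IsOptimal.swap (h : G.IsOptimal I J x y) : G.swap.IsOptimal J I y x where
  toIsChainFrom := IsChain.swap h.toIsChainFrom
  reach_le hv := by
    rw [totalGain_swap]
    exact h.reach_le hv.swap
  count_le {I' J' x' y'} h' hM := by
    have h1 := h.count_le (IsChain.swap h')
      ((totalGain_swap (G := G)).symm.trans_le (hM.trans_eq (totalGain_swap (G := G.swap)).symm))
    exact (vertexCount_swap (G := G) (x := y') (y := x')).trans_le
      (h1.trans_eq (vertexCount_swap (G := G)).symm)

theorem IsChain.isVertex_zero (h : G.IsChain I J x y) : G.IsVertex (x 0) (y 0) :=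
  ⟨⟨0, Nat.zero_le _, by simp [h.zero.2.2.1, G.hs.1]⟩,
    ⟨0, Nat.zero_le _, by simp [h.zero.2.2.2, G.ht.1]⟩⟩

theorem isVertex_one : G.IsVertex 1 1 := ⟨⟨_, le_rfl, G.hs.2.1⟩, ⟨_, le_rfl, G.ht.2.1⟩⟩

theorem IsChain.isVertex_of_le (h : G.IsChain I J x y) {k : ℕ} (hk : G.m + G.n ≤ k + 1) :
    G.IsVertex (x k) (y k) := by
  rw [(h.eq_one hk).1, (h.eq_one hk).2]
  exact isVertex_one

theorem IsChain.exit_of_not_isVertex (h : G.IsChain I J x y) {k : ℕ}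
    (hk : ¬ G.IsVertex (x (k + 1)) (y (k + 1))) : G.ExitRight I J x k ∨ G.ExitUp I J y k := by
  rcases h.next k with h1 | h1 | ⟨-, -, -, -, h5, h6⟩
  · exact Or.inl h1
  · exact Or.inr h1
  · rw [h5, h6] at hk
    exact absurd isVertex_one hk

theorem ExitRight.isNode (h : G.IsChain I J x y) {k : ℕ} (hk : G.ExitRight I J x k) :
    IsNode G.s G.m (x (k + 1)) := ⟨I k, (h.isBl k).2.1, hk.2.2.symm⟩

theorem ExitRight.not_isNode (h : G.IsChain I J x y) {k : ℕ} (hk : G.ExitRight I J x k)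
    (hv : ¬ G.IsVertex (x (k + 1)) (y (k + 1))) : ¬ IsNode G.t G.n (y (k + 1)) :=
  fun hn => hv ⟨hk.isNode h, hn⟩

theorem ExitRight.mem_Ioo (h : G.IsChain I J x y) {k : ℕ} (hk : G.ExitRight I J x k)
    (hv : ¬ G.IsVertex (x (k + 1)) (y (k + 1))) :
    G.t (J k - 1) < y (k + 1) ∧ y (k + 1) < G.t (J k) := by
  have hn := hk.not_isNode h hv
  have hm := (h.mem' k).2
  have hb := (h.isBl k).2.2
  exact ⟨hm.1.lt_of_ne fun e => hn ⟨_, (Nat.sub_le _ _).trans hb.2, e⟩,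
    hm.2.lt_of_ne fun e => hn ⟨_, hb.2, e.symm⟩⟩

theorem IsChain.not_isVertex_of_mem_Ioo (h : G.IsChain I J x y) {k l : ℕ}
    (h1 : G.t (J k - 1) < y l) (h2 : y l < G.t (J k)) : ¬ G.IsVertex (x l) (y l) :=
  fun hv => G.ht.not_isNode (h.isBl k).2.2.2 h1 h2 hv.2

/-- A point at which a chain crosses a vertical gridline may be moved up and down. -/
theorem ExitRight.update (h : G.IsChain I J x y) {k : ℕ} (hk : G.ExitRight I J x k) {η : ℝ}
    (h1 : y k ≤ η) (h2 : η ≤ y (k + 2)) (h3 : G.t (J k - 1) ≤ η) (h4 : η ≤ G.t (J k)) :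
    G.IsChain I J x (Function.update y (k + 1) η) where
  zero := by
    rw [Function.update_of_ne (by omega)]
    exact h.zero
  isBl := h.isBl
  mem l := by
    by_cases hl : l = k + 1
    · subst hl
      rw [Function.update_self]
      refine ⟨(h.mem (k + 1)).1, ?_⟩
      rw [hk.2.1]
      exact ⟨h3, h4⟩
    · rw [Function.update_of_ne hl]
      exact h.mem l
  mem' l := by
    by_cases hl : l + 1 = k + 1
    · obtain rfl : l = k := by omega
      rw [Function.update_self]
      exact ⟨(h.mem' l).1, h3, h4⟩
    · rw [Function.update_of_ne hl]
      exact h.mem' l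
  mono l := by
    refine ⟨(h.mono l).1, ?_⟩
    by_cases hl : l = k
    · subst hl
      rw [Function.update_self, Function.update_of_ne (by omega)]
      exact h1
    by_cases hl : l = k + 1
    · subst hl
      rw [Function.update_self, Function.update_of_ne (by omega)]
      exact h2
    · rw [Function.update_of_ne (by omega), Function.update_of_ne (by omega)]
      exact (h.mono l).2
  next l := by
    by_cases hl : l = k
    · subst hl
      exact Or.inl hk
    · rw [Function.update_of_ne (by omega)]
      exact h.next l

/-- The tie-break at work: if the crossing point can be moved to an end of the edge and neither
adjacent step loses, the new chain has the same vertices and one more. -/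
theorem IsOptimal.false_of_update (h : G.IsOptimal I J x y) {k : ℕ} (hk : G.ExitRight I J x k)
    (hv : ¬ G.IsVertex (x (k + 1)) (y (k + 1))) {η : ℝ} (h1 : y k ≤ η) (h2 : η ≤ y (k + 2))
    (h3 : η = G.t (J k - 1) ∨ η = G.t (J k))
    (hg1 : G.stepGain I J x y k ≤ G.gain (I k) (J k) (x k, y k) (x (k + 1), η))
    (hg2 : G.stepGain I J x y (k + 1) ≤
      G.gain (I (k + 1)) (J (k + 1)) (x (k + 1), η) (x (k + 2), y (k + 2))) : False := by
  classical
  have hb := h.isBl k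
  have hle := G.ht.le (Nat.sub_le (J k) 1) hb.2.2.2
  have hη : IsNode G.t G.n η := by
    rcases h3 with h3 | h3
    · exact ⟨_, (Nat.sub_le _ _).trans hb.2.2.2, h3.symm⟩
    · exact ⟨_, hb.2.2.2, h3.symm⟩
  have hc := hk.update h.toIsChainFrom h1 h2 (by rcases h3 with h3 | h3 <;> linarith)
    (by rcases h3 with h3 | h3 <;> linarith)
  have hcount := h.count_le hc (Finset.sum_le_sum fun l _ => ?_)
  · refine absurd hcount (not_le.2 (Finset.card_lt_card ?_))
    refine Finset.ssubset_iff_of_subset (fun l hl => ?_) |>.2 ⟨k + 1, ?_, ?_⟩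
    · rw [Finset.mem_filter] at hl ⊢
      refine ⟨hl.1, ?_⟩
      by_cases hlk : l = k + 1
      · subst hlk
        exact absurd hl.2 hv
      · rw [Function.update_of_ne hlk]
        exact hl.2
    · rw [Finset.mem_filter, Function.update_self, Finset.mem_range]
      refine ⟨?_, hk.isNode h.toIsChainFrom, hη⟩
      by_contra! hc
      exact hv (IsChain.isVertex_of_le h.toIsChainFrom (by omega))
    · rw [Finset.mem_filter]
      exact fun h => hv h.2
  · by_cases hl : l = k
    · subst hl
      unfold stepGain at hg1 ⊢
      rwa [Function.update_self, Function.update_of_ne (by omega)]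
    by_cases hl : l = k + 1
    · subst hl
      unfold stepGain at hg2 ⊢
      rwa [Function.update_self, Function.update_of_ne (by omega)]
    · unfold stepGain
      rw [Function.update_of_ne (by omega), Function.update_of_ne (by omega)]

/-- Step `k` gains nothing, so the crossing point may slide down to the height `y k`, which only
enlarges step `k + 1`. If `y k` were on the lower edge, this would create a vertex. -/
theorem IsOptimal.lt_of_gain_zero (h : G.IsOptimal I J x y) {k : ℕ} (hk : G.ExitRight I J x k)
    (hv : ¬ G.IsVertex (x (k + 1)) (y (k + 1))) (hz : G.W (I k) (J k) ≤ 0 ∨ x k = x (k + 1)) :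
    G.t (J k - 1) < y k := by
  by_contra! hc
  have hy : y k = G.t (J k - 1) := le_antisymm hc (h.mem k).2.1
  refine h.false_of_update hk hv le_rfl ((h.mono k).2.trans (h.mono (k + 1)).2) (Or.inl hy) ?_ ?_
  · rw [stepGain, gain_eq_zero (by tauto)]
    exact gain_nonneg _ _ _ _
  · exact gain_le_gain (h.mono (k + 1)).1 (h.mono (k + 1)).2 le_rfl
      (sub_le_sub_left (h.mono k).2 _)

/-- The same with the crossing point sliding up to the height `y (k + 2)`. -/
theorem IsOptimal.lt_of_gain_succ_zero (h : G.IsOptimal I J x y) {k : ℕ}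
    (hk : G.ExitRight I J x k) (hv : ¬ G.IsVertex (x (k + 1)) (y (k + 1)))
    (hz : G.W (I (k + 1)) (J (k + 1)) ≤ 0 ∨ x (k + 1) = x (k + 2)) : y (k + 2) < G.t (J k) := by
  by_contra! hc
  have hy : y (k + 2) = G.t (J k) := le_antisymm (by simpa [hk.2.1] using (h.mem' (k + 1)).2.2) hc
  refine h.false_of_update hk hv ((h.mono k).2.trans (h.mono (k + 1)).2) le_rfl (Or.inr hy) ?_ ?_
  · exact gain_le_gain (h.mono k).1 (h.mono k).2 le_rfl (sub_le_sub_right (h.mono (k + 1)).2 _)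
  · rw [stepGain, gain_eq_zero (by tauto)]
    exact gain_nonneg _ _ _ _

/-- By the preceding inequality the height `y k` lies strictly between two horizontal gridlines.
Hence the chain is not at a vertex there and can only have come through a right edge. -/
theorem IsOptimal.exitRight_pred (h : G.IsOptimal I J x y) {k : ℕ} (hk : G.ExitRight I J x k)
    (hv : ¬ G.IsVertex (x (k + 1)) (y (k + 1))) (hz : G.W (I k) (J k) ≤ 0 ∨ x k = x (k + 1)) :
    ¬ G.IsVertex (x k) (y k) ∧ ∃ l, k = l + 1 ∧ G.ExitRight I J x l := by
  have h1 := h.lt_of_gain_zero hk hv hz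
  have h2 := (h.mono k).2.trans_lt (hk.mem_Ioo h.toIsChainFrom hv).2
  have h3 := IsChain.not_isVertex_of_mem_Ioo h.toIsChainFrom h1 h2
  refine ⟨h3, ?_⟩
  rcases k with _ | l
  · exact absurd (IsChain.isVertex_zero h.toIsChainFrom) h3
  refine ⟨l, rfl, ?_⟩
  rcases IsChain.exit_of_not_isVertex h.toIsChainFrom h3 with h4 | h4
  · exact h4
  · exact absurd ⟨_, (h.isBl l).2.2.2, h4.2.2.symm⟩ (G.ht.not_isNode (h.isBl _).2.2.2 h1 h2)

theorem IsOptimal.exitRight_succ (h : G.IsOptimal I J x y) {k : ℕ} (hk : G.ExitRight I J x k)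
    (hv : ¬ G.IsVertex (x (k + 1)) (y (k + 1)))
    (hz : G.W (I (k + 1)) (J (k + 1)) ≤ 0 ∨ x (k + 1) = x (k + 2)) :
    ¬ G.IsVertex (x (k + 2)) (y (k + 2)) ∧ G.ExitRight I J x (k + 1) := by
  have h2 := h.lt_of_gain_succ_zero hk hv hz
  have h1 := (hk.mem_Ioo h.toIsChainFrom hv).1.trans_le (h.mono (k + 1)).2
  have h3 := IsChain.not_isVertex_of_mem_Ioo h.toIsChainFrom h1 h2
  refine ⟨h3, ?_⟩
  rcases IsChain.exit_of_not_isVertex h.toIsChainFrom h3 with h4 | h4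
  · exact h4
  · exact absurd ⟨_, (h.isBl (k + 1)).2.2.2, h4.2.2.symm⟩
      (G.ht.not_isNode (h.isBl k).2.2.2 h1 h2)

/-- A vertical step gains nothing, so by `exitRight_pred` it begins on the gridline to the left of
its block; yet it ends on the gridline to the right. -/
theorem IsOptimal.fst_lt (h : G.IsOptimal I J x y) {k : ℕ} (hk : G.ExitRight I J x k)
    (hv : ¬ G.IsVertex (x (k + 1)) (y (k + 1))) : x k < x (k + 1) := by
  refine (h.mono k).1.lt_of_ne fun e => ?_
  obtain ⟨-, l, rfl, hl⟩ := h.exitRight_pred hk hv (Or.inr e)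
  rw [hl.2.2, hk.2.2, hl.1] at e
  exact absurd e (G.hs.lt (Nat.lt_succ_self _) (hl.1.symm.trans_le (h.isBl (l + 1)).2.1)).ne

theorem IsOptimal.fst_succ_lt (h : G.IsOptimal I J x y) {k : ℕ} (hk : G.ExitRight I J x k)
    (hv : ¬ G.IsVertex (x (k + 1)) (y (k + 1))) : x (k + 1) < x (k + 2) := by
  refine (h.mono (k + 1)).1.lt_of_ne fun e => ?_
  have hl := (h.exitRight_succ hk hv (Or.inr e)).2
  rw [hl.2.2, hk.2.2, hk.1] at e
  exact absurd e (G.hs.lt (Nat.lt_succ_self _) (hk.1.symm.trans_le (h.isBl (k + 1)).2.1)).ne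

/-- The principle of dynamic programming: each part of an optimal chain is optimal between its end
points, since it can be exchanged with the rest left as it is. -/
theorem IsOptimal.reach_le_sum (h : G.IsOptimal I J x y) {a b : ℕ} (hab : a ≤ b) {v : ℝ}
    (hv : G.Reach (x a, y a) (x b, y b) v) :
    v ≤ ∑ k ∈ Finset.Ico a b, G.stepGain I J x y k := by
  set N := max b (G.m + G.n)
  have hbN : b ≤ N := le_max_left _ _
  have h0 := h.reach (Nat.zero_le a)
  have h1 := h.reach hbN
  have hx0 : ((x 0, y 0) : ℝ × ℝ) = 0 := by rw [h.zero.2.2.1, h.zero.2.2.2]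
  have hN := IsChain.eq_one h.toIsChainFrom (k := N) ((le_max_right _ _).trans (Nat.le_succ _))
  have hxN : ((x N, y N) : ℝ × ℝ) = 1 := by rw [hN.1, hN.2]; rfl
  rw [hx0] at h0
  rw [hxN] at h1
  have h2 := h.reach_le (h0.trans (hv.trans h1))
  rw [← IsChain.sum_range_eq h.toIsChainFrom (N := N) (le_max_right _ _),
    Finset.range_eq_Ico, ← Finset.sum_Ico_consecutive _ (Nat.zero_le a) (hab.trans hbN),
    ← Finset.sum_Ico_consecutive _ hab hbN] at h2
  linarith

/-- Between a step in a block of positive weight and the end of the `k`-th step the chain crosses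
only vertical gridlines and blocks of non-positive weight, at constant height. -/
structure IsRun (G : Grid) (I J : ℕ → ℕ) (x y : ℕ → ℝ) (r k : ℕ) : Prop where
  le : r ≤ k
  pos : 0 < G.W (I r) (J r)
  nonpos : ∀ l, r < l → l ≤ k → G.W (I l) (J l) ≤ 0
  exit : ∀ l, r ≤ l → l ≤ k → G.ExitRight I J x l
  not_isVertex : ∀ l, r ≤ l → l ≤ k → ¬ G.IsVertex (x (l + 1)) (y (l + 1))
  height : ∀ l, r ≤ l → l ≤ k → y (l + 1) = y (k + 1)

theorem IsRun.index {r k : ℕ} (h : G.IsRun I J x y r k) (d : ℕ) (hd : r + d ≤ k + 1) :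
    I (r + d) = I r + d ∧ J (r + d) = J r := by
  induction d with
  | zero => simp
  | succ d ih =>
    have h1 := ih (by omega)
    have h2 := h.exit (r + d) (by omega) (by omega)
    exact ⟨by rw [← add_assoc, h2.1, h1.1]; rfl, by rw [← add_assoc, h2.2.1, h1.2]⟩

theorem IsRun.index_snd {r k : ℕ} (h : G.IsRun I J x y r k) {l : ℕ} (h1 : r ≤ l)
    (h2 : l ≤ k + 1) : J l = J r := by
  have := (h.index (l - r) (by omega)).2
  rwa [Nat.add_sub_cancel' h1] at this

/-- The crossing is traced back: behind a block of non-positive weight there is another right exit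
off the vertices. This cannot go on to the index `0`, where the chain is at a vertex, so a block of
positive weight is met. -/
theorem IsOptimal.exists_isRun (h : G.IsOptimal I J x y) {k : ℕ} (hk : G.ExitRight I J x k)
    (hv : ¬ G.IsVertex (x (k + 1)) (y (k + 1))) : ∃ r, G.IsRun I J x y r k := by
  induction k with
  | zero =>
    refine ⟨0, le_rfl, ?_, fun l h1 h2 => by omega, ?_, ?_, ?_⟩
    · by_contra! hc
      obtain ⟨-, l, hl, -⟩ := h.exitRight_pred hk hv (Or.inl hc)
      omega
    all_goals
      intro l _ h2
      obtain rfl : l = 0 := by omega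
      first | assumption | rfl
  | succ k ih =>
    rcases lt_or_ge 0 (G.W (I (k + 1)) (J (k + 1))) with hW | hW
    · refine ⟨k + 1, le_rfl, hW, fun l h1 h2 => by omega, ?_, ?_, ?_⟩
      all_goals
        intro l h1 h2
        obtain rfl : l = k + 1 := by omega
        first | assumption | rfl
    obtain ⟨hv', l, hl, hk'⟩ := h.exitRight_pred hk hv (Or.inl hW)
    obtain rfl : k = l := by omega
    obtain ⟨r, hr⟩ := ih hk' hv'
    have hx := h.fst_lt (hr.exit r le_rfl hr.le) (hr.not_isVertex r le_rfl hr.le)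
    have hJ := hr.index_snd (l := k + 1) (by have := hr.le; omega) le_rfl
    have hrk := hr.le
    have hmono : ∀ {a b : ℕ}, a ≤ b → x a ≤ x b ∧ y a ≤ y b := fun hab =>
      ⟨monotone_nat_of_le_succ (fun k => (h.mono k).1) hab,
        monotone_nat_of_le_succ (fun k => (h.mono k).2) hab⟩
    -- If the chain rose in the last block, which gains nothing, the step `r` of positive weight
    -- could climb to the height `y (k + 2)` at once. As its width is positive, its gain would grow
    -- strictly.
    have hY : y (k + 2) = y (k + 1) := by
      refine le_antisymm ?_ (h.mono _).2
      by_contra! hlt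
      have hq : G.Mem (I r) (J r) (x (r + 1), y (k + 2)) :=
        ⟨(h.mem' r).1, (h.mem r).2.1.trans (hmono (by omega)).2, by
          rw [← hJ]; exact (h.mem' (k + 1)).2.2⟩
      have h1 := Reach.single (h.isBl r) (h.mem r) hq
        ⟨(h.mono r).1, (hmono (by omega : r ≤ k + 2)).2⟩
      have h2 : G.Reach (x (r + 1), y (k + 2)) (x (k + 2), y (k + 2)) 0 :=
        Reach.zero (hq.nonneg (h.isBl r)) ⟨(hmono (by omega)).1, le_rfl⟩
          ((h.mem' (k + 1)).le_one (h.isBl _))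
      have h3 := h.reach_le_sum (by omega) (h1.trans h2)
      rw [Finset.sum_eq_sum_Ico_succ_bot (by omega), Finset.sum_eq_zero (s := Finset.Ico (r + 1) _),
        add_zero, add_zero, stepGain, gain_of_pos hr.pos, gain_of_pos hr.pos] at h3
      · have h4 := le_of_mul_le_mul_left h3 hr.pos
        rw [Real.sqrt_le_sqrt_iff
          (mul_nonneg (sub_nonneg.2 hx.le) (sub_nonneg.2 (h.mono r).2))] at h4
        have h5 := le_of_mul_le_mul_left h4 (sub_pos.2 hx)
        have h6 := hr.height r le_rfl hrk
        simp only at h5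
        linarith
      · intro l hl
        rw [Finset.mem_Ico] at hl
        refine gain_eq_zero (Or.inl ?_)
        rcases (by omega : l ≤ k ∨ l = k + 1) with h5 | rfl
        · exact hr.nonpos l (by omega) h5
        · exact hW
    refine ⟨r, by omega, hr.pos, fun l h1 h2 => ?_, fun l h1 h2 => ?_, fun l h1 h2 => ?_,
      fun l h1 h2 => ?_⟩ <;> rcases (by omega : l ≤ k ∨ l = k + 1) with h5 | rfl
    · exact hr.nonpos l h1 h5
    · exact hW
    · exact hr.exit l h1 h5
    · exact hk
    · exact hr.not_isVertex l h1 h5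
    · exact hv
    · rw [hr.height l h1 h5, hY]
    · rfl

theorem IsOptimal.snd_succ_eq (h : G.IsOptimal I J x y) {k : ℕ} (hk : G.ExitRight I J x k)
    (hv : ¬ G.IsVertex (x (k + 1)) (y (k + 1))) (hW : G.W (I k) (J k) ≤ 0) :
    y k = y (k + 1) := by
  obtain ⟨-, l, rfl, -⟩ := h.exitRight_pred hk hv (Or.inl hW)
  obtain ⟨r, hr⟩ := h.exists_isRun hk hv
  have := hr.le
  refine hr.height l ?_ (Nat.le_succ _)
  by_contra! hc
  obtain rfl : r = l + 1 := by omega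
  exact absurd hr.pos (not_lt.2 hW)

/-- All blocks of the run are in one row, so the level part can be moved as a whole to any height
`η` within this row. Only the two steps of positive weight feel the change, and `crossing_condition`
applies with the widths absorbed into the coefficients. -/
theorem IsRun.crossing (h : G.IsOptimal I J x y) {r k : ℕ} (hr : G.IsRun I J x y r k)
    (hW : 0 < G.W (I (k + 1)) (J (k + 1))) (hy : y r < y (r + 1)) :
    y (k + 1) < y (k + 2) ∧
      G.W (I r) (J r) ^ 2 * (x (r + 1) - x r) * (y (k + 2) - y (k + 1)) =
        G.W (I (k + 1)) (J (k + 1)) ^ 2 * (x (k + 2) - x (k + 1)) * (y (r + 1) - y r) := by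
  have hrk := hr.le
  have hx := h.fst_lt (hr.exit r le_rfl hrk) (hr.not_isVertex r le_rfl hrk)
  have hx' := h.fst_succ_lt (hr.exit k hrk le_rfl) (hr.not_isVertex k hrk le_rfl)
  have hI := (hr.exit k hrk le_rfl).mem_Ioo h.toIsChainFrom (hr.not_isVertex k hrk le_rfl)
  have hJ := hr.index_snd (l := k) (by omega) (by omega)
  have hJ' := hr.index_snd (l := k + 1) (by omega) (by omega)
  have hmono : ∀ {a b : ℕ}, a ≤ b → x a ≤ x b ∧ y a ≤ y b := fun hab =>
    ⟨monotone_nat_of_le_succ (fun k => (h.mono k).1) hab,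
      monotone_nat_of_le_succ (fun k => (h.mono k).2) hab⟩
  have hY := hr.height r le_rfl hrk
  set A := G.W (I r) (J r) * √(x (r + 1) - x r) with hA
  set B := G.W (I (k + 1)) (J (k + 1)) * √(x (k + 2) - x (k + 1)) with hB
  have hA0 : 0 < A := mul_pos hr.pos (Real.sqrt_pos.2 (sub_pos.2 hx))
  have hB0 : 0 < B := mul_pos hW (Real.sqrt_pos.2 (sub_pos.2 hx'))
  have key := crossing_condition hA0 hB0 (a := y r) (b := y (k + 2)) (Y := y (k + 1))
    (hY ▸ hy) (h.mono _).2 hI.1 hI.2 ?_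
  · refine ⟨key.1, ?_⟩
    have h2 := key.2
    rw [hA, hB, mul_pow, mul_pow, Real.sq_sqrt (sub_nonneg.2 hx.le),
      Real.sq_sqrt (sub_nonneg.2 hx'.le)] at h2
    rw [hY]
    exact h2
  · intro η h1 h2 h3 h4
    have hq : G.Mem (I r) (J r) (x (r + 1), η) := ⟨(h.mem' r).1, by rw [← hJ]; exact ⟨h3, h4⟩⟩
    have hq' : G.Mem (I (k + 1)) (J (k + 1)) (x (k + 1), η) :=
      ⟨(h.mem _).1, by rw [hJ', ← hJ]; exact ⟨h3, h4⟩⟩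
    have e1 := Reach.single (h.isBl r) (h.mem r) hq ⟨(h.mono r).1, h1⟩
    have e2 : G.Reach (x (r + 1), η) (x (k + 1), η) 0 :=
      Reach.zero (hq.nonneg (h.isBl r)) ⟨(hmono (by omega)).1, le_rfl⟩ (hq'.le_one (h.isBl _))
    have e3 := Reach.single (h.isBl (k + 1)) hq' (h.mem' (k + 1)) ⟨(h.mono _).1, h2⟩
    have e4 := h.reach_le_sum (by omega) (e1.trans (e2.trans e3))
    rw [Finset.sum_Ico_succ_top (by omega), Finset.sum_eq_sum_Ico_succ_bot (by omega),
      Finset.sum_eq_zero (s := Finset.Ico (r + 1) _), add_zero, zero_add, stepGain, stepGain,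
      gain_of_pos hr.pos, gain_of_pos hr.pos, gain_of_pos hW, gain_of_pos hW, hY] at e4
    · simp only at e4
      rwa [Real.sqrt_mul (sub_nonneg.2 hx.le), Real.sqrt_mul (sub_nonneg.2 hx.le),
        Real.sqrt_mul (sub_nonneg.2 hx'.le), Real.sqrt_mul (sub_nonneg.2 hx'.le), ← mul_assoc,
        ← mul_assoc, ← mul_assoc, ← mul_assoc] at e4
    · intro l hl
      rw [Finset.mem_Ico] at hl
      exact gain_eq_zero (Or.inl (hr.nonpos l (by omega) (by omega)))

/-- In a block of positive weight an optimal chain advances in both directions, unless it steps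
from a vertex to a vertex. -/
theorem IsOptimal.lt_of_pos (h : G.IsOptimal I J x y) {r : ℕ} (hW : 0 < G.W (I r) (J r))
    (hv : ¬ G.IsVertex (x r) (y r) ∨ ¬ G.IsVertex (x (r + 1)) (y (r + 1))) :
    x r < x (r + 1) ∧ y r < y (r + 1) := by
  -- A step that begins on a vertical gridline off the vertices ends a crossing. The run behind it
  -- begins at an earlier step, which rises by induction, and the crossing condition passes this on.
  have aux : ∀ {G : Grid} {I J : ℕ → ℕ} {x y : ℕ → ℝ} {k : ℕ}, G.IsOptimal I J x y →
      G.ExitRight I J x k → ¬ G.IsVertex (x (k + 1)) (y (k + 1)) →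
      0 < G.W (I (k + 1)) (J (k + 1)) →
      (∀ r ≤ k, 0 < G.W (I r) (J r) → ¬ G.IsVertex (x (r + 1)) (y (r + 1)) →
        x r < x (r + 1) ∧ y r < y (r + 1)) →
      x (k + 1) < x (k + 2) ∧ y (k + 1) < y (k + 2) := by
    intro G I J x y k h hk hv hW ih
    obtain ⟨r, hr⟩ := h.exists_isRun hk hv
    exact ⟨h.fst_succ_lt hk hv, (hr.crossing h hW
      (ih r hr.le hr.pos (hr.not_isVertex r le_rfl hr.le)).2).1⟩
  -- A step from a vertex to a non-vertex on a vertical gridline ends off the horizontal gridlines,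
  -- so its height changes.
  have aux2 : ∀ {G : Grid} {I J : ℕ → ℕ} {x y : ℕ → ℝ} {k : ℕ}, G.IsOptimal I J x y →
      G.ExitRight I J x k → ¬ G.IsVertex (x (k + 1)) (y (k + 1)) →
      G.IsVertex (x k) (y k) → x k < x (k + 1) ∧ y k < y (k + 1) := by
    intro G I J x y k h hk hv hv'
    exact ⟨h.fst_lt hk hv, (h.mono k).2.lt_of_ne fun e =>
      hk.not_isNode h.toIsChainFrom hv (e ▸ hv'.2)⟩
  induction r using Nat.strong_induction_on with
  | _ r ih =>
    by_cases hr : G.IsVertex (x r) (y r)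
    · have hv' : ¬ G.IsVertex (x (r + 1)) (y (r + 1)) := by tauto
      rcases IsChain.exit_of_not_isVertex h.toIsChainFrom hv' with hk | hk
      · exact aux2 h hk hv' hr
      · exact (aux2 h.swap hk (mt isVertex_swap.1 hv') (isVertex_swap.2 hr)).symm
    · rcases r with _ | k
      · exact absurd (IsChain.isVertex_zero h.toIsChainFrom) hr
      rcases IsChain.exit_of_not_isVertex h.toIsChainFrom hr with hk | hk
      · exact aux h hk hr hW fun r' h1 h2 h3 => ih r' (by omega) h2 (Or.inr h3)
      · exact (aux h.swap hk (mt isVertex_swap.1 hr) hW fun r' h1 h2 h3 =>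
          (ih r' (by omega) h2 (Or.inr (mt isVertex_swap.2 h3))).symm).symm

end Grid

/-! ### Square root velocity functions of piecewise linear curves -/

section Curves

variable {N : ℕ} (f f₁ f₂ : PLCurve N)

theorem PLCurve.srvf_eq {i : ℕ} (hi : 1 ≤ i) (hi' : i ≤ f.num) {x : ℝ}
    (hx : x ∈ Ioo (f.node (i - 1)) (f.node i)) : srvf f.toFun x = f.pieceValue i := by
  obtain ⟨p, v, h⟩ := f.linear (i - 1) (by omega)
  rw [Nat.sub_add_cancel hi] at h
  have key : ∀ z ∈ Ioo (f.node (i - 1)) (f.node i), deriv f.toFun z = v := by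
    intro z hz
    have h1 : f.toFun =ᶠ[nhds z] fun w => p + w • v := by
      filter_upwards [Ioo_mem_nhds hz.1 hz.2] with w hw using h w ⟨hw.1.le, hw.2.le⟩
    rw [h1.deriv_eq]
    have : HasDerivAt (fun w : ℝ => p + w • v) ((1 : ℝ) • v) z :=
      ((hasDerivAt_id z).smul_const v).const_add p
    simpa using this.deriv
  have hlt : f.node (i - 1) < f.node i := hx.1.trans hx.2
  rw [PLCurve.pieceValue, srvf, srvf, key x hx, key _ ⟨by linarith, by linarith⟩]

theorem PLCurve.measurable_srvf : Measurable (srvf f.toFun) := by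
  have h : Measurable (deriv f.toFun) := measurable_deriv _
  unfold srvf rootNormalize
  exact (h.norm.sqrt.inv).smul h

/-- The values at the nodes are not controlled by the pieces: there may be kinks, and at `0` and `1`
the derivative may depend on values outside `[0,1]`. Their finitely many norms are therefore added
to the bound. -/
theorem PLCurve.exists_bound : ∃ C, 0 ≤ C ∧ ∀ x ∈ Icc (0 : ℝ) 1, ‖srvf f.toFun x‖ ≤ C := by
  refine ⟨∑ i ∈ Finset.range (f.num + 1), (‖f.pieceValue i‖ + ‖srvf f.toFun (f.node i)‖),
    by positivity, fun x hx => ?_⟩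
  have key : ∀ i ≤ f.num, ‖f.pieceValue i‖ + ‖srvf f.toFun (f.node i)‖ ≤
      ∑ i ∈ Finset.range (f.num + 1), (‖f.pieceValue i‖ + ‖srvf f.toFun (f.node i)‖) := fun i hi =>
    Finset.single_le_sum (f := fun i => ‖f.pieceValue i‖ + ‖srvf f.toFun (f.node i)‖)
      (fun _ _ => by positivity) (Finset.mem_range.2 (by omega))
  obtain ⟨i, h1, h2, h3, h4⟩ := f.isPartition.exists_piece hx.1 hx.2
  rcases h3.eq_or_lt with rfl | h3
  · exact (le_add_of_nonneg_left (norm_nonneg _)).trans (key _ (by omega))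
  rcases h4.eq_or_lt with rfl | h4
  · exact (le_add_of_nonneg_left (norm_nonneg _)).trans (key _ h2)
  rw [f.srvf_eq h1 h2 ⟨h3, h4⟩]
  exact (le_add_of_nonneg_right (norm_nonneg _)).trans (key _ h2)

/-- The weighted grid of a pair of piecewise linear curves. -/
noncomputable def curveGrid : Grid :=
  ⟨f₁.num, f₂.num, f₁.node, f₂.node, weight f₁ f₂, f₁.isPartition, f₂.isPartition⟩

end Curves

/-! ### Weak reparametrizations -/

theorem integral_congr_of_ae_Ioo {F : Type*} [NormedAddCommGroup F] [NormedSpace ℝ F]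
    {f g : ℝ → F} {c d : ℝ} (hc : 0 ≤ c) (hcd : c ≤ d) (hd : d ≤ 1)
    (h : ∀ᵐ z ∂volI, z ∈ Ioo c d → f z = g z) : ∫ z in c..d, f z = ∫ z in c..d, g z := by
  rw [intervalIntegral.integral_of_le hcd, intervalIntegral.integral_of_le hcd,
    integral_Ioc_eq_integral_Ioo, integral_Ioc_eq_integral_Ioo]
  refine setIntegral_congr_ae measurableSet_Ioo ?_
  rw [ae_restrict_iff' measurableSet_Icc] at h
  filter_upwards [h] with z hz hz'
  exact hz ⟨hc.trans hz'.1.le, hz'.2.le.trans hd⟩ hz'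

theorem integral_volI {F : Type*} [NormedAddCommGroup F] [NormedSpace ℝ F] (f : ℝ → F) :
    ∫ z, f z ∂volI = ∫ z in (0 : ℝ)..1, f z := by
  rw [intervalIntegral.integral_of_le zero_le_one, integral_Icc_eq_integral_Ioc]

theorem intervalIntegrable_of_volI {F : Type*} [NormedAddCommGroup F] {f : ℝ → F}
    (hf : Integrable f volI) {c d : ℝ} (hc : 0 ≤ c) (hcd : c ≤ d) (hd : d ≤ 1) :
    IntervalIntegrable f volume c d := by
  rw [intervalIntegrable_iff_integrableOn_Icc_of_le hcd]
  exact IntegrableOn.mono_set (t := Icc 0 1) hf (Icc_subset_Icc hc hd)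

/-- Where `g` is not differentiable, `deriv` is `0` by default; elsewhere it agrees with the
derivative from the left. -/
theorem deriv_eq_zero_of_const_left {g : ℝ → ℝ} {c z : ℝ} (hcz : c < z)
    (h : ∀ w ∈ Icc c z, g w = g z) : deriv g z = 0 := by
  by_cases hd : DifferentiableAt ℝ g z
  · have h1 := hd.hasDerivAt.hasDerivWithinAt (s := Icc c z)
    have h2 : HasDerivWithinAt g 0 (Icc c z) z :=
      (hasDerivWithinAt_const z (Icc c z) (g z)).congr h rfl
    exact (uniqueDiffOn_Icc hcz z ⟨hcz.le, le_rfl⟩).eq_deriv _ h1 h2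
  · exact deriv_zero_of_not_differentiableAt hd

theorem deriv_eq_zero_of_const_right {g : ℝ → ℝ} {d z : ℝ} (hzd : z < d)
    (h : ∀ w ∈ Icc z d, g w = g z) : deriv g z = 0 := by
  by_cases hd : DifferentiableAt ℝ g z
  · have h1 := hd.hasDerivAt.hasDerivWithinAt (s := Icc z d)
    have h2 : HasDerivWithinAt g 0 (Icc z d) z :=
      (hasDerivWithinAt_const z (Icc z d) (g z)).congr h rfl
    exact (uniqueDiffOn_Icc hzd z ⟨le_rfl, hzd.le⟩).eq_deriv _ h1 h2
  · exact deriv_zero_of_not_differentiableAt hd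

theorem IsReparam.isWeakReparam {γ : ℝ → ℝ} (h : IsReparam γ) : IsWeakReparam γ :=
  ⟨h.1, h.2.1, h.2.2.1, h.2.2.2.1, h.2.2.2.2.mono fun _ hx => hx.le⟩

namespace IsWeakReparam

variable {γ : ℝ → ℝ} (h : IsWeakReparam γ)
include h

theorem continuousOn : ContinuousOn γ (Icc 0 1) := by
  simpa using h.2.1.continuousOn

theorem absCont {c d : ℝ} (hc : 0 ≤ c) (hcd : c ≤ d) (hd : d ≤ 1) :
    AbsolutelyContinuousOnInterval γ c d :=
  h.2.1.mono (by rw [uIcc_of_le hcd, uIcc_of_le zero_le_one]; exact Icc_subset_Icc hc hd)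

theorem integral_deriv {c d : ℝ} (hc : 0 ≤ c) (hcd : c ≤ d) (hd : d ≤ 1) :
    ∫ z in c..d, deriv γ z = γ d - γ c :=
  (h.absCont hc hcd hd).integral_deriv_eq_sub

theorem integrable_deriv : Integrable (deriv γ) volI := by
  have := h.2.1.intervalIntegrable_deriv
  rwa [intervalIntegrable_iff_integrableOn_Icc_of_le zero_le_one] at this

theorem monotoneOn : MonotoneOn γ (Icc 0 1) := by
  intro c hc d hd hcd
  rw [← sub_nonneg, ← h.integral_deriv hc.1 hcd hd.2]
  refine intervalIntegral.integral_nonneg_of_ae_restrict hcd ?_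
  exact ae_restrict_of_ae_restrict_of_subset (Icc_subset_Icc hc.1 hd.2) h.2.2.2.2

theorem aemeasurable : AEMeasurable γ volI := h.continuousOn.aemeasurable measurableSet_Icc

end IsWeakReparam

/-! ### The action on square root velocity functions and the overlap. -/

section Act

variable {N : ℕ} {f f₁ f₂ : PLCurve N} {γ γ₁ γ₂ : ℝ → ℝ}

/-- This holds at every `z`, even where `γ z` is a node and `srvf` is uncontrolled: monotonicity
then makes `γ` constant on `[c, z]` or on `[z, d]`, its derivative vanishes, and both sides are
zero. -/
theorem act_eq_of_piece (h : IsWeakReparam γ) {i : ℕ} (hi : 1 ≤ i) (hi' : i ≤ f.num) {c d : ℝ}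
    (hc : 0 ≤ c) (hd : d ≤ 1) (h1 : f.node (i - 1) ≤ γ c) (h2 : γ d ≤ f.node i) {z : ℝ}
    (hz : z ∈ Ioo c d) :
    act (srvf f.toFun) γ z = √(deriv γ z) • f.pieceValue i := by
  have hz0 : z ∈ Icc (0 : ℝ) 1 := ⟨hc.trans hz.1.le, hz.2.le.trans hd⟩
  have hc0 : c ∈ Icc (0 : ℝ) 1 := ⟨hc, hz.1.le.trans hz0.2⟩
  have hd0 : d ∈ Icc (0 : ℝ) 1 := ⟨hz0.1.trans hz.2.le, hd⟩
  unfold act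
  have hl := h1.trans (h.monotoneOn hc0 hz0 hz.1.le)
  have hr := (h.monotoneOn hz0 hd0 hz.2.le).trans h2
  rcases hl.eq_or_lt with e | hl
  · rw [deriv_eq_zero_of_const_left hz.1 fun w hw => ?_]
    · simp
    · have hw0 : w ∈ Icc (0 : ℝ) 1 := ⟨hc.trans hw.1, hw.2.trans hz0.2⟩
      exact le_antisymm (h.monotoneOn hw0 hz0 hw.2) (e ▸ h1.trans (h.monotoneOn hc0 hw0 hw.1))
  rcases hr.eq_or_lt with e | hr
  · rw [deriv_eq_zero_of_const_right hz.2 fun w hw => ?_]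
    · simp
    · have hw0 : w ∈ Icc (0 : ℝ) 1 := ⟨hz0.1.trans hw.1, hw.2.trans hd⟩
      exact le_antisymm (e ▸ (h.monotoneOn hw0 hd0 hw.2).trans h2) (h.monotoneOn hz0 hw0 hw.1)
  rw [f.srvf_eq hi hi' ⟨hl, hr⟩]

theorem aestronglyMeasurable_act (f : PLCurve N) (h : IsWeakReparam γ) :
    AEStronglyMeasurable (act (srvf f.toFun) γ) volI := by
  unfold act
  exact ((measurable_deriv γ).sqrt.aemeasurable.smul
    (f.measurable_srvf.comp_aemeasurable h.aemeasurable)).aestronglyMeasurable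

theorem norm_act_sq_le {C : ℝ} (hC : ∀ x ∈ Icc (0 : ℝ) 1, ‖srvf f.toFun x‖ ≤ C)
    (h : IsWeakReparam γ) {z : ℝ} (hz : z ∈ Icc (0 : ℝ) 1) (hd : 0 ≤ deriv γ z) :
    ‖act (srvf f.toFun) γ z‖ ^ 2 ≤ C ^ 2 * deriv γ z := by
  have h1 := hC (γ z) (h.1 hz)
  rw [act, norm_smul, mul_pow, Real.norm_eq_abs, sq_abs, Real.sq_sqrt hd, mul_comm]
  gcongr

theorem memLp_act (f : PLCurve N) (h : IsWeakReparam γ) :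
    MemLp (act (srvf f.toFun) γ) 2 volI := by
  rw [memLp_two_iff_integrable_sq_norm (aestronglyMeasurable_act f h)]
  obtain ⟨C, -, hC⟩ := f.exists_bound
  refine Integrable.mono' (h.integrable_deriv.const_mul (C ^ 2))
    ((aestronglyMeasurable_act f h).norm.pow 2) ?_
  filter_upwards [h.2.2.2.2, ae_restrict_mem measurableSet_Icc] with z hz hz'
  rw [Real.norm_of_nonneg (by positivity)]
  exact norm_act_sq_le hC h hz' hz

/-- Even a weak reparametrization preserves the norm. Since `srvf` is constant on each piece, the
substitution rule is only needed in the form `∫ γ' = γ d - γ c`. -/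
theorem integral_norm_act_sq (f : PLCurve N) (h : IsWeakReparam γ) :
    ∫ z in (0 : ℝ)..1, ‖act (srvf f.toFun) γ z‖ ^ 2 = ∫ x in (0 : ℝ)..1, ‖srvf f.toFun x‖ ^ 2 := by
  have hint := (memLp_act f h).integrable_norm_pow (by norm_num)
  have hint' : Integrable (fun x => ‖srvf f.toFun x‖ ^ 2) volI := by
    obtain ⟨C, -, hC⟩ := f.exists_bound
    refine Integrable.mono' (integrable_const (C ^ 2))
      (f.measurable_srvf.norm.pow_const 2).aestronglyMeasurable ?_
    filter_upwards [ae_restrict_mem measurableSet_Icc] with z hz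
    rw [Real.norm_of_nonneg (by positivity)]
    exact pow_le_pow_left₀ (norm_nonneg _) (hC z hz) 2
  have key := f.isPartition.interval_induction h.continuousOn h.1
    (R := fun c d => ∫ z in c..d, ‖act (srvf f.toFun) γ z‖ ^ 2 =
      ∫ x in γ c..γ d, ‖srvf f.toFun x‖ ^ 2) ?_ ?_ le_rfl zero_le_one le_rfl
  · rwa [h.2.2.1, h.2.2.2.1] at key
  · intro c e d hc hce hed hd h1 h2
    have mc : c ∈ Icc (0 : ℝ) 1 := ⟨hc, hce.trans (hed.trans hd)⟩
    have me : e ∈ Icc (0 : ℝ) 1 := ⟨hc.trans hce, hed.trans hd⟩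
    have md : d ∈ Icc (0 : ℝ) 1 := ⟨hc.trans (hce.trans hed), hd⟩
    rw [← intervalIntegral.integral_add_adjacent_intervals
      (intervalIntegrable_of_volI hint hc hce me.2) (intervalIntegrable_of_volI hint me.1 hed hd),
      h1, h2, intervalIntegral.integral_add_adjacent_intervals
      (intervalIntegrable_of_volI hint' (h.1 mc).1 (h.monotoneOn mc me hce) (h.1 me).2)
      (intervalIntegrable_of_volI hint' (h.1 me).1 (h.monotoneOn me md hed) (h.1 md).2)]
  · intro i hi hi' c d hc hcd hd h1 h2
    have mc : c ∈ Icc (0 : ℝ) 1 := ⟨hc, hcd.trans hd⟩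
    have md : d ∈ Icc (0 : ℝ) 1 := ⟨hc.trans hcd, hd⟩
    have e1 : ∫ z in c..d, ‖act (srvf f.toFun) γ z‖ ^ 2 =
        ∫ z in c..d, deriv γ z * ‖f.pieceValue i‖ ^ 2 := by
      refine integral_congr_of_ae_Ioo hc hcd hd ?_
      filter_upwards [h.2.2.2.2] with z hz hz'
      rw [act_eq_of_piece h hi hi' hc hd h1 h2 hz', norm_smul, mul_pow, Real.norm_eq_abs, sq_abs,
        Real.sq_sqrt hz]
    have e2 : ∫ x in γ c..γ d, ‖srvf f.toFun x‖ ^ 2 =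
        ∫ x in γ c..γ d, ‖f.pieceValue i‖ ^ 2 := by
      refine integral_congr_of_ae_Ioo (h.1 mc).1 (h.monotoneOn mc md hcd) (h.1 md).2
        (Filter.Eventually.of_forall fun z hz => ?_)
      rw [f.srvf_eq hi hi' ⟨h1.trans_lt hz.1, hz.2.trans_le h2⟩]
    rw [e1, e2, intervalIntegral.integral_mul_const, h.integral_deriv hc hcd hd]
    simp

/-- The integrand of the inner product of `q₁ * γ₁` and `q₂ * γ₂`. -/
noncomputable def overlap (f₁ f₂ : PLCurve N) (γ₁ γ₂ : ℝ → ℝ) (z : ℝ) : ℝ :=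
  inner ℝ (act (srvf f₁.toFun) γ₁ z) (act (srvf f₂.toFun) γ₂ z)

theorem integrable_overlap (f₁ f₂ : PLCurve N) (h₁ : IsWeakReparam γ₁) (h₂ : IsWeakReparam γ₂) :
    Integrable (overlap f₁ f₂ γ₁ γ₂) volI := by
  have := L2.integrable_inner (𝕜 := ℝ) ((memLp_act f₁ h₁).toLp _) ((memLp_act f₂ h₂).toLp _)
  refine this.congr ?_
  filter_upwards [(memLp_act f₁ h₁).coeFn_toLp, (memLp_act f₂ h₂).coeFn_toLp] with z hz1 hz2
  rw [hz1, hz2, overlap]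

theorem overlap_eq_of_block (h₁ : IsWeakReparam γ₁) (h₂ : IsWeakReparam γ₂) {i j : ℕ}
    (hb : (curveGrid f₁ f₂).IsBl i j) {c d : ℝ} (hc : 0 ≤ c) (hd : d ≤ 1)
    (hmc : (curveGrid f₁ f₂).Mem i j (γ₁ c, γ₂ c)) (hmd : (curveGrid f₁ f₂).Mem i j (γ₁ d, γ₂ d))
    {z : ℝ} (hz : z ∈ Ioo c d) :
    overlap f₁ f₂ γ₁ γ₂ z = weight f₁ f₂ i j * (√(deriv γ₁ z) * √(deriv γ₂ z)) := by
  rw [overlap, act_eq_of_piece h₁ hb.1 hb.2.1 hc hd hmc.1.1 hmd.1.2 hz,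
    act_eq_of_piece h₂ hb.2.2.1 hb.2.2.2 hc hd hmc.2.1 hmd.2.2 hz, inner_smul_left,
    inner_smul_right, weight]
  simp only [conj_trivial]
  ring

theorem memLp_sqrt_deriv (h : IsWeakReparam γ) : MemLp (fun z => √(deriv γ z)) 2 volI := by
  rw [memLp_two_iff_integrable_sq (measurable_deriv γ).sqrt.aestronglyMeasurable]
  refine h.integrable_deriv.congr ?_
  filter_upwards [h.2.2.2.2] with z hz
  rw [Real.sq_sqrt hz]

theorem integral_sqrt_mul_sqrt_le (h₁ : IsWeakReparam γ₁) (h₂ : IsWeakReparam γ₂) {c d : ℝ}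
    (hc : 0 ≤ c) (hcd : c ≤ d) (hd : d ≤ 1) :
    ∫ z in c..d, √(deriv γ₁ z) * √(deriv γ₂ z) ≤ √((γ₁ d - γ₁ c) * (γ₂ d - γ₂ c)) := by
  have hsub : Ioc c d ⊆ Icc 0 1 := Ioc_subset_Icc_self.trans (Icc_subset_Icc hc hd)
  have key : ∀ {γ : ℝ → ℝ}, IsWeakReparam γ →
      ∫ z in Ioc c d, √(deriv γ z) ^ (2 : ℝ) = γ d - γ c := by
    intro γ h
    rw [← h.integral_deriv hc hcd hd, intervalIntegral.integral_of_le hcd]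
    refine integral_congr_ae (ae_restrict_of_ae_restrict_of_subset hsub ?_)
    filter_upwards [h.2.2.2.2] with z hz
    simp [Real.sq_sqrt hz]
  have hmem : ∀ {γ : ℝ → ℝ}, IsWeakReparam γ →
      MemLp (fun z => √(deriv γ z)) (ENNReal.ofReal 2) (volume.restrict (Ioc c d)) := by
    intro γ h
    rw [show ENNReal.ofReal 2 = 2 by norm_num]
    exact (memLp_sqrt_deriv h).mono_measure (Measure.restrict_mono hsub le_rfl)
  have := integral_mul_le_Lp_mul_Lq_of_nonneg (μ := volume.restrict (Ioc c d))
    (p := 2) (q := 2) (by constructor <;> norm_num)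
    (Filter.Eventually.of_forall fun z => Real.sqrt_nonneg (deriv γ₁ z))
    (Filter.Eventually.of_forall fun z => Real.sqrt_nonneg (deriv γ₂ z)) (hmem h₁) (hmem h₂)
  rw [key h₁, key h₂, ← Real.sqrt_eq_rpow, ← Real.sqrt_eq_rpow, ← Real.sqrt_mul] at this
  · rwa [intervalIntegral.integral_of_le hcd]
  · exact sub_nonneg.2 (h₁.monotoneOn ⟨hc, hcd.trans hd⟩ ⟨hc.trans hcd, hd⟩ hcd)

/-- Cauchy–Schwarz for `√γ₁'` and `√γ₂'`. A negative weight may be replaced by zero because the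
integral of the product of the roots is non-negative. -/
theorem integral_overlap_le_gain (h₁ : IsWeakReparam γ₁) (h₂ : IsWeakReparam γ₂) {i j : ℕ}
    (hb : (curveGrid f₁ f₂).IsBl i j) {c d : ℝ} (hc : 0 ≤ c) (hcd : c ≤ d) (hd : d ≤ 1)
    (hmc : (curveGrid f₁ f₂).Mem i j (γ₁ c, γ₂ c))
    (hmd : (curveGrid f₁ f₂).Mem i j (γ₁ d, γ₂ d)) :
    ∫ z in c..d, overlap f₁ f₂ γ₁ γ₂ z ≤
      (curveGrid f₁ f₂).gain i j (γ₁ c, γ₂ c) (γ₁ d, γ₂ d) := by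
  rw [integral_congr_of_ae_Ioo hc hcd hd (Filter.Eventually.of_forall fun z hz =>
    overlap_eq_of_block h₁ h₂ hb hc hd hmc hmd hz), intervalIntegral.integral_const_mul]
  have h0 : 0 ≤ ∫ z in c..d, √(deriv γ₁ z) * √(deriv γ₂ z) :=
    intervalIntegral.integral_nonneg hcd fun z _ => by positivity
  calc _ ≤ max (weight f₁ f₂ i j) 0 * ∫ z in c..d, √(deriv γ₁ z) * √(deriv γ₂ z) :=
        mul_le_mul_of_nonneg_right (le_max_left _ _) h0
    _ ≤ _ := mul_le_mul_of_nonneg_left (integral_sqrt_mul_sqrt_le h₁ h₂ hc hcd hd)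
        (le_max_right _ _)

theorem integral_overlap_add (h₁ : IsWeakReparam γ₁) (h₂ : IsWeakReparam γ₂) {c e d : ℝ}
    (hc : 0 ≤ c) (hce : c ≤ e) (hed : e ≤ d) (hd : d ≤ 1) :
    ∫ z in c..d, overlap f₁ f₂ γ₁ γ₂ z =
      (∫ z in c..e, overlap f₁ f₂ γ₁ γ₂ z) + ∫ z in e..d, overlap f₁ f₂ γ₁ γ₂ z :=
  (intervalIntegral.integral_add_adjacent_intervals
    (intervalIntegrable_of_volI (integrable_overlap f₁ f₂ h₁ h₂) hc hce (hed.trans hd))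
    (intervalIntegrable_of_volI (integrable_overlap f₁ f₂ h₁ h₂) (hc.trans hce) hed hd)).symm

/-- The overlap along any pair of weak reparametrizations is at most that of a chain. -/
theorem exists_reach_of_overlap (h₁ : IsWeakReparam γ₁) (h₂ : IsWeakReparam γ₂) {c d : ℝ}
    (hc : 0 ≤ c) (hcd : c ≤ d) (hd : d ≤ 1) :
    ∃ v, (curveGrid f₁ f₂).Reach (γ₁ c, γ₂ c) (γ₁ d, γ₂ d) v ∧
      ∫ z in c..d, overlap f₁ f₂ γ₁ γ₂ z ≤ v := by
  have trans : ∀ {c e d : ℝ}, 0 ≤ c → c ≤ e → e ≤ d → d ≤ 1 →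
      (∃ v, (curveGrid f₁ f₂).Reach (γ₁ c, γ₂ c) (γ₁ e, γ₂ e) v ∧
        ∫ z in c..e, overlap f₁ f₂ γ₁ γ₂ z ≤ v) →
      (∃ v, (curveGrid f₁ f₂).Reach (γ₁ e, γ₂ e) (γ₁ d, γ₂ d) v ∧
        ∫ z in e..d, overlap f₁ f₂ γ₁ γ₂ z ≤ v) →
      ∃ v, (curveGrid f₁ f₂).Reach (γ₁ c, γ₂ c) (γ₁ d, γ₂ d) v ∧
        ∫ z in c..d, overlap f₁ f₂ γ₁ γ₂ z ≤ v := by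
    rintro c e d hc hce hed hd ⟨v, hv, hv'⟩ ⟨w, hw, hw'⟩
    refine ⟨v + w, hv.trans hw, ?_⟩
    rw [integral_overlap_add h₁ h₂ hc hce hed hd]
    exact add_le_add hv' hw'
  refine f₁.isPartition.interval_induction h₁.continuousOn h₁.1
    (R := fun c d => ∃ v, (curveGrid f₁ f₂).Reach (γ₁ c, γ₂ c) (γ₁ d, γ₂ d) v ∧
        ∫ z in c..d, overlap f₁ f₂ γ₁ γ₂ z ≤ v) (fun c e d => trans) ?_ hc hcd hd
  intro i hi hi' c d hc hcd hd hi1 hi2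
  refine f₂.isPartition.interval_induction h₂.continuousOn h₂.1
    (R := fun c d => f₁.node (i - 1) ≤ γ₁ c → γ₁ d ≤ f₁.node i →
      ∃ v, (curveGrid f₁ f₂).Reach (γ₁ c, γ₂ c) (γ₁ d, γ₂ d) v ∧
        ∫ z in c..d, overlap f₁ f₂ γ₁ γ₂ z ≤ v) ?_ ?_ hc hcd hd hi1 hi2
  · intro c e d hc hce hed hd ihc ihd hi1 hi2
    have mc : c ∈ Icc (0 : ℝ) 1 := ⟨hc, hce.trans (hed.trans hd)⟩
    have me : e ∈ Icc (0 : ℝ) 1 := ⟨hc.trans hce, hed.trans hd⟩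
    have md : d ∈ Icc (0 : ℝ) 1 := ⟨hc.trans (hce.trans hed), hd⟩
    exact trans hc hce hed hd (ihc hi1 ((h₁.monotoneOn me md hed).trans hi2))
      (ihd (hi1.trans (h₁.monotoneOn mc me hce)) hi2)
  · intro j hj hj' c d hc hcd hd hj1 hj2 hi1 hi2
    have mc : c ∈ Icc (0 : ℝ) 1 := ⟨hc, hcd.trans hd⟩
    have md : d ∈ Icc (0 : ℝ) 1 := ⟨hc.trans hcd, hd⟩
    have e1 := h₁.monotoneOn mc md hcd
    have e2 := h₂.monotoneOn mc md hcd
    have hb : (curveGrid f₁ f₂).IsBl i j := ⟨hi, hi', hj, hj'⟩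
    have hmc : (curveGrid f₁ f₂).Mem i j (γ₁ c, γ₂ c) :=
      ⟨⟨hi1, e1.trans hi2⟩, ⟨hj1, e2.trans hj2⟩⟩
    have hmd : (curveGrid f₁ f₂).Mem i j (γ₁ d, γ₂ d) :=
      ⟨⟨hi1.trans e1, hi2⟩, ⟨hj1.trans e2, hj2⟩⟩
    exact ⟨_, Grid.Reach.single hb hmc hmd ⟨e1, e2⟩,
      integral_overlap_le_gain h₁ h₂ hb hc hcd hd hmc hmd⟩

end Act

/-! ### Approximation of weak reparametrizations by elements of `Γ`. -/

open Filter Topology in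
-- For each node there is at most one first time at which `γ` takes it as value. At every other such
-- time `γ` has been constant for a while. Only finitely many times are excluded.
theorem IsWeakReparam.ae_deriv_eq_zero_of_isNode {γ : ℝ → ℝ} (h : IsWeakReparam γ) {k : ℕ}
    (s : ℕ → ℝ) : ∀ᵐ z ∂volI, IsNode s k (γ z) → deriv γ z = 0 := by
  let A : Set ℝ := {z ∈ Icc (0 : ℝ) 1 | IsNode s k (γ z) ∧ ∀ c ∈ Icc (0 : ℝ) 1, c < z → γ c ≠ γ z}
  have hA : A.Finite := by
    refine Finite.of_finite_image (f := γ) (((finite_Iic k).image s).subset ?_) ?_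
    · rintro _ ⟨z, ⟨-, ⟨i, hi, e⟩, -⟩, rfl⟩
      exact ⟨i, hi, e⟩
    · rintro z ⟨hz, -, h1⟩ w ⟨hw, -, h2⟩ e
      rcases lt_trichotomy z w with h3 | h3 | h3
      · exact absurd e (h2 z hz h3)
      · exact h3
      · exact absurd e.symm (h1 w hw h3)
  have hnull : ∀ᵐ z ∂volI, z ∉ A := by
    refine ae_restrict_of_ae ?_
    rw [ae_iff]
    simpa using hA.measure_zero volume
  filter_upwards [hnull, ae_restrict_mem measurableSet_Icc] with z hz hz' hn
  have : ∃ c ∈ Icc (0 : ℝ) 1, c < z ∧ γ c = γ z := by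
    by_contra! hc
    exact hz ⟨hz', hn, fun c h1 h2 => hc c h1 h2⟩
  obtain ⟨c, hc, hcz, e⟩ := this
  refine deriv_eq_zero_of_const_left hcz fun w hw => ?_
  have hw0 : w ∈ Icc (0 : ℝ) 1 := ⟨hc.1.trans hw.1, hw.2.trans hz'.2⟩
  exact le_antisymm (h.monotoneOn hw0 hz' hw.2) (e ▸ h.monotoneOn hc hw0 hw.1)

theorem IsWeakReparam.ae_differentiableAt {γ : ℝ → ℝ} (h : IsWeakReparam γ) :
    ∀ᵐ z ∂volI, DifferentiableAt ℝ γ z := by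
  rw [ae_restrict_iff' measurableSet_Icc]
  filter_upwards [h.2.1.ae_differentiableAt] with z hz hz'
  exact hz (by rwa [uIcc_of_le zero_le_one])

/-- The convex combination of `γ` and the identity. -/
def blend (γ : ℝ → ℝ) (ε : ℝ) (z : ℝ) : ℝ := (1 - ε) * γ z + ε * z

section Blend

variable {γ : ℝ → ℝ} {ε : ℝ}

theorem deriv_blend {z : ℝ} (h : DifferentiableAt ℝ γ z) :
    deriv (blend γ ε) z = (1 - ε) * deriv γ z + ε := by
  have : HasDerivAt (blend γ ε) ((1 - ε) * deriv γ z + ε * 1) z :=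
    (h.hasDerivAt.const_mul (1 - ε)).add ((hasDerivAt_id z).const_mul ε)
  simpa using this.deriv

theorem IsWeakReparam.isReparam_blend (h : IsWeakReparam γ) (h0 : 0 < ε) (h1 : ε < 1) :
    IsReparam (blend γ ε) := by
  refine ⟨fun z hz => ?_, ?_, ?_, ?_, ?_⟩
  · have h2 := h.1 hz
    unfold blend
    constructor
    · nlinarith [h2.1, hz.1]
    · nlinarith [h2.2, hz.2]
  · have hid : AbsolutelyContinuousOnInterval (fun z : ℝ => z) 0 1 :=
      LipschitzWith.id.lipschitzOnWith.absolutelyContinuousOnInterval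
    exact (h.2.1.const_mul (1 - ε)).add (hid.const_mul ε)
  · simp [blend, h.2.2.1]
  · simp [blend, h.2.2.2.1]
  · filter_upwards [h.2.2.2.2, h.ae_differentiableAt] with z hz hd
    rw [deriv_blend hd]
    nlinarith

end Blend

/-! ### Closed orbits and the reduction of the distance to the largest overlap. -/

section Orbits

variable {N : ℕ} {γ γ₁ γ₂ : ℝ → ℝ}

open Filter Topology in
-- Away from the nodes `srvf` is locally constant and only the derivatives have to converge. At
-- times when `γ` is at a node, its derivative vanishes almost everywhere, and boundedness of `srvf`
-- suffices.
theorem tendsto_act_blend (f : PLCurve N) (h : IsWeakReparam γ) {ε : ℕ → ℝ}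
    (hε : ∀ n, 0 < ε n ∧ ε n < 1) (hlim : Tendsto ε atTop (𝓝 0)) :
    ∀ᵐ z ∂volI, Tendsto (fun n => act (srvf f.toFun) (blend γ (ε n)) z) atTop
      (𝓝 (act (srvf f.toFun) γ z)) := by
  obtain ⟨C, hC0, hC⟩ := f.exists_bound
  filter_upwards [h.ae_deriv_eq_zero_of_isNode (k := f.num) f.node, h.ae_differentiableAt,
    ae_restrict_mem measurableSet_Icc] with z hn hd hz
  have hder : Tendsto (fun n => √(deriv (blend γ (ε n)) z)) atTop (𝓝 √(deriv γ z)) := by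
    have e : (fun n => √(deriv (blend γ (ε n)) z)) =
        fun n => √((1 - ε n) * deriv γ z + ε n) := by
      ext n; rw [deriv_blend hd]
    rw [e]
    have : Tendsto (fun n => (1 - ε n) * deriv γ z + ε n) atTop
        (𝓝 ((1 - 0) * deriv γ z + 0)) :=
      ((tendsto_const_nhds.sub hlim).mul_const _).add hlim
    simpa [Function.comp_def] using (Real.continuous_sqrt.tendsto _).comp this
  by_cases hnode : IsNode f.node f.num (γ z)
  · have h0 := hn hnode
    rw [h0, Real.sqrt_zero] at hder
    rw [act, h0, Real.sqrt_zero, zero_smul]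
    refine squeeze_zero_norm (a := fun n => √(deriv (blend γ (ε n)) z) * C) (fun n => ?_)
      (by simpa using hder.mul_const C)
    rw [act, norm_smul, Real.norm_of_nonneg (Real.sqrt_nonneg _)]
    exact mul_le_mul_of_nonneg_left (hC _ ((h.isReparam_blend (hε n).1 (hε n).2).1 hz))
      (Real.sqrt_nonneg _)
  · obtain ⟨i, h1, h2, h3, h4⟩ := f.isPartition.exists_piece (h.1 hz).1 (h.1 hz).2
    have h3' : f.node (i - 1) < γ z := h3.lt_of_ne fun e => hnode ⟨_, by omega, e⟩
    have h4' : γ z < f.node i := h4.lt_of_ne fun e => hnode ⟨_, h2, e.symm⟩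
    have hb : Tendsto (fun n => blend γ (ε n) z) atTop (𝓝 (γ z)) := by
      have : Tendsto (fun n => (1 - ε n) * γ z + ε n * z) atTop
          (𝓝 ((1 - 0) * γ z + 0 * z)) :=
        ((tendsto_const_nhds.sub hlim).mul_const _).add (hlim.mul_const _)
      simpa [blend] using this
    have hev : ∀ᶠ n in atTop, srvf f.toFun (blend γ (ε n) z) = srvf f.toFun (γ z) := by
      filter_upwards [hb.eventually (Ioo_mem_nhds h3' h4')] with n hn
      rw [f.srvf_eq h1 h2 hn, f.srvf_eq h1 h2 ⟨h3', h4'⟩]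
    unfold act
    exact hder.smul (tendsto_const_nhds.congr' (hev.mono fun n hn => hn.symm))

theorem L2_norm_sq (w : L2 N) : ‖w‖ ^ 2 = ∫ z, ‖w z‖ ^ 2 ∂volI := by
  rw [← real_inner_self_eq_norm_sq, L2.inner_def]
  simp

open Filter Topology in
/-- The closure of an orbit contains the action of all weak reparametrizations. -/
theorem toLp_act_mem_closedOrbit (f : PLCurve N) (h : IsWeakReparam γ) :
    (memLp_act f h).toLp _ ∈ closedOrbit (srvf f.toFun) := by
  obtain ⟨C, hC0, hC⟩ := f.exists_bound
  let ε : ℕ → ℝ := fun n => 1 / ((n : ℝ) + 2)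
  have hε : ∀ n, 0 < ε n ∧ ε n < 1 := fun n => by
    have : (0 : ℝ) ≤ n := n.cast_nonneg
    refine ⟨by positivity, ?_⟩
    rw [div_lt_one (by positivity)]
    linarith
  have hlim : Tendsto ε atTop (𝓝 0) := by
    have := (tendsto_add_atTop_iff_nat 1).2 (tendsto_one_div_add_atTop_nhds_zero_nat (𝕜 := ℝ))
    refine this.congr fun n => ?_
    simp only [ε]
    push_cast
    ring
  have hr : ∀ n, IsReparam (blend γ (ε n)) := fun n => h.isReparam_blend (hε n).1 (hε n).2
  let w : ℕ → L2 N := fun n => (memLp_act f (hr n).isWeakReparam).toLp _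
  refine mem_closure_of_tendsto (f := w) (b := atTop) ?_
    (Eventually.of_forall fun n => ⟨_, hr n, (memLp_act f (hr n).isWeakReparam).coeFn_toLp⟩)
  rw [tendsto_iff_norm_sub_tendsto_zero]
  have hsq : Tendsto (fun n => ‖w n - (memLp_act f h).toLp _‖ ^ 2) atTop (𝓝 0) := by
    have e : ∀ n, ‖w n - (memLp_act f h).toLp _‖ ^ 2 =
        ∫ z, ‖act (srvf f.toFun) (blend γ (ε n)) z - act (srvf f.toFun) γ z‖ ^ 2 ∂volI := by
      intro n
      rw [L2_norm_sq]
      refine integral_congr_ae ?_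
      filter_upwards [Lp.coeFn_sub (w n) ((memLp_act f h).toLp _), (memLp_act f h).coeFn_toLp,
        (memLp_act f (hr n).isWeakReparam).coeFn_toLp] with z h1 h2 h3
      rw [h1, Pi.sub_apply, h2, h3]
    simp_rw [e]
    have h0 : (0 : ℝ) = ∫ z, (0 : ℝ) ∂volI := by simp
    rw [h0]
    -- The bound comes from `‖v - w‖² ≤ 2 ‖v‖² + 2 ‖w‖²`, and from the fact that the derivative of
    -- the blend is at most `deriv γ z + 1`.
    refine tendsto_integral_of_dominated_convergence
      (fun z => 2 * (C ^ 2 * (deriv γ z + 1)) + 2 * (C ^ 2 * deriv γ z)) (fun n => ?_) ?_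
      (fun n => ?_) ?_
    · exact ((aestronglyMeasurable_act f (hr n).isWeakReparam).sub
        (aestronglyMeasurable_act f h)).norm.pow 2
    · exact (((h.integrable_deriv.add (integrable_const 1)).const_mul _).const_mul _).add
        ((h.integrable_deriv.const_mul _).const_mul _)
    · filter_upwards [h.2.2.2.2, h.ae_differentiableAt, (hr n).2.2.2.2,
        ae_restrict_mem measurableSet_Icc] with z h1 h2 h3 hz
      rw [Real.norm_of_nonneg (by positivity)]
      have b1 := norm_act_sq_le hC (hr n).isWeakReparam hz h3.le
      have b2 := norm_act_sq_le hC h hz h1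
      have b3 : deriv (blend γ (ε n)) z ≤ deriv γ z + 1 := by
        rw [deriv_blend h2]
        nlinarith [hε n]
      have b4 : C ^ 2 * deriv (blend γ (ε n)) z ≤ C ^ 2 * (deriv γ z + 1) := by gcongr
      have b5 := norm_sub_le (act (srvf f.toFun) (blend γ (ε n)) z) (act (srvf f.toFun) γ z)
      have b6 := pow_le_pow_left₀ (norm_nonneg _) b5 2
      nlinarith [sq_nonneg (‖act (srvf f.toFun) (blend γ (ε n)) z‖ - ‖act (srvf f.toFun) γ z‖)]
    · filter_upwards [tendsto_act_blend f h hε hlim] with z hz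
      have := (hz.sub_const (act (srvf f.toFun) γ z)).norm.pow 2
      simpa using this
  have := (Real.continuous_sqrt.tendsto _).comp hsq
  simpa [Function.comp_def, Real.sqrt_sq (norm_nonneg _)] using this

theorem norm_sq_of_ae_eq_act {f : PLCurve N} (h : IsWeakReparam γ) {w : L2 N}
    (hw : w =ᵐ[volI] act (srvf f.toFun) γ) :
    ‖w‖ ^ 2 = ∫ x in (0 : ℝ)..1, ‖srvf f.toFun x‖ ^ 2 := by
  rw [L2_norm_sq, ← integral_norm_act_sq f h, ← integral_volI]
  exact integral_congr_ae (hw.mono fun z hz => by simp only [hz])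

theorem norm_sq_of_mem_closedOrbit {f : PLCurve N} {w : L2 N}
    (hw : w ∈ closedOrbit (srvf f.toFun)) :
    ‖w‖ ^ 2 = ∫ x in (0 : ℝ)..1, ‖srvf f.toFun x‖ ^ 2 := by
  have hcl : IsClosed {w : L2 N | ‖w‖ ^ 2 = ∫ x in (0 : ℝ)..1, ‖srvf f.toFun x‖ ^ 2} :=
    isClosed_eq (by fun_prop) continuous_const
  refine closure_minimal ?_ hcl hw
  rintro w ⟨γ, hγ, hw⟩
  exact norm_sq_of_ae_eq_act hγ.isWeakReparam hw

theorem inner_of_ae_eq_act {f₁ f₂ : PLCurve N} {w₁ w₂ : L2 N}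
    (hw₁ : w₁ =ᵐ[volI] act (srvf f₁.toFun) γ₁) (hw₂ : w₂ =ᵐ[volI] act (srvf f₂.toFun) γ₂) :
    inner ℝ w₁ w₂ = ∫ z in (0 : ℝ)..1, overlap f₁ f₂ γ₁ γ₂ z := by
  rw [L2.inner_def, ← integral_volI]
  refine integral_congr_ae ?_
  filter_upwards [hw₁, hw₂] with z h1 h2
  rw [h1, h2, overlap]

variable {f₁ f₂ : PLCurve N} {M : ℝ}

theorem integral_overlap_le (hM : ∀ v, (curveGrid f₁ f₂).Reach 0 1 v → v ≤ M)
    (h₁ : IsWeakReparam γ₁) (h₂ : IsWeakReparam γ₂) :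
    ∫ z in (0 : ℝ)..1, overlap f₁ f₂ γ₁ γ₂ z ≤ M := by
  obtain ⟨v, hv, hle⟩ := exists_reach_of_overlap (f₁ := f₁) (f₂ := f₂) h₁ h₂ le_rfl
    zero_le_one le_rfl
  rw [h₁.2.2.1, h₂.2.2.1, h₁.2.2.2.1, h₂.2.2.2.1] at hv
  exact hle.trans (hM v hv)

/-- The inequality is closed in each variable, so it passes from the orbits to their closures one
variable at a time. -/
theorem inner_le_of_mem_closedOrbit (hM : ∀ v, (curveGrid f₁ f₂).Reach 0 1 v → v ≤ M)
    {w₁ w₂ : L2 N} (hw₁ : w₁ ∈ closedOrbit (srvf f₁.toFun))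
    (hw₂ : w₂ ∈ closedOrbit (srvf f₂.toFun)) : inner ℝ w₁ w₂ ≤ M := by
  have h1 : ∀ w₁ ∈ orbit (srvf f₁.toFun), inner ℝ w₁ w₂ ≤ M := by
    rintro w₁ ⟨γ₁, hγ₁, hw₁⟩
    have hcl : IsClosed {w₂ : L2 N | inner ℝ w₁ w₂ ≤ M} :=
      isClosed_le (by fun_prop) continuous_const
    refine closure_minimal ?_ hcl hw₂
    rintro w₂ ⟨γ₂, hγ₂, hw₂⟩
    rw [mem_ofPred_eq, inner_of_ae_eq_act hw₁ hw₂]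
    exact integral_overlap_le hM hγ₁.isWeakReparam hγ₂.isWeakReparam
  have hcl : IsClosed {w₁ : L2 N | inner ℝ w₁ w₂ ≤ M} :=
    isClosed_le (by fun_prop) continuous_const
  exact closure_minimal h1 hcl hw₁

theorem orbitDist_le {q₁ q₂ : ℝ → EuclideanSpace ℝ (Fin N)} {w₁ w₂ : L2 N}
    (h₁ : w₁ ∈ closedOrbit q₁) (h₂ : w₂ ∈ closedOrbit q₂) : orbitDist q₁ q₂ ≤ dist w₁ w₂ :=
  csInf_le ⟨0, by rintro _ ⟨w₁, -, w₂, -, rfl⟩; exact dist_nonneg⟩ ⟨w₁, h₁, w₂, h₂, rfl⟩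

/-- With the norms fixed, `‖w₁ - w₂‖²` depends only on the inner product, and decreases with it. -/
theorem dist_le_dist_iff {w₁ w₂ w₁' w₂' : L2 N} (h₁ : ‖w₁‖ ^ 2 = ‖w₁'‖ ^ 2)
    (h₂ : ‖w₂‖ ^ 2 = ‖w₂'‖ ^ 2) :
    dist w₁ w₂ ≤ dist w₁' w₂' ↔ inner ℝ w₁' w₂' ≤ (inner ℝ w₁ w₂ : ℝ) := by
  rw [dist_eq_norm, dist_eq_norm, ← sq_le_sq₀ (norm_nonneg _) (norm_nonneg _), norm_sub_sq_real,
    norm_sub_sq_real, h₁, h₂]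
  constructor <;> intro h <;> linarith

/-- A pair of weak reparametrizations that attains the largest overlap is an optimal matching. -/
theorem isOptimalMatching_of_le {γ : ℝ → ℝ × ℝ}
    (hM : ∀ v, (curveGrid f₁ f₂).Reach 0 1 v → v ≤ M) (h₁ : IsWeakReparam fun z => (γ z).1)
    (h₂ : IsWeakReparam fun z => (γ z).2)
    (h : M ≤ ∫ z in (0 : ℝ)..1, overlap f₁ f₂ (fun z => (γ z).1) (fun z => (γ z).2) z) :
    IsOptimalMatching f₁ f₂ γ := by
  refine ⟨h₁, h₂, _, toLp_act_mem_closedOrbit f₁ h₁, _, toLp_act_mem_closedOrbit f₂ h₂,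
    (memLp_act f₁ h₁).coeFn_toLp, (memLp_act f₂ h₂).coeFn_toLp, le_antisymm ?_
    (orbitDist_le (toLp_act_mem_closedOrbit f₁ h₁) (toLp_act_mem_closedOrbit f₂ h₂))⟩
  refine le_csInf ⟨_, _, toLp_act_mem_closedOrbit f₁ h₁, _, toLp_act_mem_closedOrbit f₂ h₂, rfl⟩ ?_
  rintro _ ⟨w₁, hw₁, w₂, hw₂, rfl⟩
  rw [dist_le_dist_iff, inner_of_ae_eq_act (memLp_act f₁ h₁).coeFn_toLp
    (memLp_act f₂ h₂).coeFn_toLp]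
  · exact (inner_le_of_mem_closedOrbit hM hw₁ hw₂).trans h
  · rw [norm_sq_of_mem_closedOrbit hw₁,
      norm_sq_of_mem_closedOrbit (toLp_act_mem_closedOrbit f₁ h₁)]
  · rw [norm_sq_of_mem_closedOrbit hw₂,
      norm_sq_of_mem_closedOrbit (toLp_act_mem_closedOrbit f₂ h₂)]

/-- The overlap of an optimal matching is at least that of any pair of weak reparametrizations. -/
theorem IsOptimalMatching.le_overlap {γ : ℝ → ℝ × ℝ} (h : IsOptimalMatching f₁ f₂ γ)
    (h₁ : IsWeakReparam γ₁) (h₂ : IsWeakReparam γ₂) :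
    ∫ z in (0 : ℝ)..1, overlap f₁ f₂ γ₁ γ₂ z ≤
      ∫ z in (0 : ℝ)..1, overlap f₁ f₂ (fun z => (γ z).1) (fun z => (γ z).2) z := by
  obtain ⟨-, -, w₁, hw₁, w₂, hw₂, e₁, e₂, hd⟩ := h
  have := orbitDist_le (toLp_act_mem_closedOrbit f₁ h₁) (toLp_act_mem_closedOrbit f₂ h₂)
  rwa [← hd, dist_le_dist_iff, inner_of_ae_eq_act e₁ e₂, inner_of_ae_eq_act
    (memLp_act f₁ h₁).coeFn_toLp (memLp_act f₂ h₂).coeFn_toLp] at this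
  · rw [norm_sq_of_mem_closedOrbit hw₁,
      norm_sq_of_mem_closedOrbit (toLp_act_mem_closedOrbit f₁ h₁)]
  · rw [norm_sq_of_mem_closedOrbit hw₂,
      norm_sq_of_mem_closedOrbit (toLp_act_mem_closedOrbit f₂ h₂)]

end Orbits

/-! ### Paths through a sequence of points -/

/-- On `[a, a + r h]` the path `g` runs through the points `Y 0, …, Y r`, linearly and in time
`h` from each to the next. -/
def FollowsOn {F : Type*} [AddCommGroup F] [Module ℝ F] (g : ℝ → F) (Y : ℕ → F) (a h : ℝ)
    (r : ℕ) : Prop :=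
  ∀ i < r, ∀ z ∈ Icc (a + i * h) (a + (i + 1) * h),
    g z = Y i + ((z - (a + i * h)) / h) • (Y (i + 1) - Y i)

theorem exists_step {a h z : ℝ} {r : ℕ} (h1 : a ≤ z) (h2 : z < a + r * h) :
    ∃ i < r, a + i * h ≤ z ∧ z < a + (i + 1) * h := by
  induction r with
  | zero => simp at h2; linarith
  | succ r ih =>
    rcases lt_or_ge z (a + r * h) with h3 | h3
    · obtain ⟨i, hi, h4⟩ := ih h3
      exact ⟨i, by omega, h4⟩
    · exact ⟨r, by omega, h3, by push_cast at h2; exact h2⟩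

section Follows

variable {a h : ℝ} {r : ℕ}

theorem FollowsOn.fst {g : ℝ → ℝ × ℝ} {Y : ℕ → ℝ × ℝ} (hg : FollowsOn g Y a h r) :
    FollowsOn (fun z => (g z).1) (fun i => (Y i).1) a h r := fun i hi z hz => by
  simp [hg i hi z hz]

theorem FollowsOn.snd {g : ℝ → ℝ × ℝ} {Y : ℕ → ℝ × ℝ} (hg : FollowsOn g Y a h r) :
    FollowsOn (fun z => (g z).2) (fun i => (Y i).2) a h r := fun i hi z hz => by
  simp [hg i hi z hz]

section General

variable {F : Type*} [AddCommGroup F] [Module ℝ F] {g : ℝ → F} {Y : ℕ → F}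

theorem FollowsOn.left (hg : FollowsOn g Y a h r) (hh : 0 < h) {i : ℕ} (hi : i < r) :
    g (a + i * h) = Y i := by
  rw [hg i hi _ ⟨le_rfl, by nlinarith⟩]
  simp

theorem FollowsOn.right (hg : FollowsOn g Y a h r) (hh : 0 < h) {i : ℕ} (hi : i < r) :
    g (a + (i + 1) * h) = Y (i + 1) := by
  rw [hg i hi _ ⟨by nlinarith, le_rfl⟩,
    show (a + ((i : ℝ) + 1) * h - (a + i * h)) / h = 1 by field_simp; ring]
  simp

theorem FollowsOn.apply (hg : FollowsOn g Y a h r) (hh : 0 < h) (hr : 0 < r) {i : ℕ} (hi : i ≤ r) :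
    g (a + i * h) = Y i := by
  rcases i with _ | i
  · exact hg.left hh hr
  · have := hg.right hh (i := i) (by omega)
    push_cast
    exact this

theorem FollowsOn.linearOn (hg : FollowsOn g Y a h r) {i : ℕ} (hi : i < r) :
    LinearOn g (a + i * h) (a + (i + 1) * h) := by
  refine ⟨Y i - ((a + i * h) / h) • (Y (i + 1) - Y i), h⁻¹ • (Y (i + 1) - Y i), fun z hz => ?_⟩
  rw [hg i hi z hz, sub_div, sub_smul, smul_smul, ← div_eq_mul_inv]
  abel

theorem FollowsOn.piecewiseLinearOn (hg : FollowsOn g Y a h r) (hh : 0 < h) :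
    PiecewiseLinearOn g a (a + r * h) := by
  refine ⟨r, fun i => a + i * h, ⟨by simp, rfl, fun i _ => ?_⟩, fun i hi => ?_⟩
  · push_cast; nlinarith
  · have := hg.linearOn hi
    push_cast
    exact this

theorem FollowsOn.of_le (hg : FollowsOn g Y a h r) {r' : ℕ} (hr : r' ≤ r) :
    FollowsOn g Y a h r' := fun i hi => hg i (hi.trans_le hr)

end General

variable {g : ℝ → ℝ} {Y : ℕ → ℝ}

theorem FollowsOn.monotoneOn (hg : FollowsOn g Y a h r) (hh : 0 < h)
    (hY : ∀ i < r, Y i ≤ Y (i + 1)) : MonotoneOn g (Icc a (a + r * h)) := by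
  induction r with
  | zero => simp
  | succ r ih =>
    have h1 := ih (hg.of_le (Nat.le_succ r)) fun i hi => hY i (by omega)
    have h2 : MonotoneOn g (Icc (a + r * h) (a + (r + 1) * h)) := by
      intro u hu v hv huv
      rw [hg r (Nat.lt_succ_self r) u hu, hg r (Nat.lt_succ_self r) v hv]
      have := sub_nonneg.2 (hY r (Nat.lt_succ_self r))
      simp only [smul_eq_mul]
      gcongr
    have h3 : a ≤ a + r * h := by nlinarith [(r.cast_nonneg : (0 : ℝ) ≤ r)]
    have h4 : a + r * h ≤ a + (r + 1) * h := by linarith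
    have := h1.union_right h2 (isGreatest_Icc h3) (isLeast_Icc h4)
    rw [Icc_union_Icc_eq_Icc h3 h4] at this
    push_cast
    exact this

theorem FollowsOn.strictMonoOn (hg : FollowsOn g Y a h r) (hh : 0 < h)
    (hY : ∀ i < r, Y i < Y (i + 1)) : StrictMonoOn g (Icc a (a + r * h)) := by
  induction r with
  | zero => simp
  | succ r ih =>
    have h1 := ih (hg.of_le (Nat.le_succ r)) fun i hi => hY i (by omega)
    have h2 : StrictMonoOn g (Icc (a + r * h) (a + (r + 1) * h)) := by
      intro u hu v hv huv
      rw [hg r (Nat.lt_succ_self r) u hu, hg r (Nat.lt_succ_self r) v hv]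
      have := sub_pos.2 (hY r (Nat.lt_succ_self r))
      simp only [smul_eq_mul]
      gcongr
    have h3 : a ≤ a + r * h := by nlinarith [(r.cast_nonneg : (0 : ℝ) ≤ r)]
    have h4 : a + r * h ≤ a + (r + 1) * h := by linarith
    have := h1.union h2 (isGreatest_Icc h3) (isLeast_Icc h4)
    rw [Icc_union_Icc_eq_Icc h3 h4] at this
    push_cast
    exact this

theorem time_le (hh : 0 < h) {i j : ℕ} (hij : i ≤ j) : a + (i : ℝ) * h ≤ a + (j : ℝ) * h := by
  have : (i : ℝ) ≤ j := by exact_mod_cast hij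
  gcongr

theorem FollowsOn.lt_of_lt_time (hg : FollowsOn g Y a h r) (hh : 0 < h)
    (hY : ∀ i < r, Y i ≤ Y (i + 1)) {i : ℕ} (hi : i < r) (hlt : Y i < Y (i + 1)) {z : ℝ}
    (hz : a ≤ z) (hz' : z < a + (i + 1) * h) : g z < Y (i + 1) := by
  set w := max z (a + i * h)
  have hw : w < a + (i + 1) * h := max_lt hz' (by linarith)
  have hr : a + ((i : ℝ) + 1) * h ≤ a + r * h := by
    have := time_le (a := a) hh (i := i + 1) (j := r) (by omega)
    push_cast at this; exact this
  have h0 : a ≤ w := hz.trans (le_max_left _ _)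
  refine (hg.monotoneOn hh hY ⟨hz, (hz'.trans_le hr).le⟩ ⟨h0, (hw.trans_le hr).le⟩
    (le_max_left _ _)).trans_lt ?_
  rw [hg i hi w ⟨le_max_right _ _, hw.le⟩]
  have h1 : (w - (a + i * h)) / h < 1 := by rw [div_lt_one hh]; linarith
  simp only [smul_eq_mul]
  nlinarith

theorem FollowsOn.lt_of_time_lt (hg : FollowsOn g Y a h r) (hh : 0 < h)
    (hY : ∀ i < r, Y i ≤ Y (i + 1)) {i : ℕ} (hi : i < r) (hlt : Y i < Y (i + 1)) {z : ℝ}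
    (hz : a + i * h < z) (hz' : z ≤ a + r * h) : Y i < g z := by
  set w := min z (a + (i + 1) * h)
  have hw : a + i * h < w := lt_min hz (by linarith)
  have h0 : a ≤ a + i * h := by nlinarith [(i.cast_nonneg : (0 : ℝ) ≤ i)]
  refine lt_of_lt_of_le ?_ (hg.monotoneOn hh hY ⟨(h0.trans_lt hw).le, (min_le_left _ _).trans hz'⟩
    ⟨(h0.trans_lt hz).le, hz'⟩ (min_le_left _ _))
  rw [hg i hi w ⟨hw.le, min_le_right _ _⟩]
  have h1 : 0 < (w - (a + i * h)) / h := div_pos (by linarith) hh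
  simp only [smul_eq_mul]
  nlinarith

end Follows

/-! ### Pieces of optimal chains between vertices -/

namespace Grid

variable {G : Grid} {I J : ℕ → ℕ} {x y : ℕ → ℝ}

/-- The part of a chain from the index `k` to the index `k + r` joins two vertices, with no
vertices in between, and does not just run along the edge of a block or through a block of
non-positive weight. -/
structure IsPiece (G : Grid) (I J : ℕ → ℕ) (x y : ℕ → ℝ) (k r : ℕ) : Prop where
  pos : 0 < r
  left : G.IsVertex (x k) (y k)
  right : G.IsVertex (x (k + r)) (y (k + r))
  between : ∀ p, k < p → p < k + r → ¬ G.IsVertex (x p) (y p)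
  nontrivial : 1 < r ∨ (0 < G.W (I k) (J k) ∧ x k < x (k + 1) ∧ y k < y (k + 1))

theorem IsPiece.swap {k r : ℕ} (h : G.IsPiece I J x y k r) : G.swap.IsPiece J I y x k r :=
  ⟨h.pos, isVertex_swap.2 h.left, isVertex_swap.2 h.right,
    fun p h1 h2 => mt isVertex_swap.1 (h.between p h1 h2),
    h.nontrivial.imp id fun h => ⟨h.1, h.2.2, h.2.1⟩⟩

theorem IsPiece.lt_of_pos {k r p : ℕ} (hp : G.IsPiece I J x y k r) (h : G.IsOptimal I J x y)
    (h1 : k ≤ p) (h2 : p < k + r) (hW : 0 < G.W (I p) (J p)) :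
    x p < x (p + 1) ∧ y p < y (p + 1) := by
  rcases hp.nontrivial with hr | hr
  · refine h.lt_of_pos hW ?_
    rcases h1.eq_or_lt with rfl | h1
    · exact Or.inr (hp.between _ (by omega) (by omega))
    · exact Or.inl (hp.between _ h1 h2)
  · rcases h1.eq_or_lt with rfl | h1
    · exact hr.2
    · exact h.lt_of_pos hW (Or.inl (hp.between _ h1 h2))

/-- The `p`-th step crosses a block horizontally, from one vertical gridline to the next. -/
structure IsLevel (G : Grid) (I J : ℕ → ℕ) (x y : ℕ → ℝ) (p : ℕ) : Prop where
  exit : G.ExitRight I J x p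
  not_isVertex : ¬ G.IsVertex (x p) (y p)
  not_isVertex_succ : ¬ G.IsVertex (x (p + 1)) (y (p + 1))
  height : y p = y (p + 1)
  lt : x p < x (p + 1)

/-- The first block of a piece cannot be of this kind, since the point before such a step is not a
vertex. Any later block is entered through a gridline off the vertices, and the chain then leaves
through the opposite edge at constant height. -/
theorem IsPiece.isLevel_or {k r p : ℕ} (hp : G.IsPiece I J x y k r) (h : G.IsOptimal I J x y)
    (h1 : k ≤ p) (h2 : p < k + r) (hW : G.W (I p) (J p) ≤ 0) :
    G.IsLevel I J x y p ∨ G.swap.IsLevel J I y x p := by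
  have aux1 : ∀ {G : Grid} {I J : ℕ → ℕ} {x y : ℕ → ℝ} {l : ℕ}, G.IsOptimal I J x y →
      G.ExitRight I J x l → ¬ G.IsVertex (x (l + 1)) (y (l + 1)) →
      G.W (I (l + 1)) (J (l + 1)) ≤ 0 → G.IsLevel I J x y (l + 1) := by
    intro G I J x y l h hl hv hW
    obtain ⟨hv', hl'⟩ := h.exitRight_succ hl hv (Or.inl hW)
    exact ⟨hl', hv, hv', h.snd_succ_eq hl' hv' hW, h.fst_lt hl' hv'⟩
  rcases h1.eq_or_lt with rfl | h1
  · have hr : 1 < r := by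
      rcases hp.nontrivial with hr | hr
      · exact hr
      · exact absurd hr.1 (not_lt.2 hW)
    have hv := hp.between (k + 1) (by omega) (by omega)
    rcases IsChain.exit_of_not_isVertex h.toIsChainFrom hv with hk | hk
    · exact absurd hp.left (h.exitRight_pred hk hv (Or.inl hW)).1
    · exact absurd (isVertex_swap.2 hp.left)
        (h.swap.exitRight_pred hk (mt isVertex_swap.1 hv) (Or.inl hW)).1
  · obtain ⟨l, rfl⟩ : ∃ l, p = l + 1 := ⟨p - 1, by omega⟩
    have hv := hp.between (l + 1) (by omega) h2
    rcases IsChain.exit_of_not_isVertex h.toIsChainFrom hv with hk | hk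
    · exact Or.inl (aux1 h hk hv hW)
    · exact Or.inr (aux1 h.swap hk (mt isVertex_swap.1 hv) hW)

/-- Otherwise the first step would be level, and a level step neither begins nor ends at a vertex.
-/
theorem IsPiece.pos_left {k r : ℕ} (hp : G.IsPiece I J x y k r) (h : G.IsOptimal I J x y) :
    0 < G.W (I k) (J k) := by
  by_contra! hW
  have := hp.pos
  rcases hp.isLevel_or h le_rfl (by omega) hW with h1 | h1
  · exact h1.not_isVertex hp.left
  · exact h1.not_isVertex (isVertex_swap.2 hp.left)

theorem IsPiece.pos_right {k r : ℕ} (hp : G.IsPiece I J x y k (r + 1))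
    (h : G.IsOptimal I J x y) : 0 < G.W (I (k + r)) (J (k + r)) := by
  by_contra! hW
  rcases hp.isLevel_or h (Nat.le_add_right k r) (by omega) hW with h1 | h1
  · exact h1.not_isVertex_succ hp.right
  · exact h1.not_isVertex_succ (isVertex_swap.2 hp.right)

/-- A vertex in a block has its first coordinate on the left or on the right edge; the right edge is
impossible because the step in this block of positive weight advances. -/
theorem IsPiece.fst_left {k r : ℕ} (hp : G.IsPiece I J x y k r) (h : G.IsOptimal I J x y) :
    x k = G.s (I k - 1) := by
  have := hp.pos
  have h1 := (hp.lt_of_pos h le_rfl (by omega) (hp.pos_left h)).1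
  rcases hp.left.1.eq_or_eq G.hs (h.isBl k).2.1 (h.mem k).1.1 (h.mem k).1.2 with h2 | h2
  · exact h2
  · exact absurd ((h.mem' k).1.2.trans h2.ge) (not_le.2 h1)

theorem IsPiece.fst_right {k r : ℕ} (hp : G.IsPiece I J x y k (r + 1)) (h : G.IsOptimal I J x y) :
    x (k + r + 1) = G.s (I (k + r)) := by
  have h1 := (hp.lt_of_pos h (Nat.le_add_right k r) (by omega) (hp.pos_right h)).1
  rcases hp.right.1.eq_or_eq G.hs (h.isBl (k + r)).2.1 (h.mem' (k + r)).1.1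
    (h.mem' (k + r)).1.2 with h2 | h2
  · exact absurd (h2.le.trans (h.mem (k + r)).1.1) (not_le.2 h1)
  · exact h2

/-- In the interior of a step of a piece the chain is in the interior of the block. -/
theorem IsPiece.mem_interior {k r p : ℕ} (hp : G.IsPiece I J x y k r) (h : G.IsOptimal I J x y)
    (h1 : k ≤ p) (h2 : p < k + r) {θ : ℝ} (hθ : 0 < θ) (hθ' : θ < 1) :
    (G.s (I p - 1) < x p + θ * (x (p + 1) - x p) ∧ x p + θ * (x (p + 1) - x p) < G.s (I p)) ∧
    (G.t (J p - 1) < y p + θ * (y (p + 1) - y p) ∧ y p + θ * (y (p + 1) - y p) < G.t (J p)) := by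
  have hm := h.mem p
  have hm' := h.mem' p
  have strict : ∀ {lo hi u v : ℝ}, lo ≤ u → v ≤ hi → u < v →
      lo < u + θ * (v - u) ∧ u + θ * (v - u) < hi := by
    intro lo hi u v h1 h2 h3
    constructor
    · nlinarith
    · nlinarith
  rcases lt_or_ge 0 (G.W (I p) (J p)) with hW | hW
  · have := hp.lt_of_pos h h1 h2 hW
    exact ⟨strict hm.1.1 hm'.1.2 this.1, strict hm.2.1 hm'.2.2 this.2⟩
  rcases hp.isLevel_or h h1 h2 hW with hl | hl
  · refine ⟨strict hm.1.1 hm'.1.2 hl.lt, ?_⟩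
    rw [hl.height, sub_self, mul_zero, add_zero]
    exact hl.exit.mem_Ioo h.toIsChainFrom hl.not_isVertex_succ
  · refine ⟨?_, strict hm.2.1 hm'.2.2 hl.lt⟩
    rw [hl.height, sub_self, mul_zero, add_zero]
    exact hl.exit.mem_Ioo h.swap.toIsChainFrom hl.not_isVertex_succ

/-- What happens when a piece crosses a vertical gridline. -/
theorem IsPiece.crossing {k r p : ℕ} (hp : G.IsPiece I J x y k r) (h : G.IsOptimal I J x y)
    (h1 : k ≤ p) (h2 : p + 1 < k + r) (hk : G.ExitRight I J x p) :
    (G.W (I (p + 1)) (J (p + 1)) ≤ 0 → y (p + 1) = y (p + 2)) ∧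
    (0 < G.W (I (p + 1)) (J (p + 1)) → ∃ l, k ≤ l ∧ G.IsRun I J x y l p ∧
      (x l < x (l + 1) ∧ y l < y (l + 1)) ∧ (x (p + 1) < x (p + 2) ∧ y (p + 1) < y (p + 2)) ∧
      G.W (I l) (J l) ^ 2 * (x (l + 1) - x l) * (y (p + 2) - y (p + 1)) =
        G.W (I (p + 1)) (J (p + 1)) ^ 2 * (x (p + 2) - x (p + 1)) * (y (l + 1) - y l)) := by
  have hv := hp.between (p + 1) (by omega) h2
  refine ⟨fun hW => ?_, fun hW => ?_⟩
  · obtain ⟨hv', hk'⟩ := h.exitRight_succ hk hv (Or.inl hW)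
    exact h.snd_succ_eq hk' hv' hW
  · obtain ⟨l, hl⟩ := h.exists_isRun hk hv
    have hkl : k ≤ l := by
      by_contra! hc
      obtain ⟨k, rfl⟩ : ∃ k', k = k' + 1 := ⟨k - 1, by omega⟩
      exact hl.not_isVertex k (by omega) (by omega) hp.left
    have hlp := hl.le
    have h3 := hp.lt_of_pos h hkl (by omega) hl.pos
    exact ⟨l, hkl, hl, h3, hp.lt_of_pos h (by omega) h2 hW, (hl.crossing h hW h3.2).2⟩

theorem IsChain.index_mono (h : G.IsChain I J x y) {k l : ℕ} (hkl : k ≤ l) :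
    I k ≤ I l ∧ J k ≤ J l := by
  have : ∀ k, I k ≤ I (k + 1) ∧ J k ≤ J (k + 1) := by
    intro k
    rcases h.next k with h1 | h1 | h1 <;> constructor <;> omega
  exact ⟨monotone_nat_of_le_succ (fun k => (this k).1) hkl,
    monotone_nat_of_le_succ (fun k => (this k).2) hkl⟩

end Grid

theorem slope_ratio {X₁ Y₁ X₂ Y₂ c : ℝ} (hX₁ : 0 < X₁) (hY₁ : 0 < Y₁) (hX₂ : 0 < X₂)
    (hc : Y₂ * X₁ = c * (X₂ * Y₁)) :
    (ENNReal.ofReal Y₂ / ENNReal.ofReal X₂) / (ENNReal.ofReal Y₁ / ENNReal.ofReal X₁) =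
      ENNReal.ofReal c := by
  rw [← ENNReal.ofReal_div_of_pos hX₂, ← ENNReal.ofReal_div_of_pos hX₁,
    ← ENNReal.ofReal_div_of_pos (div_pos hY₁ hX₁)]
  congr 1
  field_simp
  linarith

/-! ### P-segments from pieces of optimal chains. -/

section PSegment

variable {N : ℕ} {f₁ f₂ : PLCurve N} {I J : ℕ → ℕ} {x y : ℕ → ℝ} {γ : ℝ → ℝ × ℝ} {a h : ℝ}
  {k r : ℕ}

/-- The sum of the two coordinates increases strictly along the path, even where one of them is
constant. -/
theorem FollowsOn.injOn {X : ℕ → ℝ × ℝ} (hγ : FollowsOn γ X a h r) (hh : 0 < h)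
    (hX : ∀ i < r, X i < X (i + 1)) : InjOn γ (Icc a (a + r * h)) := by
  have h1 : FollowsOn (fun z => (γ z).1 + (γ z).2) (fun i => (X i).1 + (X i).2) a h r := by
    intro i hi z hz
    simp only [hγ i hi z hz, Prod.fst_add, Prod.snd_add, Prod.smul_fst, Prod.smul_snd,
      Prod.fst_sub, Prod.snd_sub, smul_eq_mul]
    ring
  have h2 := h1.strictMonoOn hh fun i hi => by
    rcases Prod.lt_iff.1 (hX i hi) with h3 | h3 <;> linarith
  intro u hu v hv e
  exact h2.injOn hu hv (by simp only [e])

/-- At each crossing inside the piece the chain reaches and leaves the gridline strictly (`fst_lt`,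
`fst_succ_lt`). Before the step `i` the path is therefore strictly in front of the gridline by which
the block is entered, and after it strictly beyond the one by which it is left. -/
theorem passage_eq (ho : (curveGrid f₁ f₂).IsOptimal I J x y)
    (hp : (curveGrid f₁ f₂).IsPiece I J x y k r)
    (hγ : FollowsOn γ (fun i => (x (k + i), y (k + i))) a h r) (hh : 0 < h) {i : ℕ} (hi : i < r) :
    passage f₁ f₂ γ a (a + r * h) (I (k + i)) (J (k + i)) =
      Icc (a + i * h) (a + (i + 1) * h) := by
  -- One coordinate at a time; the second coordinate is covered by the exchanged grid.
  have aux : ∀ {G : Grid} {I J : ℕ → ℕ} {x y : ℕ → ℝ} {g : ℝ → ℝ}, G.IsOptimal I J x y →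
      (∀ p, k < p → p < k + r → ¬ G.IsVertex (x p) (y p)) →
      FollowsOn g (fun i => x (k + i)) a h r →
      (∀ z ∈ Icc (a + i * h) (a + (i + 1) * h),
        G.s (I (k + i) - 1) ≤ g z ∧ g z ≤ G.s (I (k + i))) ∧
      (∀ l, i = l + 1 → G.ExitRight I J x (k + l) → ∀ z ∈ Icc a (a + r * h), z < a + i * h →
        g z < G.s (I (k + i) - 1)) ∧
      (i + 1 < r → G.ExitRight I J x (k + i) → ∀ z ∈ Icc a (a + r * h), a + (i + 1) * h < z →
        G.s (I (k + i)) < g z) := by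
    intro G I J x y g ho hv hg
    have hmono : ∀ i < r, x (k + i) ≤ x (k + (i + 1)) := fun i _ => (ho.mono (k + i)).1
    refine ⟨fun z hz => ?_, ?_, ?_⟩
    · rw [hg i hi z hz]
      have h1 := (ho.mem (k + i)).1.1
      have h2 := (ho.mem' (k + i)).1.2
      have h3 := hmono i hi
      have h4 : 0 ≤ (z - (a + i * h)) / h := div_nonneg (by linarith [hz.1]) hh.le
      have h5 : (z - (a + i * h)) / h ≤ 1 := by rw [div_le_one hh]; linarith [hz.2]
      simp only [smul_eq_mul] at h1 h2 ⊢
      rw [← add_assoc] at h3 ⊢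
      constructor <;> nlinarith
    · rintro l rfl hl z hz hz'
      have h1 := ho.fst_lt hl (hv _ (by omega) (by omega))
      have h2 := hg.lt_of_lt_time hh hmono (i := l) (by omega) h1 hz.1
        (by push_cast at hz'; exact hz')
      rw [show k + (l + 1) = k + l + 1 from rfl] at h2 ⊢
      rwa [hl.1, Nat.add_sub_cancel, ← hl.2.2]
    · intro hi' hl z hz hz'
      have h1 := ho.fst_succ_lt hl (hv _ (by omega) (by omega))
      have h2 := hg.lt_of_time_lt hh hmono (i := i + 1) hi' h1 (by push_cast; exact hz') hz.2
      rwa [show k + (i + 1) = k + i + 1 from rfl, hl.2.2] at h2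
  have h1 := aux ho hp.between hγ.fst
  have h2 := aux ho.swap hp.swap.between hγ.snd
  have t0 : a ≤ a + i * h := by nlinarith [(i.cast_nonneg : (0 : ℝ) ≤ i)]
  have t1 : a + ((i : ℝ) + 1) * h ≤ a + r * h := by
    have := time_le (a := a) hh (i := i + 1) (j := r) (by omega)
    push_cast at this; exact this
  ext z
  constructor
  · rintro ⟨hz, ⟨hb1, hb2⟩, hb3, hb4⟩
    constructor
    · by_contra! hlt
      obtain ⟨l, rfl⟩ : ∃ l, i = l + 1 := by
        rcases i with _ | l
        · simp at hlt; linarith [hz.1]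
        · exact ⟨l, rfl⟩
      rcases Grid.IsChain.exit_of_not_isVertex ho.toIsChainFrom
        (hp.between (k + l + 1) (by omega) (by omega)) with hl | hl
      · exact absurd hb1 (not_le.2 (h1.2.1 l rfl hl z hz hlt))
      · exact absurd hb3 (not_le.2 (h2.2.1 l rfl hl z hz hlt))
    · by_contra! hlt
      have hi' : i + 1 < r := by
        by_contra! hc
        obtain rfl : r = i + 1 := by omega
        push_cast at hz
        linarith [hz.2]
      rcases Grid.IsChain.exit_of_not_isVertex ho.toIsChainFrom
        (hp.between (k + i + 1) (by omega) (by omega)) with hl | hl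
      · exact absurd hb2 (not_le.2 (h1.2.2 hi' hl z hz hlt))
      · exact absurd hb4 (not_le.2 (h2.2.2 hi' hl z hz hlt))
  · intro hz
    exact ⟨⟨t0.trans hz.1, hz.2.trans t1⟩, h1.1 z hz, h2.1 z hz⟩

theorem mem_interior_of_follows (ho : (curveGrid f₁ f₂).IsOptimal I J x y)
    (hp : (curveGrid f₁ f₂).IsPiece I J x y k r)
    (hγ : FollowsOn γ (fun i => (x (k + i), y (k + i))) a h r) (hh : 0 < h) {i : ℕ} (hi : i < r)
    {z : ℝ} (hz : z ∈ Ioo (a + i * h) (a + (i + 1) * h)) :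
    (f₁.node (I (k + i) - 1) < (γ z).1 ∧ (γ z).1 < f₁.node (I (k + i))) ∧
    (f₂.node (J (k + i) - 1) < (γ z).2 ∧ (γ z).2 < f₂.node (J (k + i))) := by
  have h4 : 0 < (z - (a + i * h)) / h := div_pos (by linarith [hz.1]) hh
  have h5 : (z - (a + i * h)) / h < 1 := by rw [div_lt_one hh]; linarith [hz.2]
  have := hp.mem_interior ho (Nat.le_add_right k i) (by omega) h4 h5
  rw [hγ i hi z ⟨hz.1.le, hz.2.le⟩]
  exact this

/-- An interval of positive length contains an interior time of some step. There the path is in the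
interior of a block, which identifies the block, and `passage_eq` then gives the times. -/
theorem exists_of_passesOn (ho : (curveGrid f₁ f₂).IsOptimal I J x y)
    (hp : (curveGrid f₁ f₂).IsPiece I J x y k r)
    (hγ : FollowsOn γ (fun i => (x (k + i), y (k + i))) a h r) (hh : 0 < h) {i j : ℕ}
    (hb : IsBlock f₁ f₂ i j) {c d : ℝ} (hcd : PassesOn f₁ f₂ γ a (a + r * h) i j c d) :
    ∃ l < r, i = I (k + l) ∧ j = J (k + l) ∧ c = a + l * h ∧ d = a + (l + 1) * h := by
  obtain ⟨hlt, heq⟩ := hcd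
  have hc : c ∈ passage f₁ f₂ γ a (a + r * h) i j := heq ▸ ⟨le_rfl, hlt.le⟩
  have hd : d ∈ passage f₁ f₂ γ a (a + r * h) i j := heq ▸ ⟨hlt.le, le_rfl⟩
  obtain ⟨l, hl, h1, h2⟩ := exists_step (h := h) hc.1.1 (hlt.trans_le hd.1.2)
  set z := (c + min d (a + (l + 1) * h)) / 2
  have hm : c < min d (a + (l + 1) * h) := lt_min hlt h2
  have hz1 : c < z := by simp only [z]; linarith
  have hz2 : z < min d (a + (l + 1) * h) := by simp only [z]; linarith
  have hz : z ∈ passage f₁ f₂ γ a (a + r * h) i j := by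
    rw [heq]
    exact ⟨hz1.le, hz2.le.trans (min_le_left _ _)⟩
  have hi := mem_interior_of_follows ho hp hγ hh hl (z := z)
    ⟨h1.trans_lt hz1, hz2.trans_le (min_le_right _ _)⟩
  obtain ⟨-, ⟨e1, e2⟩, e3, e4⟩ := hz
  have hbl := ho.isBl (k + l)
  have ei := f₁.isPartition.eq_of_mem_Ioo hbl.2.1 hi.1.1 hi.1.2 hb.2.1 hb.1 e1 e2
  have ej := f₂.isPartition.eq_of_mem_Ioo hbl.2.2.2 hi.2.1 hi.2.2 hb.2.2.2 hb.2.2.1 e3 e4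
  subst ei ej
  rw [passage_eq ho hp hγ hh hl] at heq
  have hle : a + (l : ℝ) * h ≤ a + (l + 1) * h := by linarith
  have e5 := congrArg sInf heq
  have e6 := congrArg sSup heq
  rw [csInf_Icc hle, csInf_Icc hlt.le] at e5
  rw [csSup_Icc hle, csSup_Icc hlt.le] at e6
  exact ⟨l, hl, rfl, rfl, e5.symm, e6.symm⟩

theorem blockSlope_of_follows (ho : (curveGrid f₁ f₂).IsOptimal I J x y)
    (hp : (curveGrid f₁ f₂).IsPiece I J x y k r)
    (hγ : FollowsOn γ (fun i => (x (k + i), y (k + i))) a h r) (hh : 0 < h) {i : ℕ} (hi : i < r) :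
    blockSlope f₁ f₂ γ a (a + r * h) (I (k + i)) (J (k + i)) =
      ENNReal.ofReal (y (k + i + 1) - y (k + i)) / ENNReal.ofReal (x (k + i + 1) - x (k + i)) := by
  have hle : a + (i : ℝ) * h ≤ a + (i + 1) * h := by linarith
  rw [blockSlope, passage_eq ho hp hγ hh hi, csInf_Icc hle, csSup_Icc hle, slopeOn,
    hγ.left hh hi, hγ.right hh hi]
  rfl

theorem succ_of_passesFromTo (ho : (curveGrid f₁ f₂).IsOptimal I J x y)
    (hp : (curveGrid f₁ f₂).IsPiece I J x y k r)
    (hγ : FollowsOn γ (fun i => (x (k + i), y (k + i))) a h r) (hh : 0 < h) {i j i' j' : ℕ}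
    (hb : IsBlock f₁ f₂ i j) (hb' : IsBlock f₁ f₂ i' j')
    (hpass : PassesFromTo f₁ f₂ γ a (a + r * h) i j i' j') :
    ∃ l, l + 1 < r ∧ i = I (k + l) ∧ j = J (k + l) ∧ i' = I (k + l + 1) ∧ j' = J (k + l + 1) := by
  obtain ⟨c, d, e, h1, h2⟩ := hpass
  obtain ⟨l, hl, rfl, rfl, -, rfl⟩ := exists_of_passesOn ho hp hγ hh hb h1
  obtain ⟨l', hl', rfl, rfl, h3, -⟩ := exists_of_passesOn ho hp hγ hh hb' h2
  have h4 : ((l : ℝ) + 1) * h = l' * h := by linarith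
  have h5 : ((l + 1 : ℕ) : ℝ) = l' := by
    push_cast
    exact mul_right_cancel₀ hh.ne' h4
  obtain rfl : l + 1 = l' := by exact_mod_cast h5
  exact ⟨l, hl', rfl, rfl, rfl, rfl⟩

theorem passesOn_of_follows (ho : (curveGrid f₁ f₂).IsOptimal I J x y)
    (hp : (curveGrid f₁ f₂).IsPiece I J x y k r)
    (hγ : FollowsOn γ (fun i => (x (k + i), y (k + i))) a h r) (hh : 0 < h) {i : ℕ} (hi : i < r) :
    ∃ c d, PassesOn f₁ f₂ γ a (a + r * h) (I (k + i)) (J (k + i)) c d :=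
  ⟨_, _, by linarith, passage_eq ho hp hγ hh hi⟩

theorem blockRule_of_follows (ho : (curveGrid f₁ f₂).IsOptimal I J x y)
    (hp : (curveGrid f₁ f₂).IsPiece I J x y k r)
    (hγ : FollowsOn γ (fun i => (x (k + i), y (k + i))) a h r) (hh : 0 < h) :
    BlockRule f₁ f₂ γ a (a + r * h) := by
  intro i j hb c d hcd
  obtain ⟨l, hl, rfl, rfl, rfl, rfl⟩ := exists_of_passesOn ho hp hγ hh hb hcd
  rw [blockSlope_of_follows ho hp hγ hh hl, hγ.left hh hl]
  refine ⟨hγ.linearOn hl, fun hW => ?_, fun hW => ?_⟩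
  · rcases hp.isLevel_or ho (Nat.le_add_right k l) (by omega) hW with h1 | h1
    · have e : ENNReal.ofReal (y (k + l + 1) - y (k + l)) /
          ENNReal.ofReal (x (k + l + 1) - x (k + l)) = 0 := by simp [h1.height]
      refine ⟨Or.inl e, fun _ => e, fun h2 => ?_⟩
      have h3 := (h1.exit.mem_Ioo ho.toIsChainFrom h1.not_isVertex_succ).1
      rw [← h1.height] at h3
      exact absurd h2 h3.ne'
    · have e : ENNReal.ofReal (y (k + l + 1) - y (k + l)) /
          ENNReal.ofReal (x (k + l + 1) - x (k + l)) = ∞ := by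
        have h4 : y (k + l) < y (k + l + 1) := h1.lt
        rw [← h1.height, sub_self, ENNReal.ofReal_zero, ENNReal.div_zero]
        simpa using h4
      refine ⟨Or.inr e, fun h2 => ?_, fun _ => e⟩
      have h3 := (h1.exit.mem_Ioo ho.swap.toIsChainFrom h1.not_isVertex_succ).1
      rw [← h1.height] at h3
      exact absurd h2 h3.ne'
  · have h1 := hp.lt_of_pos ho (Nat.le_add_right k l) (by omega) hW
    constructor
    · have : y (k + l) < y (k + l + 1) := h1.2
      simp [ENNReal.div_eq_zero_iff, this]
    · have : x (k + l) < x (k + l + 1) := h1.1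
      simp [ENNReal.div_eq_top, this]

/-- The rule is the crossing equation divided by the widths and heights involved. If the block
before the gridline has non-positive weight, the run ending there begins in the last block of
positive weight of this row, which supplies the index `k`. -/
theorem verticalGridlineRule_of_follows (ho : (curveGrid f₁ f₂).IsOptimal I J x y)
    (hp : (curveGrid f₁ f₂).IsPiece I J x y k r)
    (hγ : FollowsOn γ (fun i => (x (k + i), y (k + i))) a h r) (hh : 0 < h) :
    VerticalGridlineRule f₁ f₂ γ a (a + r * h) := by
  intro i j hb hb' hpass
  obtain ⟨l, hl, rfl, rfl, e1, e2⟩ := succ_of_passesFromTo ho hp hγ hh hb hb' hpass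
  have hk : (curveGrid f₁ f₂).ExitRight I J x (k + l) := by
    rcases Grid.IsChain.exit_of_not_isVertex ho.toIsChainFrom
        (hp.between (k + l + 1) (by omega) (by omega)) with hk | hk
    · exact hk
    · have : J (k + l + 1) = J (k + l) + 1 := hk.1
      omega
  have hc := hp.crossing ho (Nat.le_add_right k l) (by omega) hk
  have hs := blockSlope_of_follows ho hp hγ hh (i := l + 1) hl
  have hW' : weight f₁ f₂ (I (k + l) + 1) (J (k + l)) =
      weight f₁ f₂ (I (k + l + 1)) (J (k + l + 1)) := by rw [e1, ← e2]
  have hs' : blockSlope f₁ f₂ γ a (a + r * h) (I (k + l) + 1) (J (k + l)) =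
      blockSlope f₁ f₂ γ a (a + r * h) (I (k + (l + 1))) (J (k + (l + 1))) := by
    rw [e1, show J (k + l) = J (k + (l + 1)) from e2]
    rfl
  rw [hW', hs', hs]
  have ratio : ∀ p, k + p ≤ k + l → (curveGrid f₁ f₂).IsRun I J x y (k + p) (k + l) →
      (x (k + p) < x (k + p + 1) ∧ y (k + p) < y (k + p + 1)) →
      (x (k + l + 1) < x (k + l + 2) ∧ y (k + l + 1) < y (k + l + 2)) →
      weight f₁ f₂ (I (k + p)) (J (k + p)) ^ 2 * (x (k + p + 1) - x (k + p)) *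
          (y (k + l + 2) - y (k + l + 1)) =
        weight f₁ f₂ (I (k + l + 1)) (J (k + l + 1)) ^ 2 * (x (k + l + 2) - x (k + l + 1)) *
          (y (k + p + 1) - y (k + p)) →
      ENNReal.ofReal (y (k + (l + 1) + 1) - y (k + (l + 1))) /
          ENNReal.ofReal (x (k + (l + 1) + 1) - x (k + (l + 1))) /
        blockSlope f₁ f₂ γ a (a + r * h) (I (k + p)) (J (k + p)) =
      ENNReal.ofReal ((weight f₁ f₂ (I (k + l + 1)) (J (k + l + 1)) /
        weight f₁ f₂ (I (k + p)) (J (k + p))) ^ 2) := by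
    intro p hpl hr h1 h2 h3
    have hWp : 0 < weight f₁ f₂ (I (k + p)) (J (k + p)) := hr.pos
    rw [blockSlope_of_follows ho hp hγ hh (i := p) (by omega)]
    refine slope_ratio (sub_pos.2 h1.1) (sub_pos.2 h1.2) (sub_pos.2 h2.1) ?_
    change (y (k + l + 2) - y (k + l + 1)) * _ = _ * ((x (k + l + 2) - x (k + l + 1)) * _)
    rw [div_pow]
    field_simp
    linarith
  refine ⟨fun h1 h2 => ?_, fun h1 => ?_, fun h1 h2 => ?_⟩
  · obtain ⟨q, hkq, hr, h3, h4, h5⟩ := hc.2 h2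
    obtain rfl : q = k + l := by
      by_contra hne
      have := hr.le
      exact absurd h1 (not_lt.2 (hr.nonpos (k + l) (by omega) le_rfl))
    exact ratio l le_rfl hr h3 h4 h5
  · have : y (k + (l + 1)) = y (k + (l + 1) + 1) := hc.1 h1
    simp [this]
  · obtain ⟨q, hkq, hr, h3, h4, h5⟩ := hc.2 h2
    obtain ⟨p, rfl⟩ : ∃ p, q = k + p := ⟨q - k, by omega⟩
    have hpl := hr.le
    have hidx := hr.index (l - p) (by omega)
    rw [show k + p + (l - p) = k + l by omega] at hidx
    refine ⟨I (k + p), (ho.isBl _).1, by omega, ?_, fun i hi1 hi2 => ?_, ?_, ?_⟩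
    · rw [hidx.2]; exact hr.pos
    · have h6 := hr.index (i - I (k + p)) (by omega)
      have h7 := hr.nonpos (k + p + (i - I (k + p))) (by omega) (by omega)
      rw [h6.1, h6.2, show I (k + p) + (i - I (k + p)) = i by omega] at h7
      rw [hidx.2]
      exact h7
    · rw [hidx.2]
      exact passesOn_of_follows ho hp hγ hh (by omega)
    · rw [hidx.2]
      exact ratio p hpl hr h3 h4 h5

theorem horizontalGridlineRule_of_follows (ho : (curveGrid f₁ f₂).IsOptimal I J x y)
    (hp : (curveGrid f₁ f₂).IsPiece I J x y k r)
    (hγ : FollowsOn γ (fun i => (x (k + i), y (k + i))) a h r) (hh : 0 < h) :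
    HorizontalGridlineRule f₁ f₂ γ a (a + r * h) := by
  intro i j hb hb' hpass
  obtain ⟨l, hl, rfl, rfl, e2, e1⟩ := succ_of_passesFromTo ho hp hγ hh hb hb' hpass
  have hk : (curveGrid f₁ f₂).ExitUp I J y (k + l) := by
    rcases Grid.IsChain.exit_of_not_isVertex ho.toIsChainFrom
        (hp.between (k + l + 1) (by omega) (by omega)) with hk | hk
    · have : I (k + l + 1) = I (k + l) + 1 := hk.1
      omega
    · exact hk
  have hc := hp.swap.crossing ho.swap (Nat.le_add_right k l) (by omega) hk
  have hs := blockSlope_of_follows ho hp hγ hh (i := l + 1) hl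
  have hW' : weight f₁ f₂ (I (k + l)) (J (k + l) + 1) =
      weight f₁ f₂ (I (k + l + 1)) (J (k + l + 1)) := by rw [e1, ← e2]
  have hs' : blockSlope f₁ f₂ γ a (a + r * h) (I (k + l)) (J (k + l) + 1) =
      blockSlope f₁ f₂ γ a (a + r * h) (I (k + (l + 1))) (J (k + (l + 1))) := by
    rw [e1, show I (k + l) = I (k + (l + 1)) from e2]
    rfl
  rw [hW', hs', hs]
  have ratio : ∀ p, k + p ≤ k + l → (curveGrid f₁ f₂).swap.IsRun J I y x (k + p) (k + l) →
      (y (k + p) < y (k + p + 1) ∧ x (k + p) < x (k + p + 1)) →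
      (y (k + l + 1) < y (k + l + 2) ∧ x (k + l + 1) < x (k + l + 2)) →
      weight f₁ f₂ (I (k + p)) (J (k + p)) ^ 2 * (y (k + p + 1) - y (k + p)) *
          (x (k + l + 2) - x (k + l + 1)) =
        weight f₁ f₂ (I (k + l + 1)) (J (k + l + 1)) ^ 2 * (y (k + l + 2) - y (k + l + 1)) *
          (x (k + p + 1) - x (k + p)) → 0 < weight f₁ f₂ (I (k + l + 1)) (J (k + l + 1)) →
      ENNReal.ofReal (y (k + (l + 1) + 1) - y (k + (l + 1))) /
          ENNReal.ofReal (x (k + (l + 1) + 1) - x (k + (l + 1))) /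
        blockSlope f₁ f₂ γ a (a + r * h) (I (k + p)) (J (k + p)) =
      ENNReal.ofReal ((weight f₁ f₂ (I (k + p)) (J (k + p)) /
        weight f₁ f₂ (I (k + l + 1)) (J (k + l + 1))) ^ 2) := by
    intro p hpl hr h1 h2 h3 hWl
    rw [blockSlope_of_follows ho hp hγ hh (i := p) (by omega)]
    refine slope_ratio (sub_pos.2 h1.2) (sub_pos.2 h1.1) (sub_pos.2 h2.2) ?_
    change (y (k + l + 2) - y (k + l + 1)) * _ = _ * ((x (k + l + 2) - x (k + l + 1)) * _)
    rw [div_pow]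
    field_simp
    linarith
  refine ⟨fun h1 h2 => ?_, fun h1 => ?_, fun h1 h2 => ?_⟩
  · obtain ⟨q, hkq, hr, h3, h4, h5⟩ := hc.2 h2
    obtain rfl : q = k + l := by
      by_contra hne
      have := hr.le
      exact absurd h1 (not_lt.2 (hr.nonpos (k + l) (by omega) le_rfl))
    exact ratio l le_rfl hr h3 h4 h5 h2
  · obtain ⟨hv', hk'⟩ := ho.swap.exitRight_succ hk
      (hp.swap.between (k + l + 1) (by omega) (by omega)) (Or.inl h1)
    have h3 : x (k + (l + 1)) = x (k + (l + 1) + 1) := hc.1 h1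
    have h4 : y (k + (l + 1)) < y (k + (l + 1) + 1) := ho.swap.fst_lt hk' hv'
    rw [h3, sub_self, ENNReal.ofReal_zero, ENNReal.div_zero]
    simpa using h4
  · obtain ⟨q, hkq, hr, h3, h4, h5⟩ := hc.2 h2
    obtain ⟨p, rfl⟩ : ∃ p, q = k + p := ⟨q - k, by omega⟩
    have hpl := hr.le
    have hidx := hr.index (l - p) (by omega)
    rw [show k + p + (l - p) = k + l by omega] at hidx
    refine ⟨J (k + p), (ho.isBl _).2.2.1, by omega, ?_, fun i hi1 hi2 => ?_, ?_, ?_⟩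
    · rw [hidx.2]; exact hr.pos
    · have h6 := hr.index (i - J (k + p)) (by omega)
      have h7 := hr.nonpos (k + p + (i - J (k + p))) (by omega) (by omega)
      rw [h6.1, h6.2, show J (k + p) + (i - J (k + p)) = i by omega] at h7
      rw [hidx.2]
      exact h7
    · rw [hidx.2]
      exact passesOn_of_follows ho hp hγ hh (by omega)
    · rw [hidx.2]
      exact ratio p hpl hr h3 h4 h5 h2

theorem isPSegment_of_follows (ho : (curveGrid f₁ f₂).IsOptimal I J x y)
    (hp : (curveGrid f₁ f₂).IsPiece I J x y k r)
    (hγ : FollowsOn γ (fun i => (x (k + i), y (k + i))) a h r) (hh : 0 < h) (ha : 0 ≤ a)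
    (hb : a + r * h ≤ 1) : IsPSegment f₁ f₂ γ a (a + r * h) := by
  have hr := hp.pos
  have hr' : (0 : ℝ) < r := by exact_mod_cast hr
  obtain ⟨r', rfl⟩ : ∃ r', r = r' + 1 := ⟨r - 1, by omega⟩
  refine ⟨ha, by nlinarith, hb, hγ.piecewiseLinearOn hh, hγ.injOn hh fun i hi => ?_,
    ⟨I k, J k, I (k + r'), J (k + r'), ho.isBl _, ho.isBl _,
      (Grid.IsChain.index_mono ho.toIsChainFrom (Nat.le_add_right _ _)).1,
      (Grid.IsChain.index_mono ho.toIsChainFrom (Nat.le_add_right _ _)).2, ?_, ?_, ?_,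
      hp.pos_left ho, hp.pos_right ho⟩, blockRule_of_follows ho hp hγ hh,
    verticalGridlineRule_of_follows ho hp hγ hh, horizontalGridlineRule_of_follows ho hp hγ hh⟩
  · rw [Prod.lt_iff]
    rcases lt_or_ge 0 ((curveGrid f₁ f₂).W (I (k + i)) (J (k + i))) with hW | hW
    · have := hp.lt_of_pos ho (Nat.le_add_right k i) (by omega) hW
      exact Or.inl ⟨this.1, this.2.le⟩
    · rcases hp.isLevel_or ho (Nat.le_add_right k i) (by omega) hW with h1 | h1
      · exact Or.inl ⟨h1.lt, (ho.mono _).2⟩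
      · exact Or.inr ⟨(ho.mono _).1, h1.lt⟩
  · have := hγ.apply hh hr (i := 0) (by omega)
    simp only [Nat.cast_zero, zero_mul, add_zero] at this
    rw [this, hp.fst_left ho, hp.swap.fst_left ho.swap]
    rfl
  · rw [hγ.apply hh hr le_rfl]
    exact Prod.ext (hp.fst_right ho) (hp.swap.fst_right ho.swap)
  · intro z hz i hi j hj e
    obtain ⟨l, hl, h1, h2⟩ := exists_step hz.1.le hz.2
    rcases h1.eq_or_lt with rfl | h1
    · rw [hγ.left hh hl] at e
      have hl0 : l ≠ 0 := by rintro rfl; simp at hz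
      refine hp.between (k + l) (by omega) (by omega) ⟨⟨i, hi, ?_⟩, ⟨j, hj, ?_⟩⟩
      · exact (congrArg Prod.fst e).symm
      · exact (congrArg Prod.snd e).symm
    · have h3 := mem_interior_of_follows ho hp hγ hh hl ⟨h1, h2⟩
      refine f₁.isPartition.not_isNode (ho.isBl (k + l)).2.1 h3.1.1 h3.1.2 ⟨i, hi, ?_⟩
      exact (congrArg Prod.fst e).symm

end PSegment

/-! ### Perturbation of two consecutive P-segments -/

open Filter Topology in
theorem hasDerivAt_nonpos_of_le {F : ℝ → ℝ} {F' h₀ : ℝ} (hF : HasDerivAt F F' 0) (h0 : 0 < h₀)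
    (hle : ∀ h, 0 < h → h ≤ h₀ → F h ≤ F 0) : F' ≤ 0 := by
  have h1 := (hasDerivWithinAt_iff_tendsto_slope' (s := Ioi 0) (by simp)).1 hF.hasDerivWithinAt
  refine le_of_tendsto h1 ?_
  filter_upwards [Ioo_mem_nhdsGT h0] with h hh
  rw [slope_def_field, sub_zero]
  exact div_nonpos_of_nonpos_of_nonneg (sub_nonpos.2 (hle h hh.1 hh.2.le)) hh.1.le

/-- The corner is cut by `δ = t α` and `ε = t β`. To first order in `t` the two old steps lose `α β
/ 2` each and the new step gains `C * √(α β)`, so `C² ≤ α β`; written out, this is the claim. -/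
theorem corner_condition {A B C X₁ Y₁ X₂ Y₂ : ℝ} (hA : 0 < A) (hB : 0 < B)
    (hX₁ : 0 < X₁) (hY₁ : 0 < Y₁) (hX₂ : 0 < X₂) (hY₂ : 0 < Y₂)
    (h : ∀ δ ε, 0 < δ → δ ≤ X₁ → 0 < ε → ε ≤ Y₂ →
      A * √((X₁ - δ) * Y₁) + C * √(δ * ε) + B * √(X₂ * (Y₂ - ε)) ≤
        A * √(X₁ * Y₁) + B * √(X₂ * Y₂)) (hC : 0 < C) :
    C ^ 2 * √((Y₂ / X₂) / (Y₁ / X₁)) ≤ A * B := by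
  -- The direction of the perturbation is chosen such that both losses are equal, which by the
  -- inequality of the means yields the sharpest condition.
  set β := A * √(Y₁ / X₁) with hβ
  set α := B * √(X₂ / Y₂) with hα
  have hβ0 : 0 < β := mul_pos hA (Real.sqrt_pos.2 (div_pos hY₁ hX₁))
  have hα0 : 0 < α := mul_pos hB (Real.sqrt_pos.2 (div_pos hX₂ hY₂))
  have sX : √(Y₁ / X₁) = √Y₁ / √X₁ := Real.sqrt_div hY₁.le _
  have sY : √(X₂ / Y₂) = √X₂ / √Y₂ := Real.sqrt_div hX₂.le _
  have hd1 : HasDerivAt (fun t : ℝ => A * (√(X₁ - t * α) * √Y₁))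
      (A * ((-(1 * α) / (2 * √(X₁ - 0 * α))) * √Y₁)) 0 :=
    ((((hasDerivAt_id (0 : ℝ)).mul_const α).const_sub X₁).sqrt (by simpa using hX₁.ne')
      |>.mul_const _).const_mul A
  have hd2 : HasDerivAt (fun t : ℝ => B * (√X₂ * √(Y₂ - t * β)))
      (B * (√X₂ * (-(1 * β) / (2 * √(Y₂ - 0 * β))))) 0 :=
    ((((hasDerivAt_id (0 : ℝ)).mul_const β).const_sub Y₂).sqrt (by simpa using hY₂.ne')
      |>.const_mul _).const_mul B
  have hd3 : HasDerivAt (fun t : ℝ => t * (C * √(α * β))) (1 * (C * √(α * β))) 0 :=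
    (hasDerivAt_id (0 : ℝ)).mul_const _
  have hd := (hd1.add hd3).add hd2
  have h0 : 0 < min (X₁ / α) (Y₂ / β) := lt_min (by positivity) (by positivity)
  have key := hasDerivAt_nonpos_of_le hd h0 fun t ht ht' => ?_
  · have e1 : A * ((-(1 * α) / (2 * √(X₁ - 0 * α))) * √Y₁) = -(α * β) / 2 := by
      rw [zero_mul, sub_zero, hβ, sX]
      have := Real.sqrt_pos.2 hX₁
      field_simp
    have e2 : B * (√X₂ * (-(1 * β) / (2 * √(Y₂ - 0 * β)))) = -(α * β) / 2 := by
      rw [zero_mul, sub_zero, hα, sY]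
      have := Real.sqrt_pos.2 hY₂
      field_simp
    rw [e1, e2] at key
    have hs : 0 < √(α * β) := Real.sqrt_pos.2 (mul_pos hα0 hβ0)
    have hss : √(α * β) * √(α * β) = α * β := Real.mul_self_sqrt (mul_pos hα0 hβ0).le
    have h1 : C ≤ √(α * β) := by
      by_contra! hc
      nlinarith
    have h2 : C ^ 2 ≤ α * β := by nlinarith
    have h3 : √(Y₁ / X₁) * √(X₂ / Y₂) * √((Y₂ / X₂) / (Y₁ / X₁)) = 1 := by
      rw [← Real.sqrt_mul (by positivity), ← Real.sqrt_mul (by positivity)]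
      rw [show Y₁ / X₁ * (X₂ / Y₂) * (Y₂ / X₂ / (Y₁ / X₁)) = 1 by field_simp, Real.sqrt_one]
    calc C ^ 2 * √((Y₂ / X₂) / (Y₁ / X₁)) ≤ α * β * √((Y₂ / X₂) / (Y₁ / X₁)) := by gcongr
      _ = A * B * (√(Y₁ / X₁) * √(X₂ / Y₂) * √((Y₂ / X₂) / (Y₁ / X₁))) := by rw [hα, hβ]; ring
      _ = A * B := by rw [h3, mul_one]
  · have t1 : t * α ≤ X₁ := by
      rw [← le_div_iff₀ hα0]; exact ht'.trans (min_le_left _ _)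
    have t2 : t * β ≤ Y₂ := by
      rw [← le_div_iff₀ hβ0]; exact ht'.trans (min_le_right _ _)
    have := h (t * α) (t * β) (by positivity) t1 (by positivity) t2
    rw [Real.sqrt_mul (sub_nonneg.2 t1), Real.sqrt_mul hX₂.le, Real.sqrt_mul hX₁.le,
      Real.sqrt_mul hX₂.le, show t * α * (t * β) = t ^ 2 * (α * β) by ring,
      Real.sqrt_mul (by positivity), Real.sqrt_sq ht.le] at this
    simp only [Pi.add_apply, zero_mul, sub_zero, add_zero]
    linarith

namespace Grid

variable {G : Grid}

/-- If the direct connection of `p` and `q` through two vertices is the best one, it is not worse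
than cutting the corner to the left. -/
theorem corner_le {i₁ j₁ i₂ j₂ : ℕ} {p q : ℝ × ℝ} (hb₁ : G.IsBl i₁ j₁)
    (hb₂ : G.IsBl (i₂ + 1) (j₂ + 1)) (hA : 0 < G.W i₁ j₁) (hB : 0 < G.W (i₂ + 1) (j₂ + 1))
    (hp : G.Mem i₁ j₁ p) (hq : G.Mem (i₂ + 1) (j₂ + 1) q) (hs : G.s i₁ ≤ G.s i₂)
    (ht : G.t j₁ ≤ G.t j₂) (hX₁ : p.1 < G.s i₁) (hY₁ : p.2 < G.t j₁) (hX₂ : G.s i₂ < q.1)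
    (hY₂ : G.t j₂ < q.2)
    (h : ∀ v, G.Reach p q v → v ≤ G.W i₁ j₁ * √((G.s i₁ - p.1) * (G.t j₁ - p.2)) +
      G.W (i₂ + 1) (j₂ + 1) * √((q.1 - G.s i₂) * (q.2 - G.t j₂)))
    (hC : 0 < G.W i₁ (j₂ + 1)) :
    G.W i₁ (j₂ + 1) ^ 2 *
        √(((q.2 - G.t j₂) / (q.1 - G.s i₂)) / ((G.t j₁ - p.2) / (G.s i₁ - p.1))) ≤
      G.W i₁ j₁ * G.W (i₂ + 1) (j₂ + 1) := by
  refine corner_condition hA hB (sub_pos.2 hX₁) (sub_pos.2 hY₁) (sub_pos.2 hX₂) (sub_pos.2 hY₂)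
    (fun δ ε hδ hδ' hε hε' => ?_) hC
  have hbC : G.IsBl i₁ (j₂ + 1) := ⟨hb₁.1, hb₁.2.1, hb₂.2.2⟩
  have hp0 := hp.nonneg hb₁
  have hq1 := hq.le_one hb₂
  -- The competitor leaves the first block `δ` before its corner, rises freely to the row of the
  -- last block, crosses the block of weight `C` to the height `ε`, and runs freely into the last
  -- block.
  have m1 : G.Mem i₁ j₁ (G.s i₁ - δ, G.t j₁) :=
    ⟨⟨hp.1.1.trans (by simp only; linarith), by simp only; linarith⟩, hp.2.1.trans hp.2.2, le_rfl⟩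
  have m2 : G.Mem i₁ (j₂ + 1) (G.s i₁ - δ, G.t j₂) := ⟨m1.1, by simp, hq.2.1.trans hq.2.2⟩
  have m3 : G.Mem i₁ (j₂ + 1) (G.s i₁, G.t j₂ + ε) :=
    ⟨⟨hp.1.1.trans hp.1.2, le_rfl⟩, by simpa using hε.le, le_trans (by simp only; linarith) hq.2.2⟩
  have m4 : G.Mem (i₂ + 1) (j₂ + 1) (G.s i₂, G.t j₂ + ε) :=
    ⟨⟨by simp, hq.1.1.trans hq.1.2⟩, m3.2⟩
  have r1 := Reach.single hb₁ hp m1 ⟨by simp only; linarith, hY₁.le⟩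
  have r2 : G.Reach (G.s i₁ - δ, G.t j₁) (G.s i₁ - δ, G.t j₂) 0 :=
    Reach.zero (m1.nonneg hb₁) ⟨le_rfl, ht⟩ (m2.le_one hbC)
  have r3 := Reach.single hbC m2 m3 ⟨by simp only; linarith, by simp only; linarith⟩
  have r4 : G.Reach (G.s i₁, G.t j₂ + ε) (G.s i₂, G.t j₂ + ε) 0 :=
    Reach.zero (m3.nonneg hbC) ⟨hs, le_rfl⟩ (m4.le_one hb₂)
  have r5 := Reach.single hb₂ m4 hq ⟨hX₂.le, by simp only; linarith⟩
  have := h _ (r1.trans (r2.trans (r3.trans (r4.trans r5))))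
  rw [gain_of_pos hA, gain_of_pos hB, gain_of_pos hC] at this
  simp only at this
  rw [show G.s i₁ - δ - p.1 = G.s i₁ - p.1 - δ by ring, show G.s i₁ - (G.s i₁ - δ) = δ by ring,
    show G.t j₂ + ε - G.t j₂ = ε by ring,
    show q.2 - (G.t j₂ + ε) = q.2 - G.t j₂ - ε by ring] at this
  linarith

end Grid

/-! ### Segments of matchings -/

section Segments

variable {N : ℕ} {f₁ f₂ : PLCurve N} {γ : ℝ → ℝ × ℝ}

/-- In `[0, ∞]` the quotient `0 / 0` is `0`. A non-zero slope thus forces the second coordinate to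
grow, and then a finite one forces the first to grow. -/
theorem slopeOn_pos {c d : ℝ} (h0 : slopeOn γ c d ≠ 0) (h1 : slopeOn γ c d ≠ ∞) :
    (γ c).1 < (γ d).1 ∧ (γ c).2 < (γ d).2 := by
  have hY : (γ c).2 < (γ d).2 := by
    by_contra! hc
    exact h0 (by rw [slopeOn, ENNReal.ofReal_of_nonpos (by linarith), ENNReal.zero_div])
  refine ⟨?_, hY⟩
  by_contra! hc
  refine h1 ?_
  rw [slopeOn, ENNReal.ofReal_of_nonpos (by linarith : (γ d).1 - (γ c).1 ≤ 0), ENNReal.div_zero]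
  simpa using hY

theorem slope_of_passage {a b c d : ℝ} {i j : ℕ} (hrule : BlockRule f₁ f₂ γ a b)
    (hb : IsBlock f₁ f₂ i j) (hW : 0 < weight f₁ f₂ i j) (hcd : c < d)
    (hpass : passage f₁ f₂ γ a b i j = Icc c d) :
    ((γ c).1 < (γ d).1 ∧ (γ c).2 < (γ d).2) ∧ blockSlope f₁ f₂ γ a b i j =
      ENNReal.ofReal ((γ d).2 - (γ c).2) / ENNReal.ofReal ((γ d).1 - (γ c).1) := by
  have h1 := (hrule i j hb c d ⟨hcd, hpass⟩).2.2 hW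
  have e : blockSlope f₁ f₂ γ a b i j = slopeOn γ c d := by
    rw [blockSlope, hpass, csInf_Icc hcd.le, csSup_Icc hcd.le]
  rw [e] at h1 ⊢
  exact ⟨slopeOn_pos h1.1 h1.2, rfl⟩

variable (h₁ : IsWeakReparam fun z => (γ z).1) (h₂ : IsWeakReparam fun z => (γ z).2)
include h₁ h₂

theorem isCompact_passage {a b : ℝ} (ha : 0 ≤ a) (hb : b ≤ 1) (i j : ℕ) :
    IsCompact (passage f₁ f₂ γ a b i j) := by
  have hc : ContinuousOn γ (Icc a b) :=
    (h₁.continuousOn.prodMk h₂.continuousOn).mono (Icc_subset_Icc ha hb)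
  refine isCompact_Icc.of_isClosed_subset ?_ (fun z hz => hz.1)
  exact hc.preimage_isClosed_of_isClosed isClosed_Icc (isClosed_Icc.prod isClosed_Icc)

/-- The last block of a P-segment. -/
theorem IsPSegment.last_block {a b : ℝ} (h : IsPSegment f₁ f₂ γ a b) {i j : ℕ} (hi : i ≤ f₁.num)
    (hj : j ≤ f₂.num) (hv : γ b = vertex f₁ f₂ i j) :
    IsBlock f₁ f₂ i j ∧ 0 < weight f₁ f₂ i j ∧ ∃ c, 0 ≤ c ∧ c ≤ b ∧
      (curveGrid f₁ f₂).Mem i j (γ c) ∧ ((γ c).1 < f₁.node i ∧ (γ c).2 < f₂.node j) ∧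
      blockSlope f₁ f₂ γ a b i j =
        ENNReal.ofReal (f₂.node j - (γ c).2) / ENNReal.ofReal (f₁.node i - (γ c).1) := by
  obtain ⟨ha, hab, hb, -, -, ⟨i₀, j₀, i₁, j₁, hb₀, hb₁, hi01, hj01, hv₀, hv₁, -, hW₀, hW₁⟩,
    hrule, -, -⟩ := h
  have e := hv.symm.trans hv₁
  obtain rfl : i = i₁ := f₁.isPartition.inj hi hb₁.2.1 (congrArg Prod.fst e)
  obtain rfl : j = j₁ := f₂.isPartition.inj hj hb₁.2.2.2 (congrArg Prod.snd e)
  have hI : ∀ {z}, z ∈ Icc a b → z ∈ Icc (0 : ℝ) 1 := fun hz => ⟨ha.trans hz.1, hz.2.trans hb⟩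
  have ex : ∀ {g : ℝ → ℝ} {lo : ℝ}, IsWeakReparam g → lo < g b → ∃ z ∈ Ico a b, lo ≤ g z := by
    intro g lo hg hlo
    rcases le_total lo (g a) with h1 | h1
    · exact ⟨a, ⟨le_rfl, hab⟩, h1⟩
    · obtain ⟨z, hz, e⟩ := intermediate_value_Icc hab.le
        (hg.continuousOn.mono (Icc_subset_Icc ha hb)) ⟨h1, hlo.le⟩
      refine ⟨z, ⟨hz.1, hz.2.lt_of_ne ?_⟩, e.ge⟩
      rintro rfl
      exact hlo.ne e.symm
  have hb1 : (γ b).1 = f₁.node i := congrArg Prod.fst hv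
  have hb2 : (γ b).2 = f₂.node j := congrArg Prod.snd hv
  have hbb : b ∈ Icc a b := ⟨hab.le, le_rfl⟩
  obtain ⟨z₁, hz₁, hle₁⟩ := ex h₁ (lo := f₁.node (i - 1))
    (by simp only [hb1]; exact f₁.isPartition.lt (Nat.sub_lt hb₁.1 one_pos) hi)
  obtain ⟨z₂, hz₂, hle₂⟩ := ex h₂ (lo := f₂.node (j - 1))
    (by simp only [hb2]; exact f₂.isPartition.lt (Nat.sub_lt hb₁.2.2.1 one_pos) hj)
  -- The path is monotone and ends in the upper right corner of the block, so it stays in the block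
  -- once it is there: the passage is an interval that ends at `b`.
  have up : ∀ {z w}, z ∈ passage f₁ f₂ γ a b i j → z ≤ w → w ≤ b →
      w ∈ passage f₁ f₂ γ a b i j := by
    rintro z w ⟨hz, ⟨e1, e2⟩, e3, e4⟩ hzw hwb
    have hw : w ∈ Icc a b := ⟨hz.1.trans hzw, hwb⟩
    exact ⟨hw, ⟨e1.trans (h₁.monotoneOn (hI hz) (hI hw) hzw),
      (h₁.monotoneOn (hI hw) (hI hbb) hwb).trans hb1.le⟩,
      e3.trans (h₂.monotoneOn (hI hz) (hI hw) hzw),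
      (h₂.monotoneOn (hI hw) (hI hbb) hwb).trans hb2.le⟩
  have hz : max z₁ z₂ ∈ passage f₁ f₂ γ a b i j := by
    have hw : max z₁ z₂ ∈ Icc a b := ⟨hz₁.1.trans (le_max_left _ _), (max_lt hz₁.2 hz₂.2).le⟩
    exact ⟨hw, ⟨hle₁.trans (h₁.monotoneOn (hI ⟨hz₁.1, hz₁.2.le⟩) (hI hw) (le_max_left _ _)),
      (h₁.monotoneOn (hI hw) (hI hbb) hw.2).trans hb1.le⟩,
      hle₂.trans (h₂.monotoneOn (hI ⟨hz₂.1, hz₂.2.le⟩) (hI hw) (le_max_right _ _)),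
      (h₂.monotoneOn (hI hw) (hI hbb) hw.2).trans hb2.le⟩
  have hcomp := isCompact_passage (f₁ := f₁) (f₂ := f₂) h₁ h₂ ha hb i j
  have hmem := hcomp.sInf_mem ⟨_, hz⟩
  set c := sInf (passage f₁ f₂ γ a b i j)
  have hcb : c < b := (csInf_le hcomp.bddBelow hz).trans_lt (max_lt hz₁.2 hz₂.2)
  have hpass : passage f₁ f₂ γ a b i j = Icc c b := by
    ext w
    exact ⟨fun hw => ⟨csInf_le hcomp.bddBelow hw, hw.1.2⟩, fun hw => up hmem hw.1 hw.2⟩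
  have hs := slope_of_passage hrule hb₁ hW₁ hcb hpass
  rw [hb1, hb2] at hs
  exact ⟨hb₁, hW₁, c, ha.trans hmem.1.1, hcb.le, hmem.2, hs.1, hs.2⟩

/-- The first block of a P-segment. -/
theorem IsPSegment.first_block {a b : ℝ} (h : IsPSegment f₁ f₂ γ a b) {i j : ℕ} (hi : i ≤ f₁.num)
    (hj : j ≤ f₂.num) (hv : γ a = vertex f₁ f₂ i j) :
    IsBlock f₁ f₂ (i + 1) (j + 1) ∧ 0 < weight f₁ f₂ (i + 1) (j + 1) ∧ ∃ d, a ≤ d ∧ d ≤ 1 ∧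
      (curveGrid f₁ f₂).Mem (i + 1) (j + 1) (γ d) ∧
      (f₁.node i < (γ d).1 ∧ f₂.node j < (γ d).2) ∧
      blockSlope f₁ f₂ γ a b (i + 1) (j + 1) =
        ENNReal.ofReal ((γ d).2 - f₂.node j) / ENNReal.ofReal ((γ d).1 - f₁.node i) := by
  obtain ⟨ha, hab, hb, -, -, ⟨i₀, j₀, i₁, j₁, hb₀, hb₁, hi01, hj01, hv₀, hv₁, -, hW₀, hW₁⟩,
    hrule, -, -⟩ := h
  have e := hv.symm.trans hv₀
  have hi₀ := hb₀.2.1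
  have hj₀ := hb₀.2.2.2
  have ei : i = i₀ - 1 := f₁.isPartition.inj hi (by omega) (congrArg Prod.fst e)
  have ej : j = j₀ - 1 := f₂.isPartition.inj hj (by omega) (congrArg Prod.snd e)
  obtain rfl : i₀ = i + 1 := by have := hb₀.1; omega
  obtain rfl : j₀ = j + 1 := by have := hb₀.2.2.1; omega
  have hI : ∀ {z}, z ∈ Icc a b → z ∈ Icc (0 : ℝ) 1 := fun hz => ⟨ha.trans hz.1, hz.2.trans hb⟩
  have ex : ∀ {g : ℝ → ℝ} {hi : ℝ}, IsWeakReparam g → g a < hi → ∃ z ∈ Ioc a b, g z ≤ hi := by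
    intro g hi hg hhi
    rcases le_total (g b) hi with h1 | h1
    · exact ⟨b, ⟨hab, le_rfl⟩, h1⟩
    · obtain ⟨z, hz, e⟩ := intermediate_value_Icc hab.le
        (hg.continuousOn.mono (Icc_subset_Icc ha hb)) ⟨hhi.le, h1⟩
      refine ⟨z, ⟨hz.1.lt_of_ne ?_, hz.2⟩, e.le⟩
      rintro rfl
      exact hhi.ne e
  have ha1 : (γ a).1 = f₁.node i := congrArg Prod.fst hv
  have ha2 : (γ a).2 = f₂.node j := congrArg Prod.snd hv
  have haa : a ∈ Icc a b := ⟨le_rfl, hab.le⟩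
  obtain ⟨z₁, hz₁, hle₁⟩ := ex h₁ (hi := f₁.node (i + 1))
    (by simp only [ha1]; exact f₁.isPartition.lt (Nat.lt_succ_self i) hi₀)
  obtain ⟨z₂, hz₂, hle₂⟩ := ex h₂ (hi := f₂.node (j + 1))
    (by simp only [ha2]; exact f₂.isPartition.lt (Nat.lt_succ_self j) hj₀)
  -- The path starts in the lower left corner of the block, so the passage is an interval that
  -- begins at `a`.
  have down : ∀ {z w}, z ∈ passage f₁ f₂ γ a b (i + 1) (j + 1) → w ≤ z → a ≤ w →
      w ∈ passage f₁ f₂ γ a b (i + 1) (j + 1) := by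
    rintro z w ⟨hz, ⟨e1, e2⟩, e3, e4⟩ hzw hwb
    have hw : w ∈ Icc a b := ⟨hwb, hzw.trans hz.2⟩
    exact ⟨hw, ⟨ha1.ge.trans (h₁.monotoneOn (hI haa) (hI hw) hwb),
      (h₁.monotoneOn (hI hw) (hI hz) hzw).trans e2⟩,
      ha2.ge.trans (h₂.monotoneOn (hI haa) (hI hw) hwb),
      (h₂.monotoneOn (hI hw) (hI hz) hzw).trans e4⟩
  have hz : min z₁ z₂ ∈ passage f₁ f₂ γ a b (i + 1) (j + 1) := by
    have hw : min z₁ z₂ ∈ Icc a b := ⟨(lt_min hz₁.1 hz₂.1).le, (min_le_left _ _).trans hz₁.2⟩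
    exact ⟨hw, ⟨ha1.ge.trans (h₁.monotoneOn (hI haa) (hI hw) hw.1),
      (h₁.monotoneOn (hI hw) (hI ⟨hz₁.1.le, hz₁.2⟩) (min_le_left _ _)).trans hle₁⟩,
      ha2.ge.trans (h₂.monotoneOn (hI haa) (hI hw) hw.1),
      (h₂.monotoneOn (hI hw) (hI ⟨hz₂.1.le, hz₂.2⟩) (min_le_right _ _)).trans hle₂⟩
  have hcomp := isCompact_passage (f₁ := f₁) (f₂ := f₂) h₁ h₂ ha hb (i + 1) (j + 1)
  have hmem := hcomp.sSup_mem ⟨_, hz⟩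
  set d := sSup (passage f₁ f₂ γ a b (i + 1) (j + 1))
  have had : a < d := (lt_min hz₁.1 hz₂.1).trans_le (le_csSup hcomp.bddAbove hz)
  have hpass : passage f₁ f₂ γ a b (i + 1) (j + 1) = Icc a d := by
    ext w
    exact ⟨fun hw => ⟨hw.1.1, le_csSup hcomp.bddAbove hw⟩, fun hw => down hmem hw.2 hw.1⟩
  have hs := slope_of_passage hrule hb₀ hW₀ had hpass
  rw [ha1, ha2] at hs
  exact ⟨hb₀, hW₀, d, had.le, hmem.1.2.trans hb, hmem.2, hs.1, hs.2⟩

theorem overlap_eq_zero_of_flat {c d : ℝ} (hc : 0 ≤ c) (hd : d ≤ 1)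
    (h : (γ c).1 = (γ d).1 ∨ (γ c).2 = (γ d).2) {z : ℝ} (hz : z ∈ Ioo c d) :
    overlap f₁ f₂ (fun z => (γ z).1) (fun z => (γ z).2) z = 0 := by
  have key : ∀ {g : ℝ → ℝ}, IsWeakReparam g → g c = g d → deriv g z = 0 := by
    intro g hg e
    have hz0 : z ∈ Icc (0 : ℝ) 1 := ⟨hc.trans hz.1.le, hz.2.le.trans hd⟩
    have hc0 : c ∈ Icc (0 : ℝ) 1 := ⟨hc, hz.1.le.trans hz0.2⟩
    have hd0 : d ∈ Icc (0 : ℝ) 1 := ⟨hz0.1.trans hz.2.le, hd⟩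
    refine deriv_eq_zero_of_const_left hz.1 fun w hw => ?_
    have hw0 : w ∈ Icc (0 : ℝ) 1 := ⟨hc.trans hw.1, hw.2.trans hz0.2⟩
    have e1 := hg.monotoneOn hc0 hw0 hw.1
    have e2 := hg.monotoneOn hw0 hz0 hw.2
    have e3 := hg.monotoneOn hz0 hd0 hz.2.le
    linarith
  unfold overlap act
  rcases h with h | h
  · rw [key h₁ h]; simp
  · rw [key h₂ h]; simp

theorem integral_overlap_flat {c d : ℝ} (hc : 0 ≤ c) (hcd : c ≤ d) (hd : d ≤ 1)
    (h : (γ c).1 = (γ d).1 ∨ (γ c).2 = (γ d).2) :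
    ∫ z in c..d, overlap f₁ f₂ (fun z => (γ z).1) (fun z => (γ z).2) z = 0 := by
  rw [integral_congr_of_ae_Ioo (g := fun _ => (0 : ℝ)) hc hcd hd
    (Filter.Eventually.of_forall fun z hz => overlap_eq_zero_of_flat h₁ h₂ hc hd h hz)]
  simp

theorem IsNSegment.integral_overlap {a b : ℝ} (h : IsNSegment f₁ f₂ γ a b) :
    ∫ z in a..b, overlap f₁ f₂ (fun z => (γ z).1) (fun z => (γ z).2) z = 0 := by
  obtain ⟨ha, hab, hb, i₀, j₀, i₁, j₁, hi, -, hj, -, -, hv₀, hv₁, -, hc, -⟩ := h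
  rcases hi.eq_or_lt with rfl | hi
  · exact integral_overlap_flat h₁ h₂ ha hab.le hb (Or.inl (by rw [hv₀, hv₁]; rfl))
  rcases hj.eq_or_lt with rfl | hj
  · exact integral_overlap_flat h₁ h₂ ha hab.le hb (Or.inr (by rw [hv₀, hv₁]; rfl))
  have hm := (hc hi hj).1
  rw [integral_overlap_add h₁ h₂ (e := (a + b) / 2) ha (by linarith) (by linarith) hb,
    integral_overlap_flat h₁ h₂ ha (by linarith) (by linarith)
      (Or.inr (by rw [hv₀, hm]; rfl)),
    integral_overlap_flat h₁ h₂ (by linarith) (by linarith) hb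
      (Or.inl (by rw [hv₁, hm]; rfl)), add_zero]

omit h₁ h₂ in
/-- Two consecutive P-segments of an optimal matching satisfy the slope condition. -/
theorem IsOptimalMatching.exists_mu (hγ : IsOptimalMatching f₁ f₂ γ)
    (hmax : ∀ v, (curveGrid f₁ f₂).Reach 0 1 v →
      v ≤ ∫ z in (0 : ℝ)..1, overlap f₁ f₂ (fun z => (γ z).1) (fun z => (γ z).2) z)
    {u₁ u₂ u₃ u₄ : ℝ} {i₁ j₁ i₂ j₂ : ℕ}
    (hcons : ConsecutivePSegments f₁ f₂ γ u₁ u₂ u₃ u₄ i₁ j₁ i₂ j₂) :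
    ∃ μ ∈ muInterval (weight f₁ f₂ i₁ j₁) (weight f₁ f₂ (i₂ + 1) (j₂ + 1))
        (weight f₁ f₂ i₁ (j₂ + 1)) (weight f₁ f₂ (i₂ + 1) j₁),
      blockSlope f₁ f₂ γ u₃ u₄ (i₂ + 1) (j₂ + 1) =
        μ ^ 2 * blockSlope f₁ f₂ γ u₁ u₂ i₁ j₁ := by
  have h₁ := hγ.1
  have h₂ := hγ.2.1
  obtain ⟨hP, hP', hmid, hi₁, hj₁, hi₂, hj₂, hv₂, hv₃⟩ := hcons
  obtain ⟨hb, hA, c, hc0, hc, hmc, hlt, hs⟩ := hP.last_block h₁ h₂ hi₁ hj₁ hv₂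
  obtain ⟨hb', hB, d, hd, hd1, hmd, hlt', hs'⟩ := hP'.first_block h₁ h₂ hi₂ hj₂ hv₃
  have h23 : u₂ ≤ u₃ := by
    rcases hmid with rfl | h
    · exact le_rfl
    · exact h.2.1.le
  have hint : ∫ z in u₂..u₃, overlap f₁ f₂ (fun z => (γ z).1) (fun z => (γ z).2) z = 0 := by
    rcases hmid with rfl | h
    · simp
    · exact h.integral_overlap h₁ h₂
  have m2 : u₂ ∈ Icc (0 : ℝ) 1 := ⟨hc0.trans hc, hP.2.2.1⟩
  have m3 : u₃ ∈ Icc (0 : ℝ) 1 := ⟨hP'.1, hd.trans hd1⟩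
  have hle1 := h₁.monotoneOn m2 m3 h23
  have hle2 := h₂.monotoneOn m2 m3 h23
  simp only [hv₂, hv₃, vertex] at hle1 hle2
  -- Any chain from `γ c` to `γ d` is extended by chains that dominate the overlap before `c` and
  -- after `d`. Between `c` and `d` the matching itself collects at most the gains of the last and
  -- the first block, since an N-segment contributes nothing.
  have key : ∀ v, (curveGrid f₁ f₂).Reach (γ c) (γ d) v →
      v ≤ weight f₁ f₂ i₁ j₁ * √((f₁.node i₁ - (γ c).1) * (f₂.node j₁ - (γ c).2)) +
        weight f₁ f₂ (i₂ + 1) (j₂ + 1) * √(((γ d).1 - f₁.node i₂) * ((γ d).2 - f₂.node j₂)) := by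
    intro v hv
    obtain ⟨v1, hv1, hle1⟩ := exists_reach_of_overlap (f₁ := f₁) (f₂ := f₂) h₁ h₂ le_rfl hc0
      (hc.trans m2.2)
    obtain ⟨v2, hv2, hle2⟩ := exists_reach_of_overlap (f₁ := f₁) (f₂ := f₂) h₁ h₂
      (m3.1.trans hd) hd1 le_rfl
    have e0 : ((γ 0).1, (γ 0).2) = (0 : ℝ × ℝ) := Prod.ext h₁.2.2.1 h₂.2.2.1
    have e1 : ((γ 1).1, (γ 1).2) = (1 : ℝ × ℝ) := Prod.ext h₁.2.2.2.1 h₂.2.2.2.1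
    simp only [e0] at hv1
    simp only [e1] at hv2
    have h3 := hmax _ (hv1.trans (hv.trans hv2))
    have hmemv : (curveGrid f₁ f₂).Mem i₁ j₁ (γ u₂) := by
      rw [hv₂]
      exact ⟨⟨hmc.1.1.trans hmc.1.2, le_rfl⟩, hmc.2.1.trans hmc.2.2, le_rfl⟩
    have hmemv' : (curveGrid f₁ f₂).Mem (i₂ + 1) (j₂ + 1) (γ u₃) := by
      rw [hv₃]
      exact ⟨⟨le_rfl, hmd.1.1.trans hmd.1.2⟩, le_rfl, hmd.2.1.trans hmd.2.2⟩
    have g1 := integral_overlap_le_gain (f₁ := f₁) (f₂ := f₂) h₁ h₂ hb hc0 hc m2.2 hmc hmemv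
    have g2 := integral_overlap_le_gain (f₁ := f₁) (f₂ := f₂) h₁ h₂ hb' m3.1 hd hd1 hmemv' hmd
    rw [Grid.gain_of_pos hA] at g1
    rw [Grid.gain_of_pos hB] at g2
    simp only [hv₂] at g1
    simp only [hv₃] at g2
    rw [integral_overlap_add h₁ h₂ le_rfl hc0 (hc.trans m2.2) le_rfl,
      integral_overlap_add h₁ h₂ hc0 hc m2.2 le_rfl,
      integral_overlap_add h₁ h₂ m2.1 h23 m3.2 le_rfl,
      integral_overlap_add h₁ h₂ m3.1 hd hd1 le_rfl, hint] at h3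
    simp only [curveGrid, vertex] at g1 g2
    linarith
  have hC := Grid.corner_le (G := curveGrid f₁ f₂) hb hb' hA hB hmc hmd hle1 hle2 hlt.1 hlt.2
    hlt'.1 hlt'.2 key
  have hD := Grid.corner_le (G := (curveGrid f₁ f₂).swap) (p := (γ c).swap) (q := (γ d).swap)
    (Grid.IsBl.swap hb) (Grid.IsBl.swap hb') hA hB (Grid.Mem.swap hmc) (Grid.Mem.swap hmd)
    hle2 hle1 hlt.2 hlt.1 hlt'.2 hlt'.1 fun v hv => by
      have := key v hv.swap
      rw [mul_comm (f₁.node i₁ - _), mul_comm (_ - f₁.node i₂)] at this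
      exact this
  simp only [curveGrid, Grid.swap, Prod.fst_swap, Prod.snd_swap] at hC hD
  set X₁ := f₁.node i₁ - (γ c).1
  set Y₁ := f₂.node j₁ - (γ c).2
  set X₂ := (γ d).1 - f₁.node i₂
  set Y₂ := (γ d).2 - f₂.node j₂
  have hX₁ : 0 < X₁ := sub_pos.2 hlt.1
  have hY₁ : 0 < Y₁ := sub_pos.2 hlt.2
  have hX₂ : 0 < X₂ := sub_pos.2 hlt'.1
  have hY₂ : 0 < Y₂ := sub_pos.2 hlt'.2
  set ρ := √(Y₂ / X₂ / (Y₁ / X₁)) with hρ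
  have hρ0 : 0 < ρ := Real.sqrt_pos.2 (by positivity)
  have hinv : √(X₂ / Y₂ / (X₁ / Y₁)) = ρ⁻¹ := by
    rw [hρ, ← Real.sqrt_inv]
    congr 1
    field_simp
  rw [hinv] at hD
  set A := weight f₁ f₂ i₁ j₁
  set B := weight f₁ f₂ (i₂ + 1) (j₂ + 1)
  have hAB : 0 < A * B := mul_pos hA hB
  have hC' : 0 < weight f₁ f₂ i₁ (j₂ + 1) →
      ENNReal.ofReal ρ ≤ ENNReal.ofReal (A * B / weight f₁ f₂ i₁ (j₂ + 1) ^ 2) := fun h => by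
    refine ENNReal.ofReal_le_ofReal ?_
    rw [le_div_iff₀ (by positivity), mul_comm]
    exact hC h
  have hD' : 0 < weight f₁ f₂ (i₂ + 1) j₁ →
      ENNReal.ofReal (weight f₁ f₂ (i₂ + 1) j₁ ^ 2 / (A * B)) ≤ ENNReal.ofReal ρ := fun h => by
    refine ENNReal.ofReal_le_ofReal ?_
    rw [div_le_iff₀ hAB, mul_comm, ← div_le_iff₀ hρ0, div_eq_mul_inv]
    exact hD h
  -- The square of `ρ` is the quotient of the two slopes, so `ρ` is the required `μ`.
  refine ⟨ENNReal.ofReal ρ, ?_, ?_⟩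
  · unfold muInterval
    split_ifs with h1 h2 h2
    · exact ⟨hD' h2, hC' h1⟩
    · exact ⟨zero_le, hC' h1⟩
    · exact ⟨hD' h2, le_top⟩
    · exact ⟨zero_le, le_top⟩
  · rw [hs, hs', ← ENNReal.ofReal_pow hρ0.le, ← ENNReal.ofReal_div_of_pos hX₁,
      ← ENNReal.ofReal_div_of_pos hX₂, ← ENNReal.ofReal_mul (by positivity), hρ,
      Real.sq_sqrt (by positivity)]
    congr 1
    field_simp

end Segments

/-- The lower end exceeds the upper end exactly when `(A * B)² < (C * D)²`. -/
theorem muInterval_eq_empty {A B C D : ℝ} (hA : 0 < A) (hB : 0 < B) (hC : 0 < C) (hD : 0 < D)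
    (h : A * B < C * D) : muInterval A B C D = ∅ := by
  have hAB := mul_pos hA hB
  rw [muInterval, if_pos hC, if_pos hD, Icc_eq_empty]
  rw [not_le, ENNReal.ofReal_lt_ofReal_iff (by positivity),
    div_lt_div_iff₀ (by positivity) (by positivity)]
  nlinarith

/-! ### Routes: sequences of points that are divided into pieces of two kinds -/

/-- The points `Y 0, …, Y (τ r)` are divided into `r` pieces, the `i`-th of which is of kind `A`
or of kind `B` and has the value `w i`; of two consecutive pieces one is of kind `A`. -/
structure IsRoute (A B : ℕ → (ℕ → ℝ × ℝ) → ℝ → Prop) (r : ℕ) (τ : ℕ → ℕ) (Y : ℕ → ℝ × ℝ)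
    (w : ℕ → ℝ) (p q : ℝ × ℝ) : Prop where
  zero : τ 0 = 0
  left : Y 0 = p
  right : Y (τ r) = q
  lt : ∀ i < r, τ i < τ (i + 1)
  mono : ∀ j < τ r, Y j ≤ Y (j + 1)
  piece : ∀ i < r, A (τ (i + 1) - τ i) (fun j => Y (τ i + j)) (w i) ∨
    B (τ (i + 1) - τ i) (fun j => Y (τ i + j)) (w i)
  alternate : ∀ i, i + 1 < r → A (τ (i + 1) - τ i) (fun j => Y (τ i + j)) (w i) ∨
    A (τ (i + 2) - τ (i + 1)) (fun j => Y (τ (i + 1) + j)) (w (i + 1))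

/-- The kinds are required for all sequences that agree with `V` up to the index `n`, because the
concatenated sequence continues differently after that index. -/
theorem IsRoute.cons {A B : ℕ → (ℕ → ℝ × ℝ) → ℝ → Prop} {r : ℕ} {τ : ℕ → ℕ} {Y : ℕ → ℝ × ℝ}
    {w : ℕ → ℝ} {p q : ℝ × ℝ} (h : IsRoute A B r τ Y w p q) {n : ℕ} {V : ℕ → ℝ × ℝ} {c : ℝ}
    (hn : 0 < n) (hV : V n = p) (hmono : ∀ j < n, V j ≤ V (j + 1))
    (hA : (∀ V', (∀ j ≤ n, V' j = V j) → A n V' c) ∨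
      ((∀ V', (∀ j ≤ n, V' j = V j) → B n V' c) ∧
        (0 < r → A (τ 1) Y (w 0)))) :
    ∃ τ' Y' w', IsRoute A B (r + 1) τ' Y' w' (V 0) q ∧ τ' 1 = n ∧
      (∀ j ≤ n, Y' j = V j) ∧ w' 0 = c ∧
      ∑ i ∈ Finset.range (r + 1), w' i = c + ∑ i ∈ Finset.range r, w i := by
  set τ' := Grid.prepend 0 fun i => n + τ i with hτ'
  set w' := Grid.prepend c w with hw'
  set Y' : ℕ → ℝ × ℝ := fun j => if j < n then V j else Y (j - n) with hY'
  have t0 : τ' 0 = 0 := rfl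
  have ts : ∀ i, τ' (i + 1) = n + τ i := fun i => rfl
  have ys : ∀ i, Y' (n + i) = Y i := fun i => by simp [hY']
  have yv : ∀ j ≤ n, Y' j = V j := by
    intro j hj
    rcases hj.lt_or_eq with hj | rfl
    · simp [hY', hj]
    · have := ys 0
      rw [add_zero] at this
      rw [this, h.left, hV]
  have e1 : ∀ i, τ' (i + 2) - τ' (i + 1) = τ (i + 1) - τ i := fun i => by
    have h1 := ts i
    have h2 : τ' (i + 2) = n + τ (i + 1) := ts (i + 1)
    omega
  have e2 : ∀ i, (fun j => Y' (τ' (i + 1) + j)) = fun j => Y (τ i + j) := fun i => by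
    funext j
    rw [ts, add_assoc, ys]
  have e3 : τ' 1 - τ' 0 = n := by rw [t0, ts, h.zero]; rfl
  have e4 : (fun j => Y' (τ' 0 + j)) = Y' := by
    funext j
    rw [t0, zero_add]
  refine ⟨τ', Y', w', ⟨t0, yv 0 (Nat.zero_le _), ?_, ?_, ?_, ?_, ?_⟩, ?_, yv, rfl, ?_⟩
  · rw [ts, ys, h.right]
  · rintro (_ | i) hi
    · rw [t0, ts]; omega
    · have := h.lt i (by omega)
      rw [ts, ts]; omega
  · intro j hj
    rw [ts] at hj
    rcases lt_or_ge j n with hjn | hjn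
    · rw [yv j hjn.le, yv (j + 1) hjn]
      exact hmono j hjn
    · obtain ⟨i, rfl⟩ := Nat.exists_eq_add_of_le hjn
      rw [ys, add_assoc, ys]
      exact h.mono i (by omega)
  · rintro (_ | i) hi
    · rw [zero_add, e3, e4]
      exact hA.imp (fun h => h _ yv) fun h => h.1 _ yv
    · rw [e1, e2]
      exact h.piece i (by omega)
  · rintro (_ | i) hi
    · rw [zero_add, e3, e4, e1 0, e2 0, h.zero]
      simp only [zero_add]
      exact hA.imp (fun h => h _ yv) fun h => h.2 (by omega)
    · rw [e1, e2, e1, e2]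
      exact h.alternate i (by omega)
  · rw [ts, h.zero, add_zero]
  · rw [Finset.sum_range_succ', add_comm]
    rfl

/-! ### Stretches without gain and the division of an optimal chain into pieces. -/

namespace Grid

/-- The point half-way between `p` and `q` on the path that joins `p` and `q` by a horizontal
and a vertical segment. -/
noncomputable def corner (p q : ℝ × ℝ) : ℝ × ℝ :=
  if p.1 < q.1 ∧ p.2 < q.2 then (q.1, p.2) else ((p.1 + q.1) / 2, (p.2 + q.2) / 2)

theorem le_corner {p q : ℝ × ℝ} (h : p ≤ q) : p ≤ corner p q ∧ corner p q ≤ q := by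
  have h1 := h.1
  have h2 := h.2
  unfold corner
  split_ifs with hc
  · exact ⟨⟨h1, le_rfl⟩, le_rfl, h2⟩
  · exact ⟨⟨by simp only; linarith, by simp only; linarith⟩, by simp only; linarith,
      by simp only; linarith⟩

/-- The part of a chain from the index `a` to the index `b` joins two different vertices, does
not gain anything, and has no neighbouring parts of this kind. -/
structure IsIdle (G : Grid) (I J : ℕ → ℕ) (x y : ℕ → ℝ) (a b : ℕ) : Prop where
  le : a ≤ b
  left : G.IsVertex (x a) (y a)
  right : G.IsVertex (x b) (y b)
  ne : (x a, y a) ≠ (x b, y b)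
  sum_eq : ∑ k ∈ Finset.Ico a b, G.stepGain I J x y k = 0
  before : a = 0 ∨ ∃ k r, G.IsPiece I J x y k r ∧ a = k + r
  after : (x b, y b) = (1, 1) ∨ ∃ r, G.IsPiece I J x y b r

variable {G : Grid} {I J : ℕ → ℕ} {x y : ℕ → ℝ}

theorem IsIdle.swap {a b : ℕ} (h : G.IsIdle I J x y a b) : G.swap.IsIdle J I y x a b where
  le := h.le
  left := isVertex_swap.2 h.left
  right := isVertex_swap.2 h.right
  ne e := h.ne (Prod.ext (congrArg Prod.snd e) (congrArg Prod.fst e))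
  sum_eq := by
    rw [← h.sum_eq]
    exact Finset.sum_congr rfl fun k _ => stepGain_swap k
  before := h.before.imp id fun ⟨k, r, h1, h2⟩ => ⟨k, r, h1.swap, h2⟩
  after := h.after.imp (fun e => Prod.ext (congrArg Prod.snd e) (congrArg Prod.fst e))
    fun ⟨r, h1⟩ => ⟨r, h1.swap⟩

theorem IsOptimal.monotone (h : G.IsOptimal I J x y) {a b : ℕ} (hab : a ≤ b) :
    x a ≤ x b ∧ y a ≤ y b :=
  ⟨monotone_nat_of_le_succ (fun k => (h.toIsChainFrom.mono k).1) hab,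
    monotone_nat_of_le_succ (fun k => (h.toIsChainFrom.mono k).2) hab⟩

/-- The blocks below which, or above which, an optimal chain does not gain anything have
non-positive weights. -/
theorem IsIdle.weight_nonpos {a b : ℕ} (hz : G.IsIdle I J x y a b) (h : G.IsOptimal I J x y)
    {i₀ j₀ i₁ j₁ i j : ℕ} (hi₁ : i₁ ≤ G.m) (hj₁ : j₁ ≤ G.n) (hj₀ : j₀ ≤ G.n)
    (hxa : x a = G.s i₀) (hya : y a = G.t j₀) (hxb : x b = G.s i₁) (hyb : y b = G.t j₁)
    (hb : G.IsBl i j) (h1 : i₀ + 1 ≤ i) (h2 : i ≤ i₁) (h3 : j₀ ≤ j) (h4 : j ≤ j₁ + 1) :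
    G.W i j ≤ 0 := by
  by_contra! hW
  have hlt : G.s (i - 1) < G.s i := G.hs.lt (Nat.sub_lt hb.1 one_pos) hb.2.1
  have hΔ : 0 < G.s i - G.s (i - 1) := sub_pos.2 hlt
  have hl : x a ≤ G.s (i - 1) := by rw [hxa]; exact G.hs.le (by omega) (by omega)
  have hr : G.s i ≤ x b := by rw [hxb]; exact G.hs.le h2 hi₁
  have hab := h.monotone hz.le
  have ha0 := (h.mem a).nonneg (h.isBl a)
  have hb1 := (h.mem b).le_one (h.isBl b)
  have hm := (h.mem a).le_one (h.isBl a)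
  rcases h3.eq_or_lt with rfl | h3
  -- The block is just below the stretch. The preceding piece may end lower by `ε`, at a loss of
  -- order `ε`, and the block is then crossed up to the old height with a gain of order `√ε`. At the
  -- index `0` there is no row below, so a preceding piece exists.
  · have hne : a ≠ 0 := by
      rintro rfl
      have h0 := h.toIsChainFrom.zero.2.2.2
      have := G.ht.lt hb.2.2.1 hb.2.2.2
      rw [← hya, h0, G.ht.1] at this
      exact lt_irrefl _ this
    obtain ⟨k, r, hp, rfl⟩ := hz.before.resolve_left hne
    obtain ⟨r, rfl⟩ : ∃ r', r = r' + 1 := ⟨r - 1, by have := hp.pos; omega⟩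
    set p := k + r with hpd
    have hWp := hp.pos_right h
    have hlt' := hp.lt_of_pos h (Nat.le_add_right k r) (by omega) hWp
    have ex := hp.fst_right h
    have ey := hp.swap.fst_right h.swap
    rw [← hpd] at hWp hlt' ex ey
    have eJ : J p = j₀ := G.ht.inj (h.isBl p).2.2.2 hj₀ (ey.symm.trans hya)
    have hmp := h.mem p
    have hmp' := h.mem' p
    have hle := fun v => h.reach_le_sum (a := p) (b := b) (v := v) (by have := hz.le; omega)
    rw [Finset.sum_eq_sum_Ico_succ_bot (by have := hz.le; omega)] at hle
    have hsum : ∑ k ∈ Finset.Ico (p + 1) b, G.stepGain I J x y k = 0 := hz.sum_eq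
    rw [hsum, add_zero, stepGain, gain_of_pos hWp] at hle
    have hX : 0 < x (p + 1) - x p := sub_pos.2 hlt'.1
    have hY : 0 < y (p + 1) - y p := sub_pos.2 hlt'.2
    change y (p + 1) = _ at hya
    change x (p + 1) ≤ _ at hl
    have key := nonpos_of_forall_add_sqrt_le (A := G.W (I p) (J p) * √(x (p + 1) - x p))
      (B := G.W i j₀ * √(G.s i - G.s (i - 1))) (by positivity) hY
      (lt_min hY (sub_pos.2 (G.ht.lt (Nat.sub_lt hb.2.2.1 one_pos) hj₀))) fun ε hε hε' _ => ?_
    · exact absurd key (not_le.2 (mul_pos hW (Real.sqrt_pos.2 hΔ)))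
    have hε1 : ε ≤ y (p + 1) - y p := hε'.trans (min_le_left _ _)
    have hε2 : ε ≤ G.t j₀ - G.t (j₀ - 1) := hε'.trans (min_le_right _ _)
    have m1 : G.Mem (I p) (J p) (x (p + 1), y (p + 1) - ε) :=
      ⟨hmp'.1, hmp.2.1.trans (by simp only; linarith), le_trans (by simp only; linarith) hmp'.2.2⟩
    have m2 : G.Mem i j₀ (G.s (i - 1), y (p + 1) - ε) :=
      ⟨⟨le_rfl, hlt.le⟩, by simp only; linarith, by simp only; linarith⟩
    have m3 : G.Mem i j₀ (G.s i, y (p + 1)) :=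
      ⟨⟨hlt.le, le_rfl⟩, by simp only [hya]; linarith, hya.le⟩
    have r1 := Reach.single (h.isBl p) hmp m1 ⟨hlt'.1.le, by simp only; linarith⟩
    have r2 : G.Reach (x (p + 1), y (p + 1) - ε) (G.s (i - 1), y (p + 1) - ε) 0 :=
      Reach.zero (m1.nonneg (h.isBl p)) ⟨hl, le_rfl⟩ (m2.le_one hb)
    have r3 := Reach.single hb m2 m3 ⟨hlt.le, by simp only; linarith⟩
    have r4 : G.Reach (G.s i, y (p + 1)) (x b, y b) 0 :=
      Reach.zero (m3.nonneg hb) ⟨hr, hab.2⟩ hb1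
    have := hle _ (r1.trans (r2.trans (r3.trans r4)))
    rw [gain_of_pos hWp, gain_of_pos hW] at this
    simp only at this
    rw [show y (p + 1) - ε - y p = y (p + 1) - y p - ε by ring, sub_sub_cancel,
      Real.sqrt_mul hX.le, Real.sqrt_mul hX.le, Real.sqrt_mul hΔ.le] at this
    linarith
  have hd : y a ≤ G.t (j - 1) := by rw [hya]; exact G.ht.le (by omega) (by have := hb.2.2.2; omega)
  have hltj : G.t (j - 1) < G.t j := G.ht.lt (Nat.sub_lt hb.2.2.1 one_pos) hb.2.2.2
  have mlow : G.Mem i j (G.s (i - 1), G.t (j - 1)) := ⟨⟨le_rfl, hlt.le⟩, le_rfl, hltj.le⟩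
  have r1 : G.Reach (x a, y a) (G.s (i - 1), G.t (j - 1)) 0 :=
    Reach.zero ha0 ⟨hl, hd⟩ (mlow.le_one hb)
  rcases h4.eq_or_lt with rfl | h4
  -- The block is just above the stretch: it is crossed up to the height `ε`, and the following
  -- piece begins higher by `ε`.
  · rw [Nat.add_sub_cancel] at *
    have hne : (x b, y b) ≠ (1, 1) := by
      intro e
      have e2 : y b = 1 := congrArg Prod.snd e
      rw [← hyb, e2] at hltj
      exact absurd (G.ht.mem hb.2.2.2).2 (not_le.2 hltj)
    obtain ⟨r, hp⟩ := hz.after.resolve_left hne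
    have hWb := hp.pos_left h
    have hlt' := hp.lt_of_pos h le_rfl (by have := hp.pos; omega) hWb
    have hmb := h.mem b
    have hmb' := h.mem' b
    have hle := fun v => h.reach_le_sum (a := a) (b := b + 1) (v := v) (by have := hz.le; omega)
    rw [Finset.sum_Ico_succ_top hz.le, hz.sum_eq, zero_add, stepGain, gain_of_pos hWb] at hle
    have hX : 0 < x (b + 1) - x b := sub_pos.2 hlt'.1
    have hY : 0 < y (b + 1) - y b := sub_pos.2 hlt'.2
    have key := nonpos_of_forall_add_sqrt_le (A := G.W (I b) (J b) * √(x (b + 1) - x b))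
      (B := G.W i (j₁ + 1) * √(G.s i - G.s (i - 1))) (by positivity) hY
      (lt_min hY (sub_pos.2 hltj)) fun ε hε hε' _ => ?_
    · exact absurd key (not_le.2 (mul_pos hW (Real.sqrt_pos.2 hΔ)))
    have hε1 : ε ≤ y (b + 1) - y b := hε'.trans (min_le_left _ _)
    have hε2 : ε ≤ G.t (j₁ + 1) - G.t j₁ := hε'.trans (min_le_right _ _)
    have m1 : G.Mem (I b) (J b) (x b, G.t j₁ + ε) :=
      ⟨hmb.1, hmb.2.1.trans (by simp only; linarith), le_trans (by simp only; linarith) hmb'.2.2⟩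
    have m2 : G.Mem i (j₁ + 1) (G.s i, G.t j₁ + ε) :=
      ⟨⟨hlt.le, le_rfl⟩, by simp only [Nat.add_sub_cancel]; linarith, by simp only; linarith⟩
    have r2 := Reach.single hb mlow m2 ⟨hlt.le, by simp only; linarith⟩
    have r3 : G.Reach (G.s i, G.t j₁ + ε) (x b, G.t j₁ + ε) 0 :=
      Reach.zero (m2.nonneg hb) ⟨hr, le_rfl⟩ (m1.le_one (h.isBl b))
    have r4 := Reach.single (h.isBl b) m1 hmb' ⟨hlt'.1.le, by simp only; linarith⟩
    have := hle _ (r1.trans (r2.trans (r3.trans r4)))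
    rw [gain_of_pos hWb, gain_of_pos hW] at this
    simp only at this
    rw [← hyb, show y (b + 1) - (y b + ε) = y (b + 1) - y b - ε by ring, add_sub_cancel_left,
      Real.sqrt_mul hX.le, Real.sqrt_mul hX.le, Real.sqrt_mul hΔ.le] at this
    linarith
  -- The block lies between the two vertices, so its whole diagonal is available, and a positive
  -- gain contradicts the vanishing one.
  · have hu : G.t j ≤ y b := by rw [hyb]; exact G.ht.le (by omega) hj₁
    have mup : G.Mem i j (G.s i, G.t j) := ⟨⟨hlt.le, le_rfl⟩, hltj.le, le_rfl⟩
    have r2 := Reach.single hb mlow mup ⟨hlt.le, hltj.le⟩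
    have r3 : G.Reach (G.s i, G.t j) (x b, y b) 0 := Reach.zero (mup.nonneg hb) ⟨hr, hu⟩ hb1
    have := h.reach_le_sum hz.le (r1.trans (r2.trans r3))
    rw [hz.sum_eq, gain_of_pos hW] at this
    have := mul_pos hW (Real.sqrt_pos.2 (mul_pos hΔ (sub_pos.2 hltj)))
    simp only at *
    linarith

/-- The kind of pieces that become P-segments. -/
def Active (G : Grid) (I J : ℕ → ℕ) (x y : ℕ → ℝ) (n : ℕ) (Y : ℕ → ℝ × ℝ) (v : ℝ) : Prop :=
  ∃ k, G.IsPiece I J x y k n ∧ (∀ j ≤ n, Y j = (x (k + j), y (k + j))) ∧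
    v = ∑ j ∈ Finset.Ico k (k + n), G.stepGain I J x y j

/-- The kind of pieces that become N-segments. -/
def Idle (G : Grid) (I J : ℕ → ℕ) (x y : ℕ → ℝ) (n : ℕ) (Y : ℕ → ℝ × ℝ) (v : ℝ) : Prop :=
  ∃ a b, G.IsIdle I J x y a b ∧ n = 2 ∧ v = 0 ∧ Y 0 = (x a, y a) ∧ Y 2 = (x b, y b) ∧
    Y 1 = corner (x a, y a) (x b, y b)

/-- The candidate leads to the next index at which the chain is at a vertex. It fails to be a piece
only if it is a single step without gain. -/
theorem IsOptimal.exists_isPiece (h : G.IsOptimal I J x y) {k : ℕ} (hk : k < G.m + G.n)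
    (hv : G.IsVertex (x k) (y k)) :
    (∃ r, k + r ≤ G.m + G.n ∧ G.IsPiece I J x y k r) ∨
      (G.IsVertex (x (k + 1)) (y (k + 1)) ∧ G.stepGain I J x y k = 0) := by
  classical
  have hK : ∃ r, 0 < r ∧ G.IsVertex (x (k + r)) (y (k + r)) := by
    refine ⟨G.m + G.n - k, by omega, ?_⟩
    rw [Nat.add_sub_cancel' hk.le]
    obtain ⟨e1, e2⟩ := IsChain.eq_one h.toIsChainFrom (Nat.le_succ _)
    rw [e1, e2]
    exact isVertex_one
  obtain ⟨hr, hvr⟩ := Nat.find_spec hK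
  have hmin := fun r => Nat.find_min hK (m := r)
  have hle : Nat.find hK ≤ G.m + G.n - k := by
    refine Nat.find_min' hK ⟨by omega, ?_⟩
    rw [Nat.add_sub_cancel' hk.le]
    obtain ⟨e1, e2⟩ := IsChain.eq_one h.toIsChainFrom (Nat.le_succ _)
    rw [e1, e2]
    exact isVertex_one
  set r := Nat.find hK
  have hbetween : ∀ p, k < p → p < k + r → ¬ G.IsVertex (x p) (y p) := by
    intro p h1 h2 h3
    refine hmin (p - k) (by omega) ⟨by omega, ?_⟩
    rwa [Nat.add_sub_cancel' h1.le]
  by_cases hnt : 1 < r ∨ (0 < G.W (I k) (J k) ∧ x k < x (k + 1) ∧ y k < y (k + 1))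
  · exact Or.inl ⟨r, by omega, hr, hv, hvr, hbetween, hnt⟩
  · rw [not_or] at hnt
    obtain e : r = 1 := by omega
    rw [e] at hvr
    refine Or.inr ⟨hvr, gain_eq_zero ?_⟩
    by_contra! hc
    have := h.toIsChainFrom.mono k
    exact hnt.2 ⟨hc.1, this.1.lt_of_ne hc.2.1, this.2.lt_of_ne hc.2.2⟩

/-- From each vertex the optimal chain runs without any gain to the beginning of a piece or to
the end. -/
theorem IsOptimal.exists_idle (h : G.IsOptimal I J x y) {k : ℕ} (hk : k ≤ G.m + G.n)
    (hv : G.IsVertex (x k) (y k)) :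
    ∃ l, k ≤ l ∧ l ≤ G.m + G.n ∧ G.IsVertex (x l) (y l) ∧
      ∑ j ∈ Finset.Ico k l, G.stepGain I J x y j = 0 ∧
      (l = G.m + G.n ∨ ∃ r, l + r ≤ G.m + G.n ∧ G.IsPiece I J x y l r) := by
  induction hk using Nat.decreasingInduction with
  | self => exact ⟨_, le_rfl, le_rfl, hv, by simp, Or.inl rfl⟩
  | of_succ k hk ih =>
    rcases h.exists_isPiece hk hv with hp | ⟨hv', hg⟩
    · exact ⟨k, le_rfl, hk.le, hv, by simp, Or.inr hp⟩
    · obtain ⟨l, h1, h2, h3, h4, h5⟩ := ih hv'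
      refine ⟨l, by omega, h2, h3, ?_, h5⟩
      rw [Finset.sum_eq_sum_Ico_succ_bot (by omega), hg, h4, add_zero]

/-- All consecutive steps between vertices without gain are gathered into one idle piece. The
assumption that `k` is the start or follows an active piece, together with the choice of `l`,
provides the neighbours needed by `IsIdle.weight_nonpos` and the alternation of the kinds. -/
theorem IsOptimal.exists_isRoute (h : G.IsOptimal I J x y) {k : ℕ} (hk : k ≤ G.m + G.n)
    (hv : G.IsVertex (x k) (y k)) (hgood : k = 0 ∨ ∃ l r, G.IsPiece I J x y l r ∧ k = l + r) :
    ∃ r τ Y w, IsRoute (G.Active I J x y) (G.Idle I J x y) r τ Y w (x k, y k) (1, 1) ∧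
      ∑ i ∈ Finset.range r, w i = ∑ j ∈ Finset.Ico k (G.m + G.n), G.stepGain I J x y j := by
  induction hd : G.m + G.n - k using Nat.strong_induction_on generalizing k with
  | _ d ih =>
  obtain ⟨l, hkl, hl, hvl, hsum, hnext⟩ := h.exists_idle hk hv
  rw [← Finset.sum_Ico_consecutive _ hkl hl, hsum, zero_add]
  -- the route from the index `l` on, which begins with an active piece
  have key : ∃ r τ Y w, IsRoute (G.Active I J x y) (G.Idle I J x y) r τ Y w (x l, y l) (1, 1) ∧
      ((x l, y l) = (1, 1) ∨ ∃ n, G.IsPiece I J x y l n) ∧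
      (0 < r → G.Active I J x y (τ 1) Y (w 0)) ∧
      ∑ i ∈ Finset.range r, w i = ∑ j ∈ Finset.Ico l (G.m + G.n), G.stepGain I J x y j := by
    rcases hnext with rfl | ⟨n, hn, hp⟩
    · obtain ⟨e1, e2⟩ := IsChain.eq_one h.toIsChainFrom (Nat.le_succ (G.m + G.n))
      rw [e1, e2]
      exact ⟨0, fun _ => 0, fun _ => (1, 1), fun _ => 0,
        ⟨rfl, rfl, rfl, by simp, by simp, by simp, by simp⟩, Or.inl rfl, by simp, by simp⟩
    · have hn0 := hp.pos
      obtain ⟨r, τ, Y, w, hR, hw⟩ := ih (G.m + G.n - (l + n)) (by omega) hn hp.right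
        (Or.inr ⟨l, n, hp, rfl⟩) rfl
      have hA : ∀ V' : ℕ → ℝ × ℝ, (∀ j ≤ n, V' j = (x (l + j), y (l + j))) →
          G.Active I J x y n V' (∑ j ∈ Finset.Ico l (l + n), G.stepGain I J x y j) :=
        fun V' hV' => ⟨l, hp, hV', rfl⟩
      obtain ⟨τ', Y', w', hR', hτ', hY', hw0, hw'⟩ := hR.cons (n := n)
        (V := fun j => (x (l + j), y (l + j))) hn0 rfl
        (fun j _ => h.toIsChainFrom.mono (l + j)) (Or.inl hA)
      refine ⟨r + 1, τ', Y', w', hR', Or.inr ⟨n, hp⟩, fun _ => ?_, ?_⟩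
      · rw [hτ', hw0]
        exact hA _ hY'
      · rw [hw', hw, Finset.sum_Ico_consecutive _ (by omega) hn]
  obtain ⟨r, τ, Y, w, hR, hafter, hact, hw⟩ := key
  -- A stretch that does not move is dropped; otherwise it is replaced by the three points of a
  -- horizontal and a vertical segment.
  by_cases hne : (x k, y k) = (x l, y l)
  · rw [hne]
    exact ⟨r, τ, Y, w, hR, hw⟩
  · have hz : G.IsIdle I J x y k l := ⟨hkl, hv, hvl, hne, hsum, hgood, hafter⟩
    have hc := le_corner (p := (x k, y k)) (q := (x l, y l)) (h.monotone hkl)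
    obtain ⟨τ', Y', w', hR', -, -, -, hw'⟩ := hR.cons (n := 2) (c := 0)
      (V := prepend (x k, y k) (prepend (corner (x k, y k) (x l, y l)) fun _ => (x l, y l)))
      two_pos rfl
      (fun j hj => by
        interval_cases j
        · exact hc.1
        · exact hc.2)
      (Or.inr ⟨fun V' hV' => ⟨k, l, hz, rfl, rfl, hV' 0 (by omega), hV' 2 le_rfl,
        hV' 1 (by omega)⟩, hact⟩)
    exact ⟨r + 1, τ', Y', w', hR', by rw [hw', hw, zero_add]⟩

end Grid

/-! ### Construction of matchings from sequences of points -/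

theorem exists_followsOn {F : Type*} [AddCommGroup F] [Module ℝ F] (Y : ℕ → F) {h : ℝ}
    (hh : 0 < h) (r : ℕ) : ∃ g : ℝ → F, FollowsOn g Y 0 h r := by
  refine ⟨fun z => Y ⌊z / h⌋₊ + ((z - ⌊z / h⌋₊ * h) / h) • (Y (⌊z / h⌋₊ + 1) - Y ⌊z / h⌋₊),
    fun i _ z hz => ?_⟩
  simp only [zero_add] at hz ⊢
  rcases hz.2.eq_or_lt with rfl | hlt
  -- At the right end of a step the floor is already `i + 1`; the two formulas agree there.
  · have e : (((i : ℝ) + 1) * h) / h = ((i + 1 : ℕ) : ℝ) := by field_simp; push_cast; rfl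
    rw [e, Nat.floor_natCast, show (((i : ℝ) + 1) * h - i * h) / h = 1 by field_simp; ring]
    simp
  · have e : ⌊z / h⌋₊ = i := by
      rw [Nat.floor_eq_iff (div_nonneg (le_trans (by positivity) hz.1) hh.le), le_div_iff₀ hh,
        div_lt_iff₀ hh]
      exact ⟨hz.1, hlt⟩
    rw [e]

theorem FollowsOn.shift {F : Type*} [AddCommGroup F] [Module ℝ F] {g : ℝ → F} {Y : ℕ → F}
    {a h : ℝ} {r : ℕ} (hg : FollowsOn g Y a h r) {k n : ℕ} (hk : k + n ≤ r) :
    FollowsOn g (fun j => Y (k + j)) (a + k * h) h n := fun i hi z hz => by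
  have := hg (k + i) (by omega) z
  push_cast at this
  rw [show a + (k : ℝ) * h + i * h = a + (k + i) * h by ring] at hz ⊢
  rw [show a + (k : ℝ) * h + (i + 1) * h = a + (k + i + 1) * h by ring] at hz
  exact this hz

theorem FollowsOn.congr {F : Type*} [AddCommGroup F] [Module ℝ F] {g : ℝ → F} {Y Y' : ℕ → F}
    {a h : ℝ} {r : ℕ} (hg : FollowsOn g Y a h r) (hY : ∀ i ≤ r, Y i = Y' i) :
    FollowsOn g Y' a h r := fun i hi z hz => by
  rw [hg i hi z hz, hY i hi.le, hY (i + 1) hi]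

theorem deriv_nonneg_of_monotoneOn {g : ℝ → ℝ} {c d z : ℝ} (hg : MonotoneOn g (Icc c d))
    (hz : z ∈ Ioo c d) : 0 ≤ deriv g z := by
  rw [← derivWithin_of_mem_nhds (Icc_mem_nhds hz.1 hz.2)]
  exact hg.derivWithin_nonneg

/-- The values lie in `[0,1]`, so no step rises by more than `1` in time `h`, and the path is
Lipschitz with constant `h⁻¹`. -/
theorem FollowsOn.isWeakReparam {g : ℝ → ℝ} {Y : ℕ → ℝ} {h : ℝ} {r : ℕ}
    (hg : FollowsOn g Y 0 h r) (hh : 0 < h) (hr : r * h = 1) (hY : ∀ i < r, Y i ≤ Y (i + 1))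
    (h0 : Y 0 = 0) (h1 : Y r = 1) : IsWeakReparam g := by
  have hr0 : 0 < r := by
    rcases r.eq_zero_or_pos with rfl | hr0
    · simp at hr
    · exact hr0
  have hmono := hg.monotoneOn hh hY
  have e0 := hg.apply hh hr0 (Nat.zero_le _)
  have e1 := hg.apply hh hr0 le_rfl
  rw [zero_add, hr] at hmono e1
  rw [Nat.cast_zero, zero_mul, zero_add, h0] at e0
  rw [h1] at e1
  have hmaps : MapsTo g (Icc 0 1) (Icc 0 1) := fun z hz =>
    ⟨e0.symm.le.trans (hmono (left_mem_Icc.2 zero_le_one) hz hz.1),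
      (hmono hz (right_mem_Icc.2 zero_le_one) hz.2).trans e1.le⟩
  have hstep : ∀ i < r, Y (i + 1) - Y i ≤ 1 := by
    intro i hi
    have mem : ∀ j ≤ r, Y j ∈ Icc (0 : ℝ) 1 := fun j hj => by
      have e := hg.apply hh hr0 hj
      rw [← e]
      refine hmaps ⟨by positivity, ?_⟩
      rw [zero_add, ← hr]
      have : (j : ℝ) ≤ r := by exact_mod_cast hj
      gcongr
    linarith [(mem (i + 1) hi).2, (mem i hi.le).1]
  have hlip : LipschitzOnWith (Real.toNNReal h⁻¹) g (Icc 0 1) := by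
    -- The Lipschitz bound is read off from the monotonicity of `h⁻¹ * z - g z`, which is again a
    -- piecewise linear path.
    have hf : FollowsOn (fun z => h⁻¹ * z - g z) (fun i => (i : ℝ) - Y i) 0 h r := by
      intro i hi z hz
      simp only [hg i hi z hz]
      push_cast
      simp only [smul_eq_mul]
      field_simp
      ring
    have hm := hf.monotoneOn hh fun i hi => by
      push_cast
      linarith [hstep i hi]
    rw [zero_add, hr] at hm
    refine LipschitzOnWith.of_le_add_mul' _ fun u hu v hv => ?_
    rcases le_total u v with huv | huv
    · have : 0 ≤ h⁻¹ * dist u v := by positivity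
      linarith [hmono hu hv huv]
    · have := hm hv hu huv
      simp only at this
      rw [Real.dist_eq, abs_of_nonneg (sub_nonneg.2 huv)]
      linarith
  refine ⟨hmaps, ?_, e0, e1, ?_⟩
  · refine LipschitzOnWith.absolutelyContinuousOnInterval (K := Real.toNNReal h⁻¹) ?_
    rwa [uIcc_of_le zero_le_one]
  · rw [volI, ← Measure.restrict_congr_set Ioo_ae_eq_Icc]
    filter_upwards [ae_restrict_mem measurableSet_Ioo] with z hz
    exact deriv_nonneg_of_monotoneOn hmono hz

/-! ### The overlap attained by the constructed path. -/

section Overlap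

variable {N : ℕ} {f₁ f₂ : PLCurve N} {γ : ℝ → ℝ × ℝ}

theorem FollowsOn.deriv_eq {g : ℝ → ℝ} {Y : ℕ → ℝ} {a h : ℝ} {r : ℕ} (hg : FollowsOn g Y a h r)
    {i : ℕ} (hi : i < r) {z : ℝ} (hz : z ∈ Ioo (a + i * h) (a + (i + 1) * h)) :
    deriv g z = (Y (i + 1) - Y i) / h := by
  have he : g =ᶠ[nhds z] fun z => Y i + ((z - (a + i * h)) / h) * (Y (i + 1) - Y i) := by
    filter_upwards [Icc_mem_nhds hz.1 hz.2] with w hw using hg i hi w hw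
  rw [he.deriv_eq]
  have := ((((hasDerivAt_id z).sub_const (a + i * h)).div_const h).mul_const
    (Y (i + 1) - Y i)).const_add (Y i)
  simp only [id] at this
  rw [this.deriv]
  ring

/-- A linear step inside a block attains the gain of the step. -/
theorem FollowsOn.integral_overlap (h₁ : IsWeakReparam fun z => (γ z).1)
    (h₂ : IsWeakReparam fun z => (γ z).2) {Y : ℕ → ℝ × ℝ} {a h : ℝ} {r : ℕ}
    (hγ : FollowsOn γ Y a h r) (hh : 0 < h) {i : ℕ} (hi : i < r) (ha : 0 ≤ a)
    (hb : a + (i + 1) * h ≤ 1) (hY : Y i ≤ Y (i + 1)) {p q : ℕ}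
    (hblock : (curveGrid f₁ f₂).IsBl p q) (hm : (curveGrid f₁ f₂).Mem p q (Y i))
    (hm' : (curveGrid f₁ f₂).Mem p q (Y (i + 1)))
    (hflat : 0 < weight f₁ f₂ p q ∨ (Y i).1 = (Y (i + 1)).1 ∨ (Y i).2 = (Y (i + 1)).2) :
    ∫ z in a + i * h..a + (i + 1) * h, overlap f₁ f₂ (fun z => (γ z).1) (fun z => (γ z).2) z =
      (curveGrid f₁ f₂).gain p q (Y i) (Y (i + 1)) := by
  have hc : 0 ≤ a + i * h := by positivity
  have hcd : a + i * h ≤ a + (i + 1) * h := by linarith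
  have e1 := hγ.left hh hi
  have e2 := hγ.right hh hi
  have hX := sub_nonneg.2 hY.1
  have hZ := sub_nonneg.2 hY.2
  rw [integral_congr_of_ae_Ioo hc hcd hb (g := fun _ => weight f₁ f₂ p q *
    (√(((Y (i + 1)).1 - (Y i).1) * ((Y (i + 1)).2 - (Y i).2)) / h))]
  · rw [intervalIntegral.integral_const, smul_eq_mul]
    rcases hflat with hW | hW
    · rw [Grid.gain_of_pos hW]
      simp only [curveGrid]
      field_simp
      ring
    · rw [Grid.gain_eq_zero (Or.inr hW)]
      rcases hW with hW | hW <;> simp [hW]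
  · refine Filter.Eventually.of_forall fun z hz => ?_
    rw [overlap_eq_of_block h₁ h₂ hblock hc hb (by simpa only [e1] using hm)
      (by simpa only [e2] using hm') hz, hγ.fst.deriv_eq hi hz, hγ.snd.deriv_eq hi hz,
      ← Real.sqrt_mul (div_nonneg hX hh.le), div_mul_div_comm, Real.sqrt_div' _ (by positivity),
      Real.sqrt_mul_self hh.le]

open Grid in
/-- A piece of an optimal chain that becomes a P-segment attains its gain. -/
theorem integral_overlap_of_active {I J : ℕ → ℕ} {x y : ℕ → ℝ}
    (ho : (curveGrid f₁ f₂).IsOptimal I J x y) (h₁ : IsWeakReparam fun z => (γ z).1)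
    (h₂ : IsWeakReparam fun z => (γ z).2) {k n : ℕ}
    (hp : (curveGrid f₁ f₂).IsPiece I J x y k n) {a h : ℝ}
    (hγ : FollowsOn γ (fun j => (x (k + j), y (k + j))) a h n) (hh : 0 < h) (ha : 0 ≤ a)
    (hb : a + n * h ≤ 1) :
    ∫ z in a..a + n * h, overlap f₁ f₂ (fun z => (γ z).1) (fun z => (γ z).2) z =
      ∑ j ∈ Finset.Ico k (k + n), (curveGrid f₁ f₂).stepGain I J x y j := by
  have key : ∀ r ≤ n, ∫ z in a..a + r * h,
      overlap f₁ f₂ (fun z => (γ z).1) (fun z => (γ z).2) z =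
        ∑ j ∈ Finset.Ico k (k + r), (curveGrid f₁ f₂).stepGain I J x y j := by
    intro r hr
    induction r with
    | zero => simp
    | succ r ih =>
      have hle : a + ((r + 1 : ℕ) : ℝ) * h ≤ 1 := (time_le hh hr).trans hb
      push_cast at hle ⊢
      rw [← add_assoc, Finset.sum_Ico_succ_top (Nat.le_add_right k r), ← ih (by omega),
        integral_overlap_add h₁ h₂ (e := a + r * h) ha (by nlinarith [(r.cast_nonneg : (0:ℝ) ≤ r)])
          (by linarith) hle]
      congr 1
      refine hγ.integral_overlap h₁ h₂ hh hr ha hle (ho.toIsChainFrom.mono (k + r))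
        (ho.isBl (k + r)) (ho.mem (k + r)) (ho.mem' (k + r)) ?_
      rcases lt_or_ge 0 (weight f₁ f₂ (I (k + r)) (J (k + r))) with hW | hW
      · exact Or.inl hW
      · rcases hp.isLevel_or ho (Nat.le_add_right k r) (by omega) hW with h | h
        · exact Or.inr (Or.inr h.height)
        · exact Or.inr (Or.inl h.height)
  exact key n le_rfl

end Overlap

/-! ### N-segments from idle parts of chains -/

section NSegments

variable {N : ℕ} {f₁ f₂ : PLCurve N} {γ : ℝ → ℝ × ℝ} {I J : ℕ → ℕ} {x y : ℕ → ℝ}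

open Grid in
theorem isNSegment_of_follows (ho : (curveGrid f₁ f₂).IsOptimal I J x y) {k l : ℕ}
    (hz : (curveGrid f₁ f₂).IsIdle I J x y k l) {Y : ℕ → ℝ × ℝ} (hY0 : Y 0 = (x k, y k))
    (hY2 : Y 2 = (x l, y l)) (hY1 : Y 1 = corner (x k, y k) (x l, y l)) {a h : ℝ}
    (hγ : FollowsOn γ Y a h 2) (hh : 0 < h) (ha : 0 ≤ a) (hb : a + 2 * h ≤ 1) :
    IsNSegment f₁ f₂ γ a (a + 2 * h) := by
  obtain ⟨⟨i₀, hi₀, ei₀⟩, j₀, hj₀, ej₀⟩ := hz.left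
  obtain ⟨⟨i₁, hi₁, ei₁⟩, j₁, hj₁, ej₁⟩ := hz.right
  have hm := ho.monotone hz.le
  have hi : i₀ ≤ i₁ := by
    by_contra! hc
    exact absurd (f₁.isPartition.lt hc hi₀) (not_lt.2 ((ei₀.le.trans hm.1).trans ei₁.ge))
  have hj : j₀ ≤ j₁ := by
    by_contra! hc
    exact absurd (f₂.isPartition.lt hc hj₀) (not_lt.2 ((ej₀.le.trans hm.2).trans ej₁.ge))
  have e0 := hγ.apply hh two_pos (Nat.zero_le 2)
  have e1 := hγ.apply hh two_pos one_le_two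
  have e2 := hγ.apply hh two_pos le_rfl
  push_cast at e0 e1 e2
  rw [zero_mul, add_zero] at e0
  rw [one_mul] at e1
  have hmid : (a + (a + 2 * h)) / 2 = a + h := by ring
  have l0 := hγ.linearOn (i := 0) two_pos
  have l1 := hγ.linearOn (i := 1) one_lt_two
  push_cast at l0 l1
  rw [zero_mul, add_zero, zero_add, one_mul] at l0
  rw [one_mul, one_add_one_eq_two] at l1
  have hx : x k < x l ↔ i₀ < i₁ := by
    rw [← ei₀, ← ei₁]
    exact ⟨fun h => hi.lt_of_ne fun e => h.ne (by rw [e]), fun h => f₁.isPartition.lt h hi₁⟩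
  have hy : y k < y l ↔ j₀ < j₁ := by
    rw [← ej₀, ← ej₁]
    exact ⟨fun h => hj.lt_of_ne fun e => h.ne (by rw [e]), fun h => f₂.isPartition.lt h hj₁⟩
  refine ⟨ha, by linarith, hb, i₀, j₀, i₁, j₁, hi, hi₁, hj, hj₁, ?_, ?_, ?_, ?_, ?_, ?_, ?_⟩
  · by_contra! hc
    exact hz.ne (by rw [← ei₀, ← ei₁, ← ej₀, ← ej₁, hi.antisymm hc.1, hj.antisymm hc.2])
  · rw [e0, hY0, ← ei₀, ← ej₀]; rfl
  · rw [e2, hY2, ← ei₁, ← ej₁]; rfl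
  · intro hstraight
    have hne : ¬ (x k < x l ∧ y k < y l) := by rw [hx, hy]; omega
    rw [corner, if_neg hne] at hY1
    have hd : Y 2 - Y 1 = Y 1 - Y 0 := by
      rw [hY0, hY1, hY2]
      ext <;> simp <;> ring
    refine ⟨Y 0 - (a / h) • (Y 1 - Y 0), h⁻¹ • (Y 1 - Y 0), fun z hz => ?_⟩
    rcases le_total z (a + h) with hzh | hzh
    · rw [hγ 0 two_pos z ⟨by simpa using hz.1, by simpa using hzh⟩, zero_add, Nat.cast_zero,
        zero_mul, add_zero, sub_div, sub_smul, smul_smul, div_eq_mul_inv z]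
      abel
    · rw [hγ 1 one_lt_two z ⟨by simpa using hzh, by push_cast; linarith [hz.2]⟩, Nat.cast_one,
        one_mul, one_add_one_eq_two, hd, smul_smul,
        show (z - (a + h)) / h = z * h⁻¹ - a / h - 1 by field_simp; ring, sub_smul, sub_smul,
        one_smul]
      abel
  · intro hi' hj'
    rw [hmid]
    rw [corner, if_pos (by rw [hx, hy]; exact ⟨hi', hj'⟩)] at hY1
    refine ⟨?_, l0, l1⟩
    rw [e1, hY1, ← ei₁, ← ej₀]
    rfl
  · intro i j hbl h1 h2 h3 h4
    exact hz.weight_nonpos ho hi₁ hj₁ hj₀ ei₀.symm ej₀.symm ei₁.symm ej₁.symm hbl h1 h2 h3 h4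
  · intro i j hbl h1 h2 h3 h4
    exact hz.swap.weight_nonpos ho.swap hj₁ hi₁ hi₀ ej₀.symm ei₀.symm ej₁.symm ei₁.symm
      (Grid.IsBl.swap hbl) h3 h4 h1 h2

/-- The first block of the P-segment has positive weight, but it is one of those whose weights must
be non-positive for an N-segment with the same ends. -/
theorem IsPSegment.not_isNSegment {a b : ℝ} (h : IsPSegment f₁ f₂ γ a b) :
    ¬ IsNSegment f₁ f₂ γ a b := by
  rintro ⟨-, -, -, i₀, j₀, i₁, j₁, hi, hi₁, hj, hj₁, -, hv₀, hv₁, -, -, hW, -⟩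
  obtain ⟨-, -, -, -, -, ⟨p₀, q₀, p₁, q₁, hb₀, hb₁, hp, hq, hv₀', hv₁', -, hW₀, -⟩, -⟩ := h
  have e₀ := hv₀.symm.trans hv₀'
  have e₁ := hv₁.symm.trans hv₁'
  have hp₀ := hb₀.2.1
  have hq₀ := hb₀.2.2.2
  have a1 := f₁.isPartition.inj (hi.trans hi₁) (by omega) (congrArg Prod.fst e₀)
  have a2 := f₂.isPartition.inj (hj.trans hj₁) (by omega) (congrArg Prod.snd e₀)
  have a3 := f₁.isPartition.inj hi₁ hb₁.2.1 (congrArg Prod.fst e₁)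
  have a4 := f₂.isPartition.inj hj₁ hb₁.2.2.2 (congrArg Prod.snd e₁)
  have := hb₀.1
  exact absurd (hW p₀ q₀ hb₀ (by omega) (by omega) (by omega) (by omega)) (not_le.2 hW₀)

end NSegments

/-! ### The matching along an optimal chain and the main theorem. -/

section Main

variable {N : ℕ} (f₁ f₂ : PLCurve N)

/-- The matching that runs along an optimal chain of points. -/
theorem exists_matching : ∃ γ : ℝ → ℝ × ℝ, IsOptimalMatching f₁ f₂ γ ∧
    (∀ v, (curveGrid f₁ f₂).Reach 0 1 v →
      v ≤ ∫ z in (0 : ℝ)..1, overlap f₁ f₂ (fun z => (γ z).1) (fun z => (γ z).2) z) ∧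
    ∃ (k : ℕ) (u : ℕ → ℝ), IsPartition 0 1 k u ∧
      (∀ i < k, IsPSegment f₁ f₂ γ (u i) (u (i + 1)) ∨ IsNSegment f₁ f₂ γ (u i) (u (i + 1))) ∧
      (∀ i, i + 1 < k → ¬ (IsNSegment f₁ f₂ γ (u i) (u (i + 1)) ∧
        IsNSegment f₁ f₂ γ (u (i + 1)) (u (i + 2)))) := by
  obtain ⟨I, J, x, y, ho⟩ := Grid.exists_isOptimal (curveGrid f₁ f₂)
  have hz := ho.toIsChainFrom.zero
  have hx0 : x 0 = 0 := hz.2.2.1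
  have hy0 : y 0 = 0 := hz.2.2.2
  obtain ⟨r, τ, Y, w, hR, hw⟩ := ho.exists_isRoute (Nat.zero_le _)
    (Grid.IsChain.isVertex_zero ho.toIsChainFrom) (Or.inl rfl)
  rw [hx0, hy0] at hR
  have hτ : ∀ i ≤ r, ∀ j ≤ i, τ j ≤ τ i := by
    intro i hi
    induction i with
    | zero => intro j hj; rw [Nat.le_zero.1 hj]
    | succ i ih =>
      intro j hj
      rcases hj.lt_or_eq with hj | rfl
      · exact (ih (by omega) j (by omega)).trans (hR.lt i hi).le
      · exact le_rfl
  have hpos : 0 < τ r := by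
    by_contra! hc
    have e := hR.right
    rw [Nat.le_zero.1 hc, hR.left] at e
    exact zero_ne_one (congrArg Prod.fst e)
  have hposR : (0 : ℝ) < τ r := by exact_mod_cast hpos
  -- All steps take the same time; an idle piece consists of two, so its corner is reached half-way,
  -- as an N-segment requires.
  set h : ℝ := (τ r : ℝ)⁻¹ with hh
  have h0 : 0 < h := inv_pos.2 hposR
  have hr1 : (τ r : ℝ) * h = 1 := mul_inv_cancel₀ hposR.ne'
  obtain ⟨γ, hγ⟩ := exists_followsOn Y h0 (τ r)
  have h₁ : IsWeakReparam fun z => (γ z).1 := hγ.fst.isWeakReparam h0 hr1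
    (fun i hi => (hR.mono i hi).1) (congrArg Prod.fst hR.left) (congrArg Prod.fst hR.right)
  have h₂ : IsWeakReparam fun z => (γ z).2 := hγ.snd.isWeakReparam h0 hr1
    (fun i hi => (hR.mono i hi).2) (congrArg Prod.snd hR.left) (congrArg Prod.snd hR.right)
  set u : ℕ → ℝ := fun i => τ i * h with hu
  have u0 : ∀ i, 0 ≤ u i := fun i => by positivity
  have u1 : ∀ i ≤ r, u i ≤ 1 := by
    intro i hi
    rw [← hr1]
    have : (τ i : ℝ) ≤ τ r := by exact_mod_cast hτ r le_rfl i hi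
    simp only [hu]
    gcongr
  have ustep : ∀ i < r, u (i + 1) = u i + ((τ (i + 1) - τ i : ℕ) : ℝ) * h := by
    intro i hi
    rw [Nat.cast_sub (hR.lt i hi).le]
    simp only [hu]
    ring
  have hsub : ∀ i < r, FollowsOn γ (fun j => Y (τ i + j)) (u i) h (τ (i + 1) - τ i) := by
    intro i hi
    have := hγ.shift (k := τ i) (n := τ (i + 1) - τ i) (by
      have := hR.lt i hi
      have := hτ r le_rfl (i + 1) hi
      omega)
    rwa [zero_add] at this
  have hP : ∀ i < r, Grid.Active (curveGrid f₁ f₂) I J x y (τ (i + 1) - τ i)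
      (fun j => Y (τ i + j)) (w i) → IsPSegment f₁ f₂ γ (u i) (u (i + 1)) ∧
        ∫ z in u i..u (i + 1), overlap f₁ f₂ (fun z => (γ z).1) (fun z => (γ z).2) z = w i := by
    rintro i hi ⟨k, hp, hY, hv⟩
    have hf := (hsub i hi).congr hY
    have hle := u1 (i + 1) hi
    rw [ustep i hi] at hle ⊢
    exact ⟨isPSegment_of_follows ho hp hf h0 (u0 i) hle,
      (integral_overlap_of_active ho h₁ h₂ hp hf h0 (u0 i) hle).trans hv.symm⟩
  have hN : ∀ i < r, Grid.Idle (curveGrid f₁ f₂) I J x y (τ (i + 1) - τ i)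
      (fun j => Y (τ i + j)) (w i) → IsNSegment f₁ f₂ γ (u i) (u (i + 1)) ∧
        ∫ z in u i..u (i + 1), overlap f₁ f₂ (fun z => (γ z).1) (fun z => (γ z).2) z = w i := by
    rintro i hi ⟨a, b, hab, hn, hv, hY0, hY2, hY1⟩
    have hf := hsub i hi
    have hle := u1 (i + 1) hi
    rw [ustep i hi, hn] at hle ⊢
    rw [hn] at hf
    push_cast at hle ⊢
    have hseg := isNSegment_of_follows ho hab hY0 hY2 hY1 hf h0 (u0 i) hle
    exact ⟨hseg, (hseg.integral_overlap h₁ h₂).trans hv.symm⟩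
  have hint : ∫ z in (0 : ℝ)..1, overlap f₁ f₂ (fun z => (γ z).1) (fun z => (γ z).2) z =
      (curveGrid f₁ f₂).totalGain I J x y := by
    have key : ∀ k ≤ r, ∫ z in (0 : ℝ)..u k,
        overlap f₁ f₂ (fun z => (γ z).1) (fun z => (γ z).2) z = ∑ i ∈ Finset.range k, w i := by
      intro k hk
      induction k with
      | zero => simp [hu, hR.zero]
      | succ k ih =>
        have hlt : u k ≤ u (k + 1) := by
          rw [ustep k hk]
          exact le_add_of_nonneg_right (by positivity)
        rw [integral_overlap_add h₁ h₂ le_rfl (u0 k) hlt (u1 (k + 1) hk), ih (by omega),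
          Finset.sum_range_succ]
        congr 1
        rcases hR.piece k hk with hA | hB
        · exact (hP k hk hA).2
        · exact (hN k hk hB).2
    have := key r le_rfl
    simp only [hu, hr1] at this
    rw [this, hw, Grid.totalGain, Finset.range_eq_Ico]
  have hmax := fun v (hv : (curveGrid f₁ f₂).Reach 0 1 v) => (ho.reach_le hv).trans hint.ge
  refine ⟨γ, isOptimalMatching_of_le hmax h₁ h₂ le_rfl, hmax, r, u, ⟨by simp [hu, hR.zero], hr1,
    fun i hi => ?_⟩, fun i hi => ?_, fun i hi => ?_⟩
  · have : (τ i : ℝ) < τ (i + 1) := by exact_mod_cast hR.lt i hi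
    simp only [hu]
    gcongr
  · exact (hR.piece i hi).imp (fun hA => (hP i hi hA).1) fun hB => (hN i hi hB).1
  · rintro ⟨n1, n2⟩
    rcases hR.alternate i hi with hA | hA
    · exact (hP i (by omega) hA).1.not_isNSegment n1
    · exact (hP (i + 1) hi hA).1.not_isNSegment n2

end Main

end ElasticMatching

theorem mainTheorem1 (N : ℕ) (f₁ f₂ : ElasticMatching.PLCurve N) :
    (∃ γ : ℝ → ℝ × ℝ, ElasticMatching.IsOptimalMatching f₁ f₂ γ ∧
      (∃ (k : ℕ) (u : ℕ → ℝ), ElasticMatching.IsPartition 0 1 k u ∧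
        (∀ i < k, ElasticMatching.IsPSegment f₁ f₂ γ (u i) (u (i + 1)) ∨
          ElasticMatching.IsNSegment f₁ f₂ γ (u i) (u (i + 1))) ∧
        (∀ i, i + 1 < k → ¬ (ElasticMatching.IsNSegment f₁ f₂ γ (u i) (u (i + 1)) ∧
          ElasticMatching.IsNSegment f₁ f₂ γ (u (i + 1)) (u (i + 2))))) ∧
      (∀ (u₁ u₂ u₃ u₄ : ℝ) (i₁ j₁ i₂ j₂ : ℕ),
        ElasticMatching.ConsecutivePSegments f₁ f₂ γ u₁ u₂ u₃ u₄ i₁ j₁ i₂ j₂ →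
        ∃ μ ∈ ElasticMatching.muInterval
            (ElasticMatching.weight f₁ f₂ i₁ j₁)
            (ElasticMatching.weight f₁ f₂ (i₂ + 1) (j₂ + 1))
            (ElasticMatching.weight f₁ f₂ i₁ (j₂ + 1))
            (ElasticMatching.weight f₁ f₂ (i₂ + 1) j₁),
          ElasticMatching.blockSlope f₁ f₂ γ u₃ u₄ (i₂ + 1) (j₂ + 1) =
            μ ^ 2 * ElasticMatching.blockSlope f₁ f₂ γ u₁ u₂ i₁ j₁)) ∧
    (∀ i₁ j₁ i₂ j₂ : ℕ,
      ElasticMatching.IsBlock f₁ f₂ i₁ j₁ → ElasticMatching.IsBlock f₁ f₂ (i₂ + 1) (j₂ + 1) →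
      0 < ElasticMatching.weight f₁ f₂ i₁ j₁ →
      0 < ElasticMatching.weight f₁ f₂ (i₂ + 1) (j₂ + 1) →
      0 < ElasticMatching.weight f₁ f₂ i₁ (j₂ + 1) →
      0 < ElasticMatching.weight f₁ f₂ (i₂ + 1) j₁ →
      ElasticMatching.weight f₁ f₂ i₁ j₁ * ElasticMatching.weight f₁ f₂ (i₂ + 1) (j₂ + 1) <
        ElasticMatching.weight f₁ f₂ i₁ (j₂ + 1) * ElasticMatching.weight f₁ f₂ (i₂ + 1) j₁ →
      ElasticMatching.muInterval
          (ElasticMatching.weight f₁ f₂ i₁ j₁)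
          (ElasticMatching.weight f₁ f₂ (i₂ + 1) (j₂ + 1))
          (ElasticMatching.weight f₁ f₂ i₁ (j₂ + 1))
          (ElasticMatching.weight f₁ f₂ (i₂ + 1) j₁) = ∅ ∧
        ¬ ∃ γ : ℝ → ℝ × ℝ, ElasticMatching.IsOptimalMatching f₁ f₂ γ ∧
          ∃ u₁ u₂ u₃ u₄ : ℝ,
            ElasticMatching.ConsecutivePSegments f₁ f₂ γ u₁ u₂ u₃ u₄ i₁ j₁ i₂ j₂) := by
  obtain ⟨γ, hγ, hmax, hpart⟩ := ElasticMatching.exists_matching f₁ f₂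
  refine ⟨⟨γ, hγ, hpart, fun u₁ u₂ u₃ u₄ i₁ j₁ i₂ j₂ hcons => hγ.exists_mu hmax hcons⟩, ?_⟩
  intro i₁ j₁ i₂ j₂ _ _ hA hB hC hD h
  have hempty := ElasticMatching.muInterval_eq_empty hA hB hC hD h
  refine ⟨hempty, ?_⟩
  rintro ⟨γ', hγ', u₁, u₂, u₃, u₄, hcons⟩
  -- Any optimal matching has at least the overlap of the constructed one, so it also dominates all
  -- chains and is subject to the slope condition.
  obtain ⟨μ, hμ, -⟩ := hγ'.exists_mu
    (fun v hv => (hmax v hv).trans (hγ'.le_overlap hγ.1 hγ.2.1)) hcons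
  rw [hempty] at hμ
  exact hμ
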